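/- Let $k\ge 1$ and let $M$ be a smooth manifold of dimension $n$ whose formal loop space carries a homogeneous local (Dubrovin–Novikov) Poisson bracket of degree $k$. That is, for every local coordinate system $u=(u^1,\dots,u^n)$ on $M$ one is given a bracket $$\{u^i(x),u^j(y)\}=\sum_{s=0}^k P_s^{ij}\,\delta^{(s)}(x-y),$$ where $P_s^{ij}$ is a differential polynomial (a polynomial in the jet variables $u^{l,r}$, $r\ge1$, with coefficients smooth functions of $u$) which is homogeneous of degree $k-s$ for the grading $\deg u^{l,r}=r$. The bracket is skew-symmetric and satisfies the Jacobi identity, as identities of distributions with differential polynomial coefficients, where it is extended to differential polynomials by the Leibniz rule and by compatibility with $\partial_x=\sum_{r\ge0}u^{l,r+1}\,\partial/\partial u^{l,r}$ (with $u^{l,0}=u^l$). Under a change of coordinates $\tilde u=\tilde u(u)$ the coefficients obey $$\tilde P_s^{ij}=\sum_{t\ge0}\binom{s+t}{s}\frac{\partial\tilde u^i}{\partial u^{i'}}\,P_{s+t}^{i'j'}\,\partial_x^t\Big(\frac{\partial\tilde u^j}{\partial u^{j'}}\Big),\qquad \tilde u^{l,r}=\partial_x^r\,\tilde u^l .$$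 Let $g^{ij}=P_k^{ij}$, and for $0\le s\le k-1$ let $h_{(s)l}^{ij}$ be the coefficient of $u^{l,k-s}$ in $P_s^{ij}$ (both are smooth functions of $u$). Assume that the matrix $(g^{ij})$ is invertible at every point, with inverse $(g_{ij})$, and put $$\Gamma_{(s)ij}^l=-\binom ks^{-1}g_{ii'}\,h_{(s)j}^{i'l},\qquad 0\le s\le k-1 .$$ Then for each $t=0,\dots,k-1$ there is a connection $\nabla^{(t)}$ on $TM$ with $\nabla^{(t)}_{\partial_i}\partial_j=\Gamma_{(t)ij}^l\,\partial_l$ in every coordinate system; these are the standard connections of the bracket. Moreover, the $k$ connections $$\nabla^{[s]}=\sum_{t=0}^{s}c_s^t\,\nabla^{(t)},\qquad c_s^t=(-1)^t\binom{k+s-t}{k}\binom kt,\qquad s=0,\dots,k-1,$$ (these are connections because $\sum_{t=0}^s c_s^t=1$) are all flat: their curvature $R(X,Y)Z=\nabla_X\nabla_YZ-\nabla_Y\nabla_XZ-\nabla_{[X,Y]}Z$ vanishes identically. -/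

import Mathlib

open scoped Manifold ContDiff
open TopologicalSpace

noncomputable section

namespace LocalPoisson

/-! ### Differential polynomials -/

/-- Apply an additive map to every coefficient of a polynomial. -/
def coeffwise {σ A : Type*} [CommSemiring A] (d : A → A) (f : MvPolynomial σ A) :
    MvPolynomial σ A :=
  ∑ m ∈ f.support, MvPolynomial.monomial m (d (f.coeff m))

/-- Differential polynomials in `n` dependent variables over a ring `R` of functions of
`u¹, …, uⁿ`.  The generator with index `(i, s)` is the jet variable `u^{i, s+1}`. -/
abbrev DiffPoly (n : ℕ) (R : Type*) [CommRing R] : Type _ := MvPolynomial (Fin n × ℕ) R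

section DifferentialAlgebra

variable {n : ℕ} {R : Type*} [CommRing R] [Algebra ℝ R]

/-- The partial derivative `∂/∂u^{i,s}` of a differential polynomial, where `D i` is `∂/∂u^i` on
functions of `u¹, …, uⁿ` and `u^{i,0} = u^i`. -/
def jetDeriv (D : Fin n → Derivation ℝ R R) (i : Fin n) : ℕ → DiffPoly n R → DiffPoly n R
  | 0, f => coeffwise (D i) f
  | s + 1, f => MvPolynomial.pderiv (i, s) f

/-- The total derivative `∂ₓ = ∑_{s ≥ 0} u^{i,s+1} ∂/∂u^{i,s}`; the first sum is the part `s = 0`,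
the derivation in the second summand is the part `s ≥ 1`. -/
def totalDeriv (D : Fin n → Derivation ℝ R R) (f : DiffPoly n R) : DiffPoly n R :=
  (∑ i, MvPolynomial.X (i, 0) * jetDeriv D i 0 f) +
    MvPolynomial.mkDerivation R (fun v : Fin n × ℕ => MvPolynomial.X (v.1, v.2 + 1)) f

/-! ### Local distributions

A distribution `∑ A_{a,b}(x) δ^{(a)}(x-y) δ^{(b)}(x-z)`, with `A_{a,b}` differential polynomials, is
encoded by its symbol `∑ A_{a,b} λ^a μ^b`; a distribution `∑ A_a(x) δ^{(a)}(x-y)` is the special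
case where `μ` does not occur.  The operators `∂_y` and `∂_z` act on symbols as multiplication by
`-λ` and `-μ`, and `∂_x` acts as `λ + μ + ∂`, where `∂` is the total derivative of the
coefficients. -/

/-- Symbols of local distributions in three points. -/
abbrev Symbol (n : ℕ) (R : Type*) [CommRing R] : Type _ := MvPolynomial (Fin 2) (DiffPoly n R)

/-- The variable `λ`, dual to `y`. -/
def lam : Symbol n R := MvPolynomial.X 0

/-- The variable `μ`, dual to `z`. -/
def mu : Symbol n R := MvPolynomial.X 1

/-- The operator `κ + ∂` on symbols. -/
def shift (D : Fin n → Derivation ℝ R R) (κ : Symbol n R) (T : Symbol n R) : Symbol n R :=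
  κ * T + coeffwise (totalDeriv D) T

/-- The operator `-(κ + ∂)` on symbols. -/
def negShift (D : Fin n → Derivation ℝ R R) (κ : Symbol n R) (T : Symbol n R) : Symbol n R :=
  -(shift D κ T)

/-- The symbol of `{u^i(x), u^j(y)} = ∑_{s ≤ k} P_s^{ij}(x) δ^{(s)}(x-y)`. -/
def bracketSymbol (k : ℕ) (P : ℕ → Fin n → Fin n → DiffPoly n R) (i j : Fin n) : Symbol n R :=
  ∑ s ∈ Finset.range (k + 1), MvPolynomial.C (P s i j) * lam ^ s

/-- The symbol of `{u^j(y), u^i(x)} = ∑_{s ≤ k} P_s^{ji}(y) δ^{(s)}(y-x)`. -/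
def swappedBracketSymbol (D : Fin n → Derivation ℝ R R) (k : ℕ)
    (P : ℕ → Fin n → Fin n → DiffPoly n R) (i j : Fin n) : Symbol n R :=
  ∑ s ∈ Finset.range (k + 1), (negShift D lam)^[s] (MvPolynomial.C (P s j i))

/-- Skew-symmetry `{u^i(x), u^j(y)} = -{u^j(y), u^i(x)}`. -/
def IsSkew (D : Fin n → Derivation ℝ R R) (k : ℕ) (P : ℕ → Fin n → Fin n → DiffPoly n R) :
    Prop :=
  ∀ i j, bracketSymbol k P i j = -swappedBracketSymbol D k P i j

/-- The symbol of `{{u^i(x), u^j(y)}, u^l(z)}`, where the bracket is extended to differential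
polynomials by the Leibniz rule and by commutation with `∂ₓ`:
`∑ ∂P_s^{ij}/∂u^{m,p}(x) ∂ₓ^p ({u^m(x), u^l(z)}) δ^{(s)}(x-y)`.
The differential polynomials `P_s^{ij}` are assumed not to involve `u^{m,p}` with `p > k`. -/
def doubleBracket (D : Fin n → Derivation ℝ R R) (k : ℕ)
    (P : ℕ → Fin n → Fin n → DiffPoly n R) (i j l : Fin n) : Symbol n R :=
  ∑ s ∈ Finset.range (k + 1), ∑ m, ∑ p ∈ Finset.range (k + 1),
    MvPolynomial.C (jetDeriv D m p (P s i j)) * lam ^ s *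
      (shift D mu)^[p] (∑ r ∈ Finset.range (k + 1), MvPolynomial.C (P r m l) * mu ^ r)

/-- If `T` is the symbol of `∑ A_{a,b}(x) δ^{(a)}(x-y) δ^{(b)}(x-z)`, this is the symbol of
`∑ A_{a,b}(y) δ^{(a)}(y-z) δ^{(b)}(y-x)`, the distribution obtained by the cyclic renaming
`x → y → z → x`. -/
def rotate (D : Fin n → Derivation ℝ R R) (T : Symbol n R) : Symbol n R :=
  ∑ m ∈ T.support, mu ^ (m 0) * (negShift D (lam + mu))^[m 1] (MvPolynomial.C (T.coeff m))

/-- If `T` is the symbol of `∑ A_{a,b}(x) δ^{(a)}(x-y) δ^{(b)}(x-z)`, this is the symbol of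
`∑ A_{a,b}(z) δ^{(a)}(z-x) δ^{(b)}(z-y)`, the distribution obtained by the cyclic renaming
`x → z → y → x`. -/
def rotateInv (D : Fin n → Derivation ℝ R R) (T : Symbol n R) : Symbol n R :=
  ∑ m ∈ T.support, lam ^ (m 1) * (negShift D (lam + mu))^[m 0] (MvPolynomial.C (T.coeff m))

/-- The Jacobi identity
`{{u^i(x),u^j(y)},u^l(z)} + {{u^j(y),u^l(z)},u^i(x)} + {{u^l(z),u^i(x)},u^j(y)} = 0`. -/
def IsJacobi (D : Fin n → Derivation ℝ R R) (k : ℕ) (P : ℕ → Fin n → Fin n → DiffPoly n R) :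
    Prop :=
  ∀ i j l, doubleBracket D k P i j l + rotate D (doubleBracket D k P j l i) +
    rotateInv D (doubleBracket D k P l i j) = 0

/-- Substitution of the jet variables `ũ^{i,s} = ∂ₓ^s ũ^i(u)`, where `v i` is the function
`ũ^i(u)`. -/
def jetSubst (D : Fin n → Derivation ℝ R R) (v : Fin n → R) : DiffPoly n R →+* DiffPoly n R :=
  MvPolynomial.eval₂Hom MvPolynomial.C
    (fun w => (totalDeriv D)^[w.2 + 1] (MvPolynomial.C (v w.1)))

end DifferentialAlgebra

/-! ### Smooth functions on coordinate domains -/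

section Charts

variable {n : ℕ} {M : Type*} [TopologicalSpace M] [ChartedSpace (EuclideanSpace ℝ (Fin n)) M]

/-- The algebra of smooth real functions on an open subset `W` of `M`. -/
abbrev Smooth (W : Opens M) : Type _ := C^∞⟮𝓡 n, W; 𝓘(ℝ, ℝ), ℝ⟯

variable (n M) in
/-- The local coordinate systems `(u¹, …, uⁿ)` of `M`: all charts of the maximal smooth atlas. -/
abbrev Coord : Type _ :=
  {e : OpenPartialHomeomorph M (EuclideanSpace ℝ (Fin n)) //
    e ∈ IsManifold.maximalAtlas (𝓡 n) ∞ M}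

/-- The domain of a coordinate system. -/
def Coord.dom (e : Coord n M) : Opens M := ⟨e.1.source, e.1.open_source⟩

/-- Extension by zero of a function on `W`. -/
def extendZero {W : Opens M} (f : W → ℝ) : M → ℝ := Function.extend Subtype.val f 0

lemma extendZero_apply {W : Opens M} (f : W → ℝ) (x : W) : extendZero f x = f x :=
  Subtype.val_injective.extend_apply f 0 x

lemma contMDiffAt_extendZero {W : Opens M} (f : Smooth (n := n) W) {x : M} (hx : x ∈ W) :
    ContMDiffAt (𝓡 n) 𝓘(ℝ, ℝ) ∞ (extendZero f) x := by
  have h : ContMDiffAt (𝓡 n) 𝓘(ℝ, ℝ) ∞ (fun y : W => extendZero f y) ⟨x, hx⟩ := by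
    have : (fun y : W => extendZero f y) = f := funext (extendZero_apply f)
    rw [this]
    exact f.contMDiff.contMDiffAt
  exact contMDiffAt_subtype_iff.1 h

lemma contDiffAt_extendZero (e : Coord n M) {W : Opens M} (hW : W ≤ e.dom)
    (f : Smooth (n := n) W) {x : M} (hx : x ∈ W) :
    ContDiffAt ℝ ∞ (extendZero f ∘ e.1.symm) (e.1 x) := by
  rw [← contMDiffAt_iff_contDiffAt]
  have hxe : x ∈ e.1.source := hW hx
  have h1 := contMDiffAt_symm_of_mem_maximalAtlas e.2 (e.1.map_source hxe)
  refine ContMDiffAt.comp (e.1 x) ?_ h1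
  rw [e.1.left_inv hxe]
  exact contMDiffAt_extendZero f hx

/-- The partial derivative `∂f/∂u^i` of a function on `W` in the coordinate system `e`. -/
def partialFun (e : Coord n M) {W : Opens M} (i : Fin n) (f : W → ℝ) (x : W) : ℝ :=
  fderiv ℝ (extendZero f ∘ e.1.symm) (e.1 x) (EuclideanSpace.single i 1)

lemma contMDiff_partialFun (e : Coord n M) {W : Opens M} (hW : W ≤ e.dom) (i : Fin n)
    (f : Smooth (n := n) W) : ContMDiff (𝓡 n) 𝓘(ℝ, ℝ) ∞ (partialFun e i f) := by
  intro x
  have hx : x.1 ∈ e.1.source := hW x.2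
  have h1 : ContDiffAt ℝ ∞ (fun v => fderiv ℝ (extendZero f ∘ e.1.symm) v
      (EuclideanSpace.single i 1)) (e.1 x) :=
    ((contDiffAt_extendZero e hW f x.2).fderiv_right (m := ∞) (by simp)).clm_apply
      contDiffAt_const
  have h2 : ContMDiffAt (𝓡 n) 𝓘(ℝ, ℝ) ∞ (fun y : M => fderiv ℝ (extendZero f ∘ e.1.symm) (e.1 y)
      (EuclideanSpace.single i 1)) x.1 :=
    ContMDiffAt.comp x.1 h1.contMDiffAt (contMDiffAt_of_mem_maximalAtlas e.2 hx)
  exact contMDiffAt_subtype_iff.2 h2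

lemma extendZero_add {W : Opens M} (f g : W → ℝ) :
    extendZero (f + g) = extendZero f + extendZero g := by
  simpa [extendZero] using Function.extend_add Subtype.val f g (0 : M → ℝ) 0

lemma extendZero_smul {W : Opens M} (c : ℝ) (f : W → ℝ) :
    extendZero (c • f) = c • extendZero f := by
  simpa [extendZero] using Function.extend_smul c Subtype.val f (0 : M → ℝ)

lemma extendZero_mul {W : Opens M} (f g : W → ℝ) :
    extendZero (f * g) = extendZero f * extendZero g := by
  simpa [extendZero] using Function.extend_mul Subtype.val f g (0 : M → ℝ) 0

lemma partialFun_add (e : Coord n M) {W : Opens M} (hW : W ≤ e.dom) (i : Fin n)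
    (f g : Smooth (n := n) W) (x : W) :
    partialFun e i (f + g) x = partialFun e i f x + partialFun e i g x := by
  have hf := (contDiffAt_extendZero e hW f x.2).differentiableAt (by simp)
  have hg := (contDiffAt_extendZero e hW g x.2).differentiableAt (by simp)
  have : extendZero (⇑(f + g)) ∘ e.1.symm = extendZero f ∘ e.1.symm + extendZero g ∘ e.1.symm := by
    rw [ContMDiffMap.coe_add, extendZero_add]; rfl
  simp only [partialFun]
  rw [this, fderiv_add hf hg]
  rfl

lemma partialFun_smul (e : Coord n M) {W : Opens M} (hW : W ≤ e.dom) (i : Fin n) (c : ℝ)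
    (f : Smooth (n := n) W) (x : W) :
    partialFun e i (c • f) x = c * partialFun e i f x := by
  have hf := (contDiffAt_extendZero e hW f x.2).differentiableAt (by simp)
  have : extendZero (⇑(c • f)) ∘ e.1.symm = c • (extendZero f ∘ e.1.symm) := by
    rw [ContMDiffMap.coe_smul, extendZero_smul]; rfl
  simp only [partialFun]
  rw [this, fderiv_const_smul hf]
  rfl

lemma partialFun_mul (e : Coord n M) {W : Opens M} (hW : W ≤ e.dom) (i : Fin n)
    (f g : Smooth (n := n) W) (x : W) :
    partialFun e i (f * g) x = f x * partialFun e i g x + g x * partialFun e i f x := by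
  have hf := (contDiffAt_extendZero e hW f x.2).differentiableAt (by simp)
  have hg := (contDiffAt_extendZero e hW g x.2).differentiableAt (by simp)
  have : extendZero (⇑(f * g)) ∘ e.1.symm =
      (extendZero f ∘ e.1.symm) * (extendZero g ∘ e.1.symm) := by
    rw [ContMDiffMap.coe_mul, extendZero_mul]; rfl
  have hx : e.1.symm (e.1 x) = x := e.1.left_inv (hW x.2)
  simp only [partialFun]
  rw [this, fderiv_mul hf hg]
  simp [hx, extendZero_apply]

/-- The derivation `∂/∂u^i` of the algebra of smooth functions on `W`, in the coordinate system
`e`. -/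
def partialDeriv (e : Coord n M) {W : Opens M} (hW : W ≤ e.dom) (i : Fin n) :
    Derivation ℝ (Smooth (n := n) W) (Smooth (n := n) W) :=
  Derivation.mk'
    { toFun := fun f => ⟨partialFun e i f, contMDiff_partialFun e hW i f⟩
      map_add' := fun f g => by
        ext x
        exact partialFun_add e hW i f g x
      map_smul' := fun c f => by
        ext x
        exact partialFun_smul e hW i c f x }
    (fun f g => by
      ext x
      exact partialFun_mul e hW i f g x)

/-- The coordinate function `u^i` of `e`, restricted to `W`. -/
def coordFun (e : Coord n M) {W : Opens M} (hW : W ≤ e.dom) (i : Fin n) : Smooth (n := n) W :=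
  ⟨fun x => e.1 x i, by
    intro x
    have h1 : ContMDiffAt (𝓡 n) (𝓡 n) ∞ e.1 x.1 := contMDiffAt_of_mem_maximalAtlas e.2 (hW x.2)
    have h2 : ContDiff ℝ ∞ (fun v : EuclideanSpace ℝ (Fin n) => v i) := by fun_prop
    exact contMDiffAt_subtype_iff.2
      (ContMDiffAt.comp x.1 (h2.contMDiff.contMDiffAt (x := e.1 x)) h1)⟩

/-- Restriction of differential polynomials to a smaller open set. -/
def restrict {V W : Opens M} (h : W ≤ V) :
    DiffPoly n (Smooth (n := n) V) →+* DiffPoly n (Smooth (n := n) W) :=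
  MvPolynomial.map (ContMDiffMap.restrictRingHom (𝓡 n) 𝓘(ℝ, ℝ) ℝ h)

end Charts

/-! ### Homogeneous local Poisson brackets -/

section Brackets

variable (n k : ℕ) (M : Type*) [TopologicalSpace M] [ChartedSpace (EuclideanSpace ℝ (Fin n)) M]

/-- A homogeneous local Poisson bracket of degree `k` on the formal loop space of the
`n`-dimensional manifold `M`: in every coordinate system, a bracket
`{u^i(x), u^j(y)} = ∑_{s ≤ k} P_s^{ij} δ^{(s)}(x-y)` with `P_s^{ij}` a differential polynomial of
standard degree `k - s`, which is skew-symmetric and satisfies the Jacobi identity, with the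
transformation rule
`P̃_s^{ij} = ∑_t (s+t choose s) ∂ũ^i/∂u^{i'} P_{s+t}^{i'j'} ∂ₓ^t (∂ũ^j/∂u^{j'})`
under changes of coordinates `ũ = ũ(u)`. -/
structure HomogeneousPoissonBracket where
  /-- The coefficients `P_s^{ij}` in each coordinate system. -/
  P : (e : Coord n M) → ℕ → Fin n → Fin n → DiffPoly n (Smooth (n := n) e.dom)
  vanish : ∀ e s i j, k < s → P e s i j = 0
  homogeneous : ∀ e s i j, s ≤ k →
    MvPolynomial.IsWeightedHomogeneous (fun v : Fin n × ℕ => v.2 + 1) (P e s i j) (k - s)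
  skew : ∀ e, IsSkew (partialDeriv e le_rfl) k (P e)
  jacobi : ∀ e, IsJacobi (partialDeriv e le_rfl) k (P e)
  transform : ∀ (e e' : Coord n M) (s : ℕ) (i j : Fin n), s ≤ k →
    jetSubst (partialDeriv e (inf_le_left : e.dom ⊓ e'.dom ≤ e.dom))
        (coordFun e' (inf_le_right : e.dom ⊓ e'.dom ≤ e'.dom))
        (restrict inf_le_right (P e' s i j)) =
      ∑ t ∈ Finset.range (k - s + 1), ∑ i', ∑ j',
        ((s + t).choose s : DiffPoly n (Smooth (n := n) (e.dom ⊓ e'.dom))) *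
          MvPolynomial.C (partialDeriv e inf_le_left i' (coordFun e' inf_le_right i)) *
          restrict inf_le_left (P e (s + t) i' j') *
          (totalDeriv (partialDeriv e inf_le_left))^[t]
            (MvPolynomial.C (partialDeriv e inf_le_left j' (coordFun e' inf_le_right j)))

end Brackets

namespace HomogeneousPoissonBracket

variable {n k : ℕ} {M : Type*} [TopologicalSpace M] [ChartedSpace (EuclideanSpace ℝ (Fin n)) M]

/-- The leading coefficients `g^{ij}`, that is `P_k^{ij}`. -/
def g (B : HomogeneousPoissonBracket n k M) (e : Coord n M) (i j : Fin n) :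
    Smooth (n := n) e.dom :=
  MvPolynomial.coeff 0 (B.P e k i j)

/-- The matrix `(g^{ij}(x))`. -/
def gMatrix (B : HomogeneousPoissonBracket n k M) (e : Coord n M) (x : e.dom) :
    Matrix (Fin n) (Fin n) ℝ :=
  Matrix.of fun i j => B.g e i j x

/-- The leading coefficient is nondegenerate. -/
def Nondegenerate (B : HomogeneousPoissonBracket n k M) : Prop :=
  ∀ (e : Coord n M) (x : e.dom), (B.gMatrix e x).det ≠ 0

/-- For `s < k`, the coefficient `h_{(s)l}^{ij}` of `u^{l,k-s}` in `P_s^{ij}`. -/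
def h (B : HomogeneousPoissonBracket n k M) (e : Coord n M) (s : ℕ) (i j l : Fin n) :
    Smooth (n := n) e.dom :=
  MvPolynomial.coeff (Finsupp.single (l, k - s - 1) 1) (B.P e s i j)

/-- The symbols `Γ_{(s)ij}^l = - (k choose s)⁻¹ g_{ii'} h_{(s)j}^{i'l}`, for `s < k`, where
`(g_{ij})` is the inverse of the matrix `(g^{ij})`. -/
def christoffel (B : HomogeneousPoissonBracket n k M) (e : Coord n M) (s : ℕ) (i j l : Fin n)
    (x : e.dom) : ℝ :=
  -((k.choose s : ℝ)⁻¹ * ∑ i', (B.gMatrix e x)⁻¹ i i' * B.h e s i' l j x)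

end HomogeneousPoissonBracket

/-! ### Connections -/

section Connections

variable {n : ℕ} {M : Type*} [TopologicalSpace M] [ChartedSpace (EuclideanSpace ℝ (Fin n)) M]
  [IsManifold (𝓡 n) ∞ M]

variable (n M) in
/-- Connections on the tangent bundle of `M`. In Mathlib, `∇ Z x v` is `∇_v Z` at `x`. -/
abbrev Connection : Type _ :=
  CovariantDerivative (𝓡 n) (EuclideanSpace ℝ (Fin n)) (fun x : M => TangentSpace (𝓡 n) x)

/-- The coordinate vector field `∂/∂u^i` of a coordinate system (meaningful on its domain). -/
def coordField (e : Coord n M) (i : Fin n) (x : M) : TangentSpace (𝓡 n) x :=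
  VectorField.mpullback (𝓡 n) 𝓘(ℝ, EuclideanSpace ℝ (Fin n)) e.1
    (fun _ => (EuclideanSpace.single i 1 : EuclideanSpace ℝ (Fin n))) x

/-- `∇` is the `s`-th standard connection of the bracket: in every coordinate system,
`∇_{∂_i} ∂_j = Γ_{(s)ij}^l ∂_l`. -/
def IsStandardConnection {k : ℕ} (B : HomogeneousPoissonBracket n k M) (s : ℕ)
    (nabla : Connection n M) : Prop :=
  ∀ (e : Coord n M) (i j : Fin n) (x : e.dom),
    nabla (coordField e j) x (coordField e i x) =
      ∑ l, B.christoffel e s i j l x • coordField e l x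

/-- The vector field `X` is smooth on the open set `U`. -/
def IsSmoothFieldOn (X : (x : M) → TangentSpace (𝓡 n) x) (U : Opens M) : Prop :=
  ContMDiffOn (𝓡 n) (𝓡 n).tangent ∞ (fun x => (⟨x, X x⟩ : TangentBundle (𝓡 n) M)) U

/-- The curvature `R(X, Y) Z = ∇_X ∇_Y Z - ∇_Y ∇_X Z - ∇_{[X, Y]} Z` at `x`. -/
def curvature (nabla : Connection n M) (X Y Z : (x : M) → TangentSpace (𝓡 n) x) (x : M) :
    TangentSpace (𝓡 n) x :=
  nabla (fun y => nabla Z y (Y y)) x (X x) - nabla (fun y => nabla Z y (X y)) x (Y x) -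
    nabla Z x (VectorField.mlieBracket (𝓡 n) X Y x)

/-- A connection is flat if its curvature vanishes: `R(X, Y) Z = 0` at `x` for all vector fields
`X`, `Y`, `Z` which are smooth on a
neighbourhood of `x`. -/
def IsFlat (nabla : Connection n M) : Prop :=
  ∀ (U : Opens M) (X Y Z : (x : M) → TangentSpace (𝓡 n) x),
    IsSmoothFieldOn X U → IsSmoothFieldOn Y U → IsSmoothFieldOn Z U →
    ∀ x ∈ U, curvature nabla X Y Z x = 0

/-- The constants `c_s^t = (-1)^t (k+s-t choose k) (k choose t)`, for `t ≤ s`. -/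
def flatCoeff (k s t : ℕ) : ℝ := (-1) ^ t * ((k + s - t).choose k : ℝ) * (k.choose t : ℝ)

lemma sum_flatCoeff (k s : ℕ) : ∑ t ∈ Finset.range (s + 1), flatCoeff k s t = 1 := by
  open PowerSeries in
  have h1 : (mk fun m ↦ ((k + m).choose k : ℝ)) * (1 - X) ^ (k + 1) = 1 :=
    mk_add_choose_mul_one_sub_pow_eq_one ℝ k
  have h2 : (mk fun m ↦ ((0 + m).choose 0 : ℝ)) * (1 - X) ^ (0 + 1) = 1 :=
    mk_add_choose_mul_one_sub_pow_eq_one ℝ 0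
  have h3 : (1 - X : ℝ⟦X⟧) ^ k = mk fun t ↦ (-1) ^ t * (k.choose t : ℝ) := by
    have h0 : (1 - X : ℝ⟦X⟧) ^ k =
        rescale (-1 : ℝ) (((1 + Polynomial.X : Polynomial ℝ) ^ k : Polynomial ℝ) : ℝ⟦X⟧) := by
      simp [sub_eq_add_neg]
    ext t
    rw [h0, coeff_rescale, Polynomial.coeff_coe, Polynomial.coeff_one_add_X_pow, coeff_mk]
  have h4 : (mk fun m ↦ ((k + m).choose k : ℝ)) * (1 - X) ^ k = mk fun _ ↦ (1 : ℝ) := by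
    have h5 : (mk fun m ↦ ((0 + m).choose 0 : ℝ)) = mk fun _ ↦ (1 : ℝ) := by simp
    rw [h5] at h2
    calc _ = (mk fun m ↦ ((k + m).choose k : ℝ)) * (1 - X) ^ k *
            ((mk fun _ ↦ (1 : ℝ)) * (1 - X) ^ (0 + 1)) := by rw [h2, mul_one]
      _ = ((mk fun m ↦ ((k + m).choose k : ℝ)) * (1 - X) ^ (k + 1)) * mk fun _ ↦ (1 : ℝ) := by
          ring
      _ = _ := by rw [h1, one_mul]
  have h6 := congrArg (coeff s) h4
  rw [h3, mul_comm, coeff_mul, Finset.Nat.sum_antidiagonal_eq_sum_range_succ_mk] at h6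
  simp only [coeff_mk] at h6
  rw [← h6]
  refine Finset.sum_congr rfl fun t ht => ?_
  have : t ≤ s := Nat.lt_succ_iff.1 (Finset.mem_range.1 ht)
  rw [flatCoeff, Nat.add_sub_assoc this]
  ring

/-- The connection `∇^{[s]} = ∑_{t ≤ s} c_s^t ∇^{(t)}`. -/
def quadConnection (k s : ℕ) (nabla : ℕ → Connection n M) : Connection n M :=
  CovariantDerivative.finiteAffineCombination nabla (s := Finset.range (s + 1))
    (f := fun t _ => flatCoeff k s t)
    (by funext x; simpa using sum_flatCoeff k s)

end Connections

end LocalPoisson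

end

/-!
The proof extracts from the axioms of the bracket only the part of lowest order in the jet
variables. Restricting to a constant map, with a first-order deformation `u^{q,a} ↦ ε α^a` of the
jets of one coordinate `u^q`, gives a ring homomorphism `jetAlong` from differential polynomials to
dual numbers under which `∂ₓ` becomes multiplication by `α`. A symbol of a local distribution is
thereby turned into a polynomial, and the bracket into the two data `g^{ij} λ^k` and
`∑_s c_s α^{k-s} λ^s`, where `c_s` is the coefficient of `u^{q,k-s}` in `P_s^{ij}` for `s < k`, and
`c_k = ∂g^{ij}/∂u^q`.

*Flatness.* The expansion of the Jacobi identity is polynomial in `λ, μ, ν`, the variables dual to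
the three points, with `α = -(λ + μ + ν)`. The coefficients of the `P_s^{ij}` which are quadratic in
the jets occur only with a factor `λ^{k+1}`, `μ^{k+1}` or `ν^{k+1}`. Hence, for `s < k`, the
coefficient of `λ^k μ^s ν^k` after multiplication by `(λ + μ + ν)^s` involves only `g`, the `c_t` and
first derivatives of the `c_t`, and these enter through the single combination
`∑_t (-1)^{k-t} (k+s-t choose k) c_t`, which up to raising an index is the symbol of `∇^{[s]}`
(`IsJacobi.flatCoeffSum_identity`, `Nondegenerate.flatCoeffSum_eq`). The result is the vanishing of
the curvature of `∇^{[s]}`, with two indices raised by `g`, up to terms containing derivatives of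
`g`; these cancel by the part of the Jacobi identity of order zero
(`IsJacobi.leadCoeff_identity`, `curvatureSymbol_eq_zero`).

*Existence.* Expanding the transformation rule of the `P_s^{ij}` in the same way, with `α = 1`, gives
the transformation rule of the symbols of a connection (`IsTransformed.linCoeff`,
`Nondegenerate.christoffel_transform`), so the connections defined by the symbols in each chart
agree on overlaps.

The passage between symbols and connections on the tangent bundle rests on the operator `chartCov`,
the covariant derivative with given symbols in one chart: a connection is determined by its values
on coordinate fields (`connection_eq_chartCov`), and its curvature is computed in the chart
(`curvature_eq_zero_of_chart`).
-/

noncomputable section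

namespace LocalPoisson

/-! ### First-order expansion of differential polynomials at a constant -/

theorem coeff_coeffwise {σ A : Type*} [CommSemiring A] {d : A → A} (hd : d 0 = 0)
    (f : MvPolynomial σ A) (m : σ →₀ ℕ) : (coeffwise d f).coeff m = d (f.coeff m) := by
  classical
  rw [coeffwise, MvPolynomial.coeff_sum]
  simp only [MvPolynomial.coeff_monomial]
  rw [Finset.sum_ite_eq' f.support m]
  split_ifs with h
  · rfl
  · rw [MvPolynomial.notMem_support_iff.1 h, hd]

theorem constantCoeff_coeffwise {σ A : Type*} [CommSemiring A] {d : A → A} (hd : d 0 = 0)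
    (f : MvPolynomial σ A) :
    MvPolynomial.constantCoeff (coeffwise d f) = d (MvPolynomial.constantCoeff f) :=
  coeff_coeffwise hd f 0

theorem isWeightedHomogeneous_coeffwise {σ A : Type*} [CommSemiring A] {d : A → A} (hd : d 0 = 0)
    {w : σ → ℕ} {f : MvPolynomial σ A} {N : ℕ} (hf : f.IsWeightedHomogeneous w N) :
    (coeffwise d f).IsWeightedHomogeneous w N := by
  intro m hm
  refine hf (d := m) fun h => hm ?_
  rw [coeff_coeffwise hd, h, hd]

theorem eq_C_of_isWeightedHomogeneous_zero {n : ℕ} {A : Type*} [CommRing A] {f : DiffPoly n A}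
    (hf : f.IsWeightedHomogeneous (fun v : Fin n × ℕ => v.2 + 1) 0) :
    f = MvPolynomial.C (MvPolynomial.constantCoeff f) := by
  classical
  ext m
  rw [MvPolynomial.coeff_C]
  split_ifs with h
  · rw [← h]; rfl
  · refine hf.coeff_eq_zero m fun h0 => h ?_
    ext v
    by_contra hv
    have : m v * (v.2 + 1) ≤ Finsupp.weight (fun v : Fin n × ℕ => v.2 + 1) m := by
      rw [Finsupp.weight_apply, Finsupp.sum]
      exact Finset.single_le_sum (f := fun v => m v • (v.2 + 1)) (fun _ _ => Nat.zero_le _)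
        (Finsupp.mem_support_iff.2 fun h => hv (by simp [h]))
    rw [h0] at this
    have h3 : m v = 0 := by simpa using this
    exact hv (by simp [h3])

theorem constantCoeff_mkDerivation {n : ℕ} {A : Type*} [CommRing A] (f : DiffPoly n A) :
    MvPolynomial.constantCoeff (MvPolynomial.mkDerivation A
      (fun v : Fin n × ℕ => (MvPolynomial.X (v.1, v.2 + 1) : DiffPoly n A)) f) = 0 := by
  induction f using MvPolynomial.induction_on with
  | C a => simp
  | add p r hp hr => simp [hp, hr]
  | mul_X p v hp => simp [hp, MvPolynomial.mkDerivation_X]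

section Linearization

variable {n : ℕ} {R : Type*} [CommRing R] [Algebra ℝ R]
variable {S : Type*} [CommRing S] [Algebra R S]

/-- The ring homomorphism `f ↦ f + ε δ f` attached to a derivation `δ`. -/
def dualHom (S : Type*) [CommRing S] [Algebra R S] (δ : Derivation ℝ R R) :
    R →+* DualNumber S where
  toFun f := TrivSqZeroExt.inl (algebraMap R S f) + TrivSqZeroExt.inr (algebraMap R S (δ f))
  map_one' := by ext <;> simp
  map_zero' := by ext <;> simp
  map_add' f g := by ext <;> simp [-DualNumber.inr_eq_smul_eps]
  map_mul' f g := by ext <;> simp [-DualNumber.inr_eq_smul_eps, mul_comm]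

@[simp] theorem fst_dualHom (δ : Derivation ℝ R R) (f : R) :
    (dualHom S δ f).fst = algebraMap R S f := by
  simp [dualHom, -DualNumber.inr_eq_smul_eps]

@[simp] theorem snd_dualHom (δ : Derivation ℝ R R) (f : R) :
    (dualHom S δ f).snd = algebraMap R S (δ f) := by
  simp [dualHom, -DualNumber.inr_eq_smul_eps]

/-- First-order expansion of a differential polynomial at a constant: functions are expanded in
the direction of the derivation `δ`, and the jet variable `v` is replaced by `ε w v`. -/
def jetExpand (δ : Derivation ℝ R R) (w : Fin n × ℕ → S) : DiffPoly n R →+* DualNumber S :=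
  MvPolynomial.eval₂Hom (dualHom S δ) fun v => TrivSqZeroExt.inr (w v)

variable (δ : Derivation ℝ R R) (w : Fin n × ℕ → S)

@[simp] theorem jetExpand_C (f : R) : jetExpand δ w (MvPolynomial.C f) = dualHom S δ f := by
  simp [jetExpand]

theorem fst_jetExpand_X (v : Fin n × ℕ) :
    (jetExpand δ w (MvPolynomial.X v)).fst = 0 := by
  simp only [jetExpand, MvPolynomial.coe_eval₂Hom, MvPolynomial.eval₂_X, TrivSqZeroExt.fst_inr]

@[simp] theorem snd_jetExpand_X (v : Fin n × ℕ) :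
    (jetExpand δ w (MvPolynomial.X v)).snd = w v := by
  simp only [jetExpand, MvPolynomial.coe_eval₂Hom, MvPolynomial.eval₂_X, TrivSqZeroExt.snd_inr]

theorem fst_jetExpand (f : DiffPoly n R) :
    (jetExpand δ w f).fst = algebraMap R S (MvPolynomial.constantCoeff f) := by
  induction f using MvPolynomial.induction_on with
  | C a => simp
  | add p q hp hq => simp [hp, hq]
  | mul_X p v hp => simp [fst_jetExpand_X]

theorem snd_jetExpand_monomial_eq_zero {m : Fin n × ℕ →₀ ℕ} (hm : m ≠ 0)
    (hw : ∀ v, m = Finsupp.single v 1 → w v = 0) (a : R) :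
    (jetExpand δ w (MvPolynomial.monomial m a)).snd = 0 := by
  obtain ⟨v, hv⟩ : ∃ v, m v ≠ 0 := by
    by_contra! h
    exact hm (Finsupp.ext h)
  obtain ⟨m', rfl⟩ : ∃ m', m = m' + Finsupp.single v 1 := by
    refine ⟨m - Finsupp.single v 1, (tsub_add_cancel_of_le ?_).symm⟩
    simpa using Nat.one_le_iff_ne_zero.2 hv
  have h : MvPolynomial.monomial (m' + Finsupp.single v 1) a =
      MvPolynomial.monomial m' a * MvPolynomial.X v := by
    rw [MvPolynomial.X, MvPolynomial.monomial_mul, mul_one]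
  rw [h, map_mul, DualNumber.snd_mul, snd_jetExpand_X, fst_jetExpand_X, fst_jetExpand]
  by_cases h0 : m' = 0
  · simp [hw v (by simp [h0])]
  · simp [MvPolynomial.constantCoeff_monomial, h0]

/-- Only the monomials linear in the jet variables contribute to the first order, and by
homogeneity these jet variables are the `u^{l,N+1}`. -/
theorem snd_jetExpand_of_isWeightedHomogeneous {f : DiffPoly n R} {N : ℕ}
    (hf : f.IsWeightedHomogeneous (fun v : Fin n × ℕ => v.2 + 1) (N + 1)) :
    (jetExpand δ w f).snd =
      ∑ l, algebraMap R S (f.coeff (Finsupp.single (l, N) 1)) * w (l, N) := by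
  classical
  have key : ∀ m : Fin n × ℕ →₀ ℕ, m ∈ f.support →
      (jetExpand δ w (MvPolynomial.monomial m (f.coeff m))).snd =
        ∑ l, if m = Finsupp.single (l, N) 1 then algebraMap R S (f.coeff m) * w (l, N) else 0 := by
    intro m hm
    have hwt := hf (MvPolynomial.mem_support_iff.1 hm)
    by_cases h : ∃ l, m = Finsupp.single (l, N) 1
    · obtain ⟨l, rfl⟩ := h
      rw [Finset.sum_eq_single l]
      · rw [if_pos rfl, ← mul_one (f.coeff _), ← MvPolynomial.C_mul_monomial, map_mul]
        change (_ * jetExpand δ w (MvPolynomial.X (l, N))).snd = _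
        simp [fst_jetExpand_X]
      · intro l' _ hl
        rw [if_neg]
        intro h
        have := Finsupp.single_left_injective one_ne_zero h
        simp_all
      · simp
    · rw [snd_jetExpand_monomial_eq_zero, Finset.sum_eq_zero]
      · exact fun l _ => if_neg fun hl => h ⟨l, hl⟩
      · rintro rfl
        simp at hwt
      · rintro ⟨l, a⟩ rfl
        refine absurd ⟨l, ?_⟩ h
        have : a = N := by simpa [Finsupp.weight_apply] using hwt
        rw [this]
  conv_lhs => rw [← MvPolynomial.support_sum_monomial_coeff f]
  rw [map_sum, TrivSqZeroExt.snd_sum, Finset.sum_congr rfl key, Finset.sum_comm]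
  refine Finset.sum_congr rfl fun l _ => ?_
  rw [Finset.sum_ite_eq']
  split_ifs with h
  · rfl
  · rw [MvPolynomial.notMem_support_iff.1 h]
    simp

/-- The expansion along `u^q ↦ u^q + ε`, `u^{q,a} ↦ ε α^a`, with all other jets set to zero. -/
def jetAlong (D : Fin n → Derivation ℝ R R) (q : Fin n) (α : S) : DiffPoly n R →+* DualNumber S :=
  jetExpand (D q) fun v => if v.1 = q then α ^ (v.2 + 1) else 0

variable (D : Fin n → Derivation ℝ R R) (q : Fin n) (α : S)

theorem fst_jetAlong (f : DiffPoly n R) :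
    (jetAlong D q α f).fst = algebraMap R S (MvPolynomial.constantCoeff f) :=
  fst_jetExpand _ _ f

theorem snd_jetAlong_of_isWeightedHomogeneous {f : DiffPoly n R} {N : ℕ}
    (hf : f.IsWeightedHomogeneous (fun v : Fin n × ℕ => v.2 + 1) (N + 1)) :
    (jetAlong D q α f).snd =
      algebraMap R S (f.coeff (Finsupp.single (q, N) 1)) * α ^ (N + 1) := by
  rw [jetAlong, snd_jetExpand_of_isWeightedHomogeneous _ _ hf]
  simp

theorem snd_jetAlong_C (f : R) :
    (jetAlong D q α (MvPolynomial.C f)).snd = algebraMap R S (D q f) := by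
  simp [jetAlong]

theorem snd_jetAlong_X (v : Fin n × ℕ) :
    (jetAlong D q α (MvPolynomial.X v)).snd = if v.1 = q then α ^ (v.2 + 1) else 0 := by
  simp only [jetAlong, snd_jetExpand_X]

theorem snd_jetAlong_mul (f g : DiffPoly n R) :
    (jetAlong D q α (f * g)).snd =
      algebraMap R S (MvPolynomial.constantCoeff f) * (jetAlong D q α g).snd +
        (jetAlong D q α f).snd * algebraMap R S (MvPolynomial.constantCoeff g) := by
  rw [map_mul, DualNumber.snd_mul, fst_jetAlong, fst_jetAlong]

theorem constantCoeff_totalDeriv (f : DiffPoly n R) :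
    MvPolynomial.constantCoeff (totalDeriv D f) = 0 := by
  rw [totalDeriv, map_add, constantCoeff_mkDerivation]
  simp

/-- To first order, the total derivative acts as multiplication by `α`. -/
theorem snd_jetAlong_totalDeriv (f : DiffPoly n R) :
    (jetAlong D q α (totalDeriv D f)).snd = α * (jetAlong D q α f).snd := by
  have h1 : (jetAlong D q α (∑ i, MvPolynomial.X (i, 0) * jetDeriv D i 0 f)).snd =
      α * algebraMap R S (D q (MvPolynomial.constantCoeff f)) := by
    have h (i : Fin n) : (jetAlong D q α (MvPolynomial.X (i, 0) * jetDeriv D i 0 f)).snd =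
        if i = q then α * algebraMap R S (D q (MvPolynomial.constantCoeff f)) else 0 := by
      have h3 := constantCoeff_coeffwise (map_zero (D i)) f
      rw [snd_jetAlong_mul, snd_jetAlong_X, jetDeriv, h3]
      split_ifs with hi
      · simp [← hi]
      · simp
    simp only [map_sum, TrivSqZeroExt.snd_sum, h, Finset.sum_ite_eq', Finset.mem_univ, if_true]
  have h2 : (jetAlong D q α (MvPolynomial.mkDerivation R
        (fun v : Fin n × ℕ => (MvPolynomial.X (v.1, v.2 + 1) : DiffPoly n R)) f)).snd =
      α * ((jetAlong D q α f).snd -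
        algebraMap R S (D q (MvPolynomial.constantCoeff f))) := by
    clear h1
    induction f using MvPolynomial.induction_on with
    | C a => simp [snd_jetAlong_C]
    | add p r hp hr =>
      simp only [map_add, hp, hr, TrivSqZeroExt.snd_add]
      ring
    | mul_X p v hp =>
      rw [Derivation.leibniz, smul_eq_mul, smul_eq_mul, map_add, TrivSqZeroExt.snd_add,
        snd_jetAlong_mul, snd_jetAlong_mul, snd_jetAlong_mul, hp,
        MvPolynomial.mkDerivation_X, constantCoeff_mkDerivation, snd_jetAlong_X, snd_jetAlong_X]
      simp only [map_mul, MvPolynomial.constantCoeff_X, mul_zero, map_zero]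
      split_ifs <;> ring
  rw [totalDeriv, map_add, TrivSqZeroExt.snd_add, h1, h2]
  ring

end Linearization

/-! ### First-order expansion of symbols -/

section SymbolExpansion

variable {n : ℕ} {R : Type*} [CommRing R] [Algebra ℝ R]
variable {S : Type*} [CommRing S] [Algebra R S]
variable (D : Fin n → Derivation ℝ R R) (q : Fin n) (α x y : S)

/-- The first-order expansion of a symbol, with `λ = x` and `μ = y`. -/
def symbolExpand : Symbol n R →+* DualNumber S :=
  MvPolynomial.eval₂Hom (jetAlong D q α) ![TrivSqZeroExt.inl x, TrivSqZeroExt.inl y]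

@[simp] theorem symbolExpand_C (f : DiffPoly n R) :
    symbolExpand D q α x y (MvPolynomial.C f) = jetAlong D q α f := by
  simp [symbolExpand]

@[simp] theorem symbolExpand_lam :
    symbolExpand D q α x y lam = TrivSqZeroExt.inl x := by
  simp [symbolExpand, lam]

@[simp] theorem symbolExpand_mu :
    symbolExpand D q α x y mu = TrivSqZeroExt.inl y := by
  simp [symbolExpand, mu]

theorem symbolExpand_eq_sum (T : Symbol n R) :
    symbolExpand D q α x y T =
      ∑ m ∈ T.support, jetAlong D q α (T.coeff m) *
        (TrivSqZeroExt.inl x ^ m 0 * TrivSqZeroExt.inl y ^ m 1) := by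
  simp [symbolExpand, MvPolynomial.eval₂_eq']

theorem symbolExpand_coeffwise (d : DiffPoly n R → DiffPoly n R) (T : Symbol n R) :
    symbolExpand D q α x y (coeffwise d T) =
      ∑ m ∈ T.support, jetAlong D q α (d (T.coeff m)) *
        (TrivSqZeroExt.inl x ^ m 0 * TrivSqZeroExt.inl y ^ m 1) := by
  rw [coeffwise, map_sum]
  refine Finset.sum_congr rfl fun m _ => ?_
  rw [symbolExpand, MvPolynomial.coe_eval₂Hom, MvPolynomial.eval₂_monomial,
    Finsupp.prod_fintype _ _ (by simp)]
  simp

theorem fst_symbolExpand_coeffwise_totalDeriv (T : Symbol n R) :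
    (symbolExpand D q α x y (coeffwise (totalDeriv D) T)).fst = 0 := by
  rw [symbolExpand_coeffwise, TrivSqZeroExt.fst_sum]
  exact Finset.sum_eq_zero fun m _ => by
    rw [TrivSqZeroExt.fst_mul, fst_jetAlong, constantCoeff_totalDeriv, map_zero, zero_mul]

theorem snd_symbolExpand_coeffwise_totalDeriv (T : Symbol n R) :
    (symbolExpand D q α x y (coeffwise (totalDeriv D) T)).snd =
      α * (symbolExpand D q α x y T).snd := by
  rw [symbolExpand_coeffwise, symbolExpand_eq_sum, TrivSqZeroExt.snd_sum, TrivSqZeroExt.snd_sum,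
    Finset.mul_sum]
  refine Finset.sum_congr rfl fun m _ => ?_
  simp only [DualNumber.snd_mul, snd_jetAlong_totalDeriv, TrivSqZeroExt.inl_pow,
    ← TrivSqZeroExt.inl_mul, TrivSqZeroExt.snd_inl, TrivSqZeroExt.fst_inl]
  ring

variable {D q α x y} {κ : Symbol n R} {κ' : S}

theorem fst_symbolExpand_shift_iterate
    (hκ : symbolExpand D q α x y κ = TrivSqZeroExt.inl κ') (p : ℕ) (T : Symbol n R) :
    (symbolExpand D q α x y ((shift D κ)^[p] T)).fst = κ' ^ p * (symbolExpand D q α x y T).fst := by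
  induction p with
  | zero => simp
  | succ p ih =>
    rw [Function.iterate_succ_apply', shift, map_add, map_mul, TrivSqZeroExt.fst_add,
      TrivSqZeroExt.fst_mul, ih, fst_symbolExpand_coeffwise_totalDeriv, hκ, TrivSqZeroExt.fst_inl]
    ring

theorem snd_symbolExpand_shift_iterate
    (hκ : symbolExpand D q α x y κ = TrivSqZeroExt.inl κ') (p : ℕ) (T : Symbol n R) :
    (symbolExpand D q α x y ((shift D κ)^[p] T)).snd =
      (κ' + α) ^ p * (symbolExpand D q α x y T).snd := by
  induction p with
  | zero => simp
  | succ p ih =>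
    rw [Function.iterate_succ_apply', shift, map_add, map_mul, TrivSqZeroExt.snd_add,
      DualNumber.snd_mul, ih, snd_symbolExpand_coeffwise_totalDeriv, hκ, TrivSqZeroExt.fst_inl,
      TrivSqZeroExt.snd_inl, ih]
    ring

theorem fst_symbolExpand_negShift_iterate
    (hκ : symbolExpand D q α x y κ = TrivSqZeroExt.inl κ') (p : ℕ) (T : Symbol n R) :
    (symbolExpand D q α x y ((negShift D κ)^[p] T)).fst =
      (-κ') ^ p * (symbolExpand D q α x y T).fst := by
  induction p with
  | zero => simp
  | succ p ih =>
    rw [Function.iterate_succ_apply', negShift, shift, map_neg, map_add, map_mul,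
      TrivSqZeroExt.fst_neg, TrivSqZeroExt.fst_add,
      TrivSqZeroExt.fst_mul, ih, fst_symbolExpand_coeffwise_totalDeriv, hκ, TrivSqZeroExt.fst_inl]
    ring

theorem snd_symbolExpand_negShift_iterate
    (hκ : symbolExpand D q α x y κ = TrivSqZeroExt.inl κ') (p : ℕ) (T : Symbol n R) :
    (symbolExpand D q α x y ((negShift D κ)^[p] T)).snd =
      (-(κ' + α)) ^ p * (symbolExpand D q α x y T).snd := by
  induction p with
  | zero => simp
  | succ p ih =>
    rw [Function.iterate_succ_apply', negShift, shift, map_neg, map_add, map_mul,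
      TrivSqZeroExt.snd_neg, TrivSqZeroExt.snd_add,
      DualNumber.snd_mul, ih, snd_symbolExpand_coeffwise_totalDeriv, hκ, TrivSqZeroExt.fst_inl,
      TrivSqZeroExt.snd_inl, ih]
    ring

variable (D q α x y)

theorem symbolExpand_lam_add_mu :
    symbolExpand D q α x y (lam + mu) = TrivSqZeroExt.inl (x + y) := by
  rw [map_add, symbolExpand_lam, symbolExpand_mu, TrivSqZeroExt.inl_add]

/-- To order zero, `rotate` is the cyclic substitution `(λ, μ, ν) → (μ, ν, λ)`, where
`λ + μ + ν = 0`. -/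
theorem fst_symbolExpand_rotate (T : Symbol n R) :
    (symbolExpand D q α x y (rotate D T)).fst =
      (symbolExpand D q α y (-(x + y)) T).fst := by
  rw [rotate, map_sum, symbolExpand_eq_sum, TrivSqZeroExt.fst_sum, TrivSqZeroExt.fst_sum]
  refine Finset.sum_congr rfl fun m _ => ?_
  simp only [map_mul, map_pow, TrivSqZeroExt.fst_mul, TrivSqZeroExt.fst_pow, symbolExpand_mu,
    fst_symbolExpand_negShift_iterate (symbolExpand_lam_add_mu D q α x y), symbolExpand_C,
    TrivSqZeroExt.fst_inl]
  ring

/-- To first order, `rotate` is the cyclic substitution `(λ, μ, ν) → (μ, ν, λ)`, where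
`λ + μ + ν + α = 0`. -/
theorem snd_symbolExpand_rotate (T : Symbol n R) :
    (symbolExpand D q α x y (rotate D T)).snd =
      (symbolExpand D q α y (-(x + y + α)) T).snd := by
  rw [rotate, map_sum, symbolExpand_eq_sum, TrivSqZeroExt.snd_sum, TrivSqZeroExt.snd_sum]
  refine Finset.sum_congr rfl fun m _ => ?_
  simp only [map_mul, map_pow, DualNumber.snd_mul, symbolExpand_mu,
    snd_symbolExpand_negShift_iterate (symbolExpand_lam_add_mu D q α x y), symbolExpand_C,
    TrivSqZeroExt.inl_pow, TrivSqZeroExt.fst_inl, TrivSqZeroExt.snd_inl, TrivSqZeroExt.fst_mul]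
  ring

theorem fst_symbolExpand_rotateInv (T : Symbol n R) :
    (symbolExpand D q α x y (rotateInv D T)).fst =
      (symbolExpand D q α (-(x + y)) x T).fst := by
  rw [rotateInv, map_sum, symbolExpand_eq_sum, TrivSqZeroExt.fst_sum, TrivSqZeroExt.fst_sum]
  refine Finset.sum_congr rfl fun m _ => ?_
  simp only [map_mul, map_pow, TrivSqZeroExt.fst_mul, TrivSqZeroExt.fst_pow, symbolExpand_lam,
    fst_symbolExpand_negShift_iterate (symbolExpand_lam_add_mu D q α x y), symbolExpand_C,
    TrivSqZeroExt.fst_inl]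
  ring

/-- To first order, `rotateInv` is the cyclic substitution `(λ, μ, ν) → (ν, λ, μ)`, where
`λ + μ + ν + α = 0`. -/
theorem snd_symbolExpand_rotateInv (T : Symbol n R) :
    (symbolExpand D q α x y (rotateInv D T)).snd =
      (symbolExpand D q α (-(x + y + α)) x T).snd := by
  rw [rotateInv, map_sum, symbolExpand_eq_sum, TrivSqZeroExt.snd_sum, TrivSqZeroExt.snd_sum]
  refine Finset.sum_congr rfl fun m _ => ?_
  simp only [map_mul, map_pow, DualNumber.snd_mul, symbolExpand_lam,
    snd_symbolExpand_negShift_iterate (symbolExpand_lam_add_mu D q α x y), symbolExpand_C,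
    TrivSqZeroExt.inl_pow, TrivSqZeroExt.fst_inl, TrivSqZeroExt.snd_inl, TrivSqZeroExt.fst_mul]
  ring

end SymbolExpansion

/-! ### The linear part of a homogeneous bracket -/

section Homogeneity

variable {n : ℕ} {R : Type*} [CommRing R] {k : ℕ}

/-- The coefficients `P_s^{ij}`, `s ≤ k`, are homogeneous of degree `k - s`. -/
def IsHomogeneousFamily (k : ℕ) (P : ℕ → Fin n → Fin n → DiffPoly n R) : Prop :=
  ∀ s i j, s ≤ k →
    MvPolynomial.IsWeightedHomogeneous (fun v : Fin n × ℕ => v.2 + 1) (P s i j) (k - s)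

/-- The leading coefficient `g^{ij}`. -/
def leadCoeff (k : ℕ) (P : ℕ → Fin n → Fin n → DiffPoly n R) (i j : Fin n) : R :=
  MvPolynomial.constantCoeff (P k i j)

theorem constantCoeff_eq_ite {P : ℕ → Fin n → Fin n → DiffPoly n R}
    (hP : IsHomogeneousFamily k P) {s : ℕ} (hs : s ≤ k)
    (i j : Fin n) :
    MvPolynomial.constantCoeff (P s i j) = if s = k then leadCoeff k P i j else 0 := by
  split_ifs with h
  · rw [h, leadCoeff]
  · refine (hP s i j hs).coeff_eq_zero 0 ?_
    rw [map_zero]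
    omega

end Homogeneity

section LinearPart

variable {n : ℕ} {R : Type*} [CommRing R] [Algebra ℝ R]
variable {S : Type*} [CommRing S] [Algebra R S]
variable {D : Fin n → Derivation ℝ R R} {k : ℕ} {P : ℕ → Fin n → Fin n → DiffPoly n R}

/-- The coefficient of `u^{q,k-s}` in `P_s^{ij}`; for `s = k`, where `u^{q,0} = u^q`, this is read
as the partial derivative of `g^{ij}`. -/
def linCoeff (D : Fin n → Derivation ℝ R R) (k : ℕ) (P : ℕ → Fin n → Fin n → DiffPoly n R)
    (s : ℕ) (i j q : Fin n) : R :=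
  if s = k then D q (leadCoeff k P i j)
  else (P s i j).coeff (Finsupp.single (q, k - s - 1) 1)

/-- The symbol `∑_s c_s β^{k-s} λ^s` of the linear part of the bracket in the direction `u^q`: the
variable `β` stands for the differentiations of `u^q`. -/
def linSymbol (D : Fin n → Derivation ℝ R R) (k : ℕ) (P : ℕ → Fin n → Fin n → DiffPoly n R)
    (i j q : Fin n) (β l : S) : S :=
  ∑ s ∈ Finset.range (k + 1), algebraMap R S (linCoeff D k P s i j q) * β ^ (k - s) * l ^ s

theorem snd_jetAlong_coeff (hP : IsHomogeneousFamily k P) {s : ℕ} (hs : s ≤ k) (i j q : Fin n)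
    (α : S) : (jetAlong D q α (P s i j)).snd =
      algebraMap R S (linCoeff D k P s i j q) * α ^ (k - s) := by
  have h := hP s i j hs
  rw [linCoeff]
  split_ifs with hk
  · subst hk
    rw [Nat.sub_self] at h
    rw [eq_C_of_isWeightedHomogeneous_zero h, snd_jetAlong_C, leadCoeff]
    simp
  · obtain ⟨N, hN⟩ : ∃ N, k - s = N + 1 := ⟨k - s - 1, by omega⟩
    rw [hN] at h ⊢
    rw [snd_jetAlong_of_isWeightedHomogeneous _ _ _ h, Nat.add_sub_cancel]

theorem snd_jetAlong_coeffwise (hD : ∀ i j f, D i (D j f) = D j (D i f))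
    (hP : IsHomogeneousFamily k P) {s : ℕ} (hs : s ≤ k) (i j m q : Fin n)
    (α : S) : (jetAlong D q α (coeffwise (D m) (P s i j))).snd =
      algebraMap R S (D m (linCoeff D k P s i j q)) * α ^ (k - s) := by
  have h := isWeightedHomogeneous_coeffwise (map_zero (D m)) (hP s i j hs)
  rw [linCoeff]
  split_ifs with hk
  · subst hk
    rw [Nat.sub_self] at h
    rw [eq_C_of_isWeightedHomogeneous_zero h, snd_jetAlong_C,
      constantCoeff_coeffwise (map_zero (D m)), leadCoeff, hD]
    simp
  · obtain ⟨N, hN⟩ : ∃ N, k - s = N + 1 := ⟨k - s - 1, by omega⟩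
    rw [hN] at h ⊢
    rw [snd_jetAlong_of_isWeightedHomogeneous _ _ _ h, Nat.add_sub_cancel,
      coeff_coeffwise (map_zero (D m))]

/-- At vanishing jets, the only nonzero jet derivatives of `P_s^{ij}` are those with respect to
`u^{m,k-s}`, which has the degree of `P_s^{ij}`. -/
theorem constantCoeff_jetDeriv (hP : IsHomogeneousFamily k P) {s : ℕ} (hs : s ≤ k)
    (i j m : Fin n) (p : ℕ) : MvPolynomial.constantCoeff (jetDeriv D m p (P s i j)) =
      if p = k - s then linCoeff D k P s i j m else 0 := by
  cases p with
  | zero =>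
    rw [jetDeriv, constantCoeff_coeffwise (map_zero (D m)), constantCoeff_eq_ite hP hs]
    split_ifs with h1 h2 h2
    · rw [linCoeff, if_pos h1]
    · omega
    · omega
    · exact map_zero _
  | succ a =>
    have : MvPolynomial.constantCoeff (jetDeriv D m (a + 1) (P s i j)) =
        (P s i j).coeff (Finsupp.single (m, a) 1) := by
      rw [jetDeriv, MvPolynomial.constantCoeff_eq, MvPolynomial.coeff_pderiv]
      simp
    rw [this]
    split_ifs with h
    · rw [linCoeff, if_neg (by omega), ← h, Nat.add_sub_cancel]
    · refine (hP s i j hs).coeff_eq_zero _ ?_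
      simpa [Finsupp.weight_apply] using h

variable (q : Fin n) (α x y : S)

theorem fst_symbolExpand_bracket (hP : IsHomogeneousFamily k P) (κ : Symbol n R) {κ' : S}
    (hκ : symbolExpand D q α x y κ = TrivSqZeroExt.inl κ') (i j : Fin n) :
    (symbolExpand D q α x y
      (∑ s ∈ Finset.range (k + 1), MvPolynomial.C (P s i j) * κ ^ s)).fst =
      algebraMap R S (leadCoeff k P i j) * κ' ^ k := by
  rw [map_sum, TrivSqZeroExt.fst_sum, Finset.sum_eq_single k]
  · simp [hκ, fst_jetAlong, leadCoeff]
  · intro s hs hsk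
    have hs' : s ≤ k := Nat.lt_succ_iff.1 (Finset.mem_range.1 hs)
    simp [fst_jetAlong, constantCoeff_eq_ite hP hs', hsk]
  · simp

theorem snd_symbolExpand_bracket (hP : IsHomogeneousFamily k P) (κ : Symbol n R) {κ' : S}
    (hκ : symbolExpand D q α x y κ = TrivSqZeroExt.inl κ') (i j : Fin n) :
    (symbolExpand D q α x y
      (∑ s ∈ Finset.range (k + 1), MvPolynomial.C (P s i j) * κ ^ s)).snd =
      linSymbol D k P i j q α κ' := by
  rw [map_sum, TrivSqZeroExt.snd_sum, linSymbol]
  refine Finset.sum_congr rfl fun s hs => ?_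
  have hs' : s ≤ k := Nat.lt_succ_iff.1 (Finset.mem_range.1 hs)
  rw [map_mul, map_pow, hκ, symbolExpand_C, TrivSqZeroExt.inl_pow, DualNumber.snd_mul,
    snd_jetAlong_coeff hP hs', TrivSqZeroExt.snd_inl, TrivSqZeroExt.fst_inl]
  ring

/-- Skew-symmetry of the leading coefficient: `g^{ij} = (-1)^{k+1} g^{ji}`. -/
theorem IsSkew.leadCoeff_swap (hP : IsHomogeneousFamily k P) (hS : IsSkew D k P) (i j : Fin n) :
    leadCoeff k P i j = -((-1) ^ k * leadCoeff k P j i) := by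
  have h := congrArg (fun T => (symbolExpand D i (1 : R) 1 1 T).fst) (hS i j)
  simp only [map_neg, TrivSqZeroExt.fst_neg] at h
  rw [bracketSymbol, fst_symbolExpand_bracket i (1 : R) 1 1 hP lam (symbolExpand_lam ..),
    swappedBracketSymbol, map_sum, TrivSqZeroExt.fst_sum, Finset.sum_eq_single k] at h
  · simpa [fst_symbolExpand_negShift_iterate (symbolExpand_lam D i (1 : R) 1 1), fst_jetAlong,
      leadCoeff] using h
  · intro s hs hsk
    have hs' : s ≤ k := Nat.lt_succ_iff.1 (Finset.mem_range.1 hs)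
    simp [fst_symbolExpand_negShift_iterate (symbolExpand_lam D i (1 : R) 1 1), fst_jetAlong,
      constantCoeff_eq_ite hP hs', hsk]
  · simp

/-- Skew-symmetry of the linear part. -/
theorem IsSkew.linSymbol_swap (hP : IsHomogeneousFamily k P) (hS : IsSkew D k P) (i j : Fin n)
    {z : S} (hz : z = -(x + α)) :
    linSymbol D k P i j q α x = -linSymbol D k P j i q α z := by
  have h := congrArg (fun T => (symbolExpand D q α x 0 T).snd) (hS i j)
  simp only [map_neg, TrivSqZeroExt.snd_neg] at h
  rw [bracketSymbol, snd_symbolExpand_bracket q α x 0 hP lam (symbolExpand_lam ..),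
    swappedBracketSymbol, map_sum, TrivSqZeroExt.snd_sum] at h
  rw [h, linSymbol, neg_inj]
  refine Finset.sum_congr rfl fun s hs => ?_
  have hs' : s ≤ k := Nat.lt_succ_iff.1 (Finset.mem_range.1 hs)
  rw [snd_symbolExpand_negShift_iterate (symbolExpand_lam D q α x 0), symbolExpand_C,
    snd_jetAlong_coeff hP hs', hz]
  ring

theorem fst_symbolExpand_doubleBracket (hP : IsHomogeneousFamily k P) (i j l : Fin n) :
    (symbolExpand D q α x y (doubleBracket D k P i j l)).fst =
      ∑ m, linSymbol D k P i j m y x * (algebraMap R S (leadCoeff k P m l) * y ^ k) := by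
  simp only [doubleBracket, map_sum, TrivSqZeroExt.fst_sum]
  rw [Finset.sum_comm]
  refine Finset.sum_congr rfl fun m _ => ?_
  rw [linSymbol, Finset.sum_mul]
  refine Finset.sum_congr rfl fun s hs => ?_
  have hs' : s ≤ k := Nat.lt_succ_iff.1 (Finset.mem_range.1 hs)
  rw [Finset.sum_eq_single (k - s)]
  · simp only [map_mul, map_pow, symbolExpand_C, symbolExpand_lam, TrivSqZeroExt.fst_mul,
      fst_symbolExpand_shift_iterate (symbolExpand_mu D q α x y), TrivSqZeroExt.fst_pow,
      fst_symbolExpand_bracket q α x y hP mu (symbolExpand_mu D q α x y), fst_jetAlong,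
      constantCoeff_jetDeriv hP hs', if_true, TrivSqZeroExt.fst_inl]
    ring
  · intro p _ hp
    simp only [map_mul, symbolExpand_C, TrivSqZeroExt.fst_mul, fst_jetAlong,
      constantCoeff_jetDeriv hP hs', if_neg hp, map_zero, zero_mul]
  · intro h
    exact absurd (Finset.mem_range.2 (by omega)) h

/-- The linear part of `{{u^i(x), u^j(y)}, u^l(z)}`. The quadratic terms of `P_s^{ij}` enter only
through the multiples `B m` of `y ^ (k + 1)`. -/
theorem exists_snd_symbolExpand_doubleBracket (hD : ∀ i j f, D i (D j f) = D j (D i f))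
    (hP : IsHomogeneousFamily k P) (i j l : Fin n) :
    ∃ B : Fin n → S, (symbolExpand D q α x y (doubleBracket D k P i j l)).snd =
      (∑ m, linSymbol D k P i j m (y + α) x * linSymbol D k P m l q α y) +
      ∑ m, algebraMap R S (leadCoeff k P m l) * y ^ k *
        ((∑ s ∈ Finset.range (k + 1),
          algebraMap R S (D m (linCoeff D k P s i j q)) * α ^ (k - s) * x ^ s) + y * B m) := by
  refine ⟨fun m => ∑ s ∈ Finset.range (k + 1), ∑ p ∈ Finset.range k,
    (jetAlong D q α (jetDeriv D m (p + 1) (P s i j))).snd * x ^ s * y ^ p, ?_⟩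
  simp only [doubleBracket, map_sum, TrivSqZeroExt.snd_sum]
  rw [Finset.sum_comm, ← Finset.sum_add_distrib]
  refine Finset.sum_congr rfl fun m _ => ?_
  rw [linSymbol, Finset.sum_mul, Finset.mul_sum, ← Finset.sum_add_distrib, Finset.mul_sum,
    ← Finset.sum_add_distrib]
  refine Finset.sum_congr rfl fun s hs => ?_
  have hs' : s ≤ k := Nat.lt_succ_iff.1 (Finset.mem_range.1 hs)
  -- the product rule: the first summand expands the inner bracket, the second one `∂P_s/∂u^{m,p}`
  have hterm (p : ℕ) : (symbolExpand D q α x y (MvPolynomial.C (jetDeriv D m p (P s i j)) *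
      lam ^ s * (shift D mu)^[p]
        (∑ r ∈ Finset.range (k + 1), MvPolynomial.C (P r m l) * mu ^ r))).snd =
      (if p = k - s then algebraMap R S (linCoeff D k P s i j m) * (y + α) ^ (k - s) * x ^ s *
        linSymbol D k P m l q α y else 0) +
      algebraMap R S (leadCoeff k P m l) * y ^ k *
        ((jetAlong D q α (jetDeriv D m p (P s i j))).snd * x ^ s * y ^ p) := by
    simp only [map_mul, map_pow, symbolExpand_C, symbolExpand_lam, DualNumber.snd_mul,
      TrivSqZeroExt.fst_mul, TrivSqZeroExt.inl_pow, TrivSqZeroExt.snd_inl, fst_jetAlong,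
      fst_symbolExpand_shift_iterate (symbolExpand_mu D q α x y),
      snd_symbolExpand_shift_iterate (symbolExpand_mu D q α x y),
      snd_symbolExpand_bracket q α x y hP mu (symbolExpand_mu D q α x y),
      fst_symbolExpand_bracket q α x y hP mu (symbolExpand_mu D q α x y),
      constantCoeff_jetDeriv hP hs', TrivSqZeroExt.fst_inl]
    split_ifs with h
    · rw [h]; ring
    · simp only [map_zero]; ring
  simp only [hterm]
  rw [Finset.sum_add_distrib, Finset.sum_ite_eq', if_pos (Finset.mem_range.2 (by omega)),
    ← Finset.mul_sum, Finset.sum_range_succ']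
  -- the summand `p = 0` is the derivative along `u^m`, the summands with `p > 0` make up `B m`
  congr 2
  rw [add_comm]
  congr 1
  · rw [jetDeriv, snd_jetAlong_coeffwise hD hP hs']
    ring
  · rw [Finset.mul_sum]
    exact Finset.sum_congr rfl fun p _ => by ring

end LinearPart

/-! ### Coefficients of products of sums of three variables -/

section Trinomial

variable {σ R : Type*} [CommRing R] {a b c : σ}

theorem coeff_X_pow_three (hab : a ≠ b) (hac : a ≠ c) (hbc : b ≠ c) (p q r i j l : ℕ) :
    MvPolynomial.coeff (Finsupp.single a p + Finsupp.single b q + Finsupp.single c r)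
      (MvPolynomial.X a ^ i * MvPolynomial.X b ^ j * MvPolynomial.X c ^ l : MvPolynomial σ R) =
      if i = p ∧ j = q ∧ l = r then 1 else 0 := by
  classical
  rw [MvPolynomial.X_pow_eq_monomial, MvPolynomial.X_pow_eq_monomial,
    MvPolynomial.X_pow_eq_monomial, MvPolynomial.monomial_mul, MvPolynomial.monomial_mul,
    MvPolynomial.coeff_monomial]
  simp only [mul_one]
  congr 1
  refine propext ⟨fun h => ⟨?_, ?_, ?_⟩, ?_⟩
  · simpa [hab, hab.symm, hac, hac.symm, hbc, hbc.symm] using DFunLike.congr_fun h a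
  · simpa [hab, hab.symm, hac, hac.symm, hbc, hbc.symm] using DFunLike.congr_fun h b
  · simpa [hab, hab.symm, hac, hac.symm, hbc, hbc.symm] using DFunLike.congr_fun h c
  · rintro ⟨rfl, rfl, rfl⟩
    rfl

/-- The coefficient of `a^p b^q c^r` in `a^d (a+b+c)^N (b+c)^M c^j`. -/
theorem coeff_trinomial (hab : a ≠ b) (hac : a ≠ c) (hbc : b ≠ c) {p q r d N M j : ℕ}
    (h : d + N + M + j = p + q + r) :
    MvPolynomial.coeff (Finsupp.single a p + Finsupp.single b q + Finsupp.single c r)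
      (MvPolynomial.X a ^ d * (MvPolynomial.X a + (MvPolynomial.X b + MvPolynomial.X c)) ^ N *
        (MvPolynomial.X b + MvPolynomial.X c) ^ M * MvPolynomial.X c ^ j : MvPolynomial σ R) =
      if d ≤ p then (N.choose (p - d) : R) * ((N - (p - d) + M).choose q : R) else 0 := by
  have key : (MvPolynomial.X a ^ d *
      (MvPolynomial.X a + (MvPolynomial.X b + MvPolynomial.X c)) ^ N *
        (MvPolynomial.X b + MvPolynomial.X c) ^ M * MvPolynomial.X c ^ j : MvPolynomial σ R) =
      ∑ i ∈ Finset.range (N + 1), ∑ e ∈ Finset.range (N - i + M + 1),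
        MvPolynomial.C ((N.choose i : R) * ((N - i + M).choose e : R)) *
          (MvPolynomial.X a ^ (d + i) * MvPolynomial.X b ^ e *
            MvPolynomial.X c ^ (N - i + M - e + j)) := by
    rw [add_pow, Finset.mul_sum, Finset.sum_mul, Finset.sum_mul]
    refine Finset.sum_congr rfl fun i _ => ?_
    have : (MvPolynomial.X a ^ d * (MvPolynomial.X a ^ i *
        (MvPolynomial.X b + MvPolynomial.X c) ^ (N - i) * (N.choose i : MvPolynomial σ R)) *
        (MvPolynomial.X b + MvPolynomial.X c) ^ M * MvPolynomial.X c ^ j : MvPolynomial σ R) =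
        (N.choose i : MvPolynomial σ R) * MvPolynomial.X a ^ (d + i) * MvPolynomial.X c ^ j *
          (MvPolynomial.X b + MvPolynomial.X c) ^ (N - i + M) := by ring
    rw [this, add_pow, Finset.mul_sum]
    refine Finset.sum_congr rfl fun e _ => ?_
    simp only [map_mul, map_natCast]
    ring
  rw [key, MvPolynomial.coeff_sum]
  simp only [MvPolynomial.coeff_sum, MvPolynomial.coeff_C_mul,
    coeff_X_pow_three hab hac hbc]
  split_ifs with hd
  · rw [Finset.sum_eq_single (p - d)]
    · by_cases hN : N < p - d
      · rw [Nat.choose_eq_zero_of_lt hN]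
        simp
      rw [Finset.sum_eq_single q]
      · by_cases hq : N - (p - d) + M < q
        · rw [Nat.choose_eq_zero_of_lt hq]
          simp
        · rw [if_pos ⟨by omega, rfl, by omega⟩, mul_one]
      · intro e _ he
        rw [if_neg (fun h => he h.2.1), mul_zero]
      · intro hq
        have : N - (p - d) + M < q := by
          rw [Finset.mem_range] at hq
          omega
        rw [Nat.choose_eq_zero_of_lt this]
        simp
    · intro i _ hi
      refine Finset.sum_eq_zero fun e _ => ?_
      rw [if_neg (fun h => hi (by omega)), mul_zero]
    · intro hN
      have : N < p - d := by
        rw [Finset.mem_range] at hN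
        omega
      rw [Nat.choose_eq_zero_of_lt this]
      simp
  · refine Finset.sum_eq_zero fun i _ => Finset.sum_eq_zero fun e _ => ?_
    rw [if_neg (fun h => hd (by omega)), mul_zero]

theorem coeff_X_pow_mul_eq_zero (F : MvPolynomial σ R) {m : σ →₀ ℕ} {p : ℕ} (h : m a < p) :
    MvPolynomial.coeff m (MvPolynomial.X a ^ p * F) = 0 := by
  classical
  rw [MvPolynomial.X_pow_eq_monomial, MvPolynomial.coeff_monomial_mul', if_neg]
  intro hle
  have := hle a
  rw [Finsupp.single_eq_same] at this
  omega

/-- The alternating sum `∑_t (-1)^{k-t} (k+s-t choose k) c_t`, the coefficient of `λ^k κ^s` in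
`(λ + κ)^s ∑_t c_t (-λ-κ)^{k-t} κ^t`. -/
def flatSum (k s : ℕ) (v : ℕ → R) : R :=
  ∑ t ∈ Finset.range (k + 1), (-1) ^ (k - t) * ((k + s - t).choose k : R) * v t

/-- The coefficient of `a^k b^k c^s` in a product of two linear symbols, taken at
`(β, λ) = (-(b+c), c)` and `(-(a+b+c), b+c)`, times `(a+b+c)^s`. The second factor contributes
`(k+s-u choose k)` by the choice of `a^k`, and the remaining powers of `b + c` give
`(k+s-t choose k)`. -/
theorem coeff_flatSum_mul_flatSum (hab : a ≠ b) (hac : a ≠ c) (hbc : b ≠ c) (k s : ℕ)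
    (v w : ℕ → R) :
    MvPolynomial.coeff (Finsupp.single a k + Finsupp.single b k + Finsupp.single c s)
      ((MvPolynomial.X a + (MvPolynomial.X b + MvPolynomial.X c)) ^ s *
        ((∑ t ∈ Finset.range (k + 1), MvPolynomial.C (v t) *
            (-(MvPolynomial.X b + MvPolynomial.X c)) ^ (k - t) * MvPolynomial.X c ^ t) *
          ∑ t ∈ Finset.range (k + 1), MvPolynomial.C (w t) *
            (-(MvPolynomial.X a + (MvPolynomial.X b + MvPolynomial.X c))) ^ (k - t) *
              (MvPolynomial.X b + MvPolynomial.X c) ^ t) : MvPolynomial σ R) =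
      flatSum k s v * flatSum k s w := by
  rw [Finset.sum_mul_sum, Finset.mul_sum, MvPolynomial.coeff_sum, flatSum, flatSum,
    Finset.sum_mul_sum]
  refine Finset.sum_congr rfl fun t ht => ?_
  rw [Finset.mul_sum, MvPolynomial.coeff_sum]
  refine Finset.sum_congr rfl fun u hu => ?_
  have ht' : t ≤ k := Nat.lt_succ_iff.1 (Finset.mem_range.1 ht)
  have hu' : u ≤ k := Nat.lt_succ_iff.1 (Finset.mem_range.1 hu)
  have h1 : ((MvPolynomial.X a + (MvPolynomial.X b + MvPolynomial.X c)) ^ s *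
        ((MvPolynomial.C (v t) *
            (-(MvPolynomial.X b + MvPolynomial.X c)) ^ (k - t) * MvPolynomial.X c ^ t) *
          (MvPolynomial.C (w u) *
            (-(MvPolynomial.X a + (MvPolynomial.X b + MvPolynomial.X c))) ^ (k - u) *
              (MvPolynomial.X b + MvPolynomial.X c) ^ u)) : MvPolynomial σ R) =
      MvPolynomial.C ((-1) ^ (k - t) * v t * ((-1) ^ (k - u) * w u)) *
        (MvPolynomial.X a ^ 0 *
          (MvPolynomial.X a + (MvPolynomial.X b + MvPolynomial.X c)) ^ (k - u + s) *
          (MvPolynomial.X b + MvPolynomial.X c) ^ (k - t + u) * MvPolynomial.X c ^ t) := by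
    rw [neg_pow, neg_pow (MvPolynomial.X a + (MvPolynomial.X b + MvPolynomial.X c))]
    simp only [map_mul, map_pow, map_neg, map_one]
    ring
  rw [h1, MvPolynomial.coeff_C_mul, coeff_trinomial hab hac hbc (by omega), if_pos (Nat.zero_le _),
    Nat.sub_zero, show k - u + s = k + s - u by omega]
  by_cases hus : k ≤ k + s - u
  · rw [show k + s - u - k + (k - t + u) = k + s - t by omega]
    ring
  · rw [Nat.choose_eq_zero_of_lt (not_le.1 hus)]
    simp

/-- The coefficient of `a^s b^k c^k` in a product of two linear symbols, taken at
`(β, λ) = (-(b+c), c)` and `(-(a+b+c), a)`, times `(a+b+c)^s`. -/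
theorem coeff_flatSum_top_mul_flatSum (hab : a ≠ b) (hac : a ≠ c) (hbc : b ≠ c) (k s : ℕ)
    (v w : ℕ → R) :
    MvPolynomial.coeff (Finsupp.single a s + Finsupp.single b k + Finsupp.single c k)
      ((MvPolynomial.X a + (MvPolynomial.X b + MvPolynomial.X c)) ^ s *
        ((∑ t ∈ Finset.range (k + 1), MvPolynomial.C (v t) *
            (-(MvPolynomial.X b + MvPolynomial.X c)) ^ (k - t) * MvPolynomial.X c ^ t) *
          ∑ t ∈ Finset.range (k + 1), MvPolynomial.C (w t) *
            (-(MvPolynomial.X a + (MvPolynomial.X b + MvPolynomial.X c))) ^ (k - t) *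
              MvPolynomial.X a ^ t) : MvPolynomial σ R) =
      flatSum k k v * flatSum k s w := by
  rw [Finset.sum_mul_sum, Finset.mul_sum, MvPolynomial.coeff_sum, flatSum, flatSum,
    Finset.sum_mul_sum]
  refine Finset.sum_congr rfl fun t ht => ?_
  rw [Finset.mul_sum, MvPolynomial.coeff_sum]
  refine Finset.sum_congr rfl fun u hu => ?_
  have ht' : t ≤ k := Nat.lt_succ_iff.1 (Finset.mem_range.1 ht)
  have hu' : u ≤ k := Nat.lt_succ_iff.1 (Finset.mem_range.1 hu)
  have h1 : ((MvPolynomial.X a + (MvPolynomial.X b + MvPolynomial.X c)) ^ s *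
        ((MvPolynomial.C (v t) *
            (-(MvPolynomial.X b + MvPolynomial.X c)) ^ (k - t) * MvPolynomial.X c ^ t) *
          (MvPolynomial.C (w u) *
            (-(MvPolynomial.X a + (MvPolynomial.X b + MvPolynomial.X c))) ^ (k - u) *
              MvPolynomial.X a ^ u)) : MvPolynomial σ R) =
      MvPolynomial.C ((-1) ^ (k - t) * v t * ((-1) ^ (k - u) * w u)) *
        (MvPolynomial.X a ^ u *
          (MvPolynomial.X a + (MvPolynomial.X b + MvPolynomial.X c)) ^ (k - u + s) *
          (MvPolynomial.X b + MvPolynomial.X c) ^ (k - t) * MvPolynomial.X c ^ t) := by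
    rw [neg_pow, neg_pow (MvPolynomial.X a + (MvPolynomial.X b + MvPolynomial.X c))]
    simp only [map_mul, map_pow, map_neg, map_one]
    ring
  rw [h1, MvPolynomial.coeff_C_mul, coeff_trinomial hab hac hbc (by omega),
    show k - u + s = k + s - u by omega]
  split_ifs with hus
  · rw [show k + s - u - (s - u) + (k - t) = k + k - t by omega,
      show (k + s - u).choose (s - u) = (k + s - u).choose k from
        Nat.choose_symm_of_eq_add (by omega)]
    ring
  · rw [Nat.choose_eq_zero_of_lt (show k + s - u < k by omega)]
    simp

/-- The coefficient of `a^k b^q c^r` in `a^k (∑ v_t (-(a+b+c))^{k-t} c^t + a B) (a+b+c)^s`; the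
term with `B` is divisible by `a^{k+1}` and does not contribute. -/
theorem coeff_X_pow_mul_linear (hab : a ≠ b) (hac : a ≠ c) (hbc : b ≠ c) (k : ℕ) {s q r : ℕ}
    (h : k + s = q + r) (v : ℕ → R) (B : MvPolynomial σ R) :
    MvPolynomial.coeff (Finsupp.single a k + Finsupp.single b q + Finsupp.single c r)
      ((MvPolynomial.X a + (MvPolynomial.X b + MvPolynomial.X c)) ^ s *
        (MvPolynomial.X a ^ k * ((∑ t ∈ Finset.range (k + 1), MvPolynomial.C (v t) *
            (-(MvPolynomial.X a + (MvPolynomial.X b + MvPolynomial.X c))) ^ (k - t) *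
              MvPolynomial.X c ^ t) + MvPolynomial.X a * B)) : MvPolynomial σ R) =
      ∑ t ∈ Finset.range (k + 1), (-1) ^ (k - t) * ((k + s - t).choose q : R) * v t := by
  have h0 : ((MvPolynomial.X a + (MvPolynomial.X b + MvPolynomial.X c)) ^ s *
        (MvPolynomial.X a ^ k * ((∑ t ∈ Finset.range (k + 1), MvPolynomial.C (v t) *
            (-(MvPolynomial.X a + (MvPolynomial.X b + MvPolynomial.X c))) ^ (k - t) *
              MvPolynomial.X c ^ t) + MvPolynomial.X a * B)) : MvPolynomial σ R) =
      (∑ t ∈ Finset.range (k + 1), (MvPolynomial.X a + (MvPolynomial.X b + MvPolynomial.X c)) ^ s *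
        (MvPolynomial.X a ^ k * (MvPolynomial.C (v t) *
            (-(MvPolynomial.X a + (MvPolynomial.X b + MvPolynomial.X c))) ^ (k - t) *
              MvPolynomial.X c ^ t))) + MvPolynomial.X a ^ (k + 1) *
        ((MvPolynomial.X a + (MvPolynomial.X b + MvPolynomial.X c)) ^ s * B) := by
    rw [← Finset.mul_sum, ← Finset.mul_sum]
    ring
  rw [h0, MvPolynomial.coeff_add, coeff_X_pow_mul_eq_zero, add_zero, MvPolynomial.coeff_sum]
  · refine Finset.sum_congr rfl fun t ht => ?_
    have ht' : t ≤ k := Nat.lt_succ_iff.1 (Finset.mem_range.1 ht)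
    have h1 : ((MvPolynomial.X a + (MvPolynomial.X b + MvPolynomial.X c)) ^ s *
        (MvPolynomial.X a ^ k * (MvPolynomial.C (v t) *
            (-(MvPolynomial.X a + (MvPolynomial.X b + MvPolynomial.X c))) ^ (k - t) *
              MvPolynomial.X c ^ t)) : MvPolynomial σ R) =
        MvPolynomial.C ((-1) ^ (k - t) * v t) * (MvPolynomial.X a ^ k *
          (MvPolynomial.X a + (MvPolynomial.X b + MvPolynomial.X c)) ^ (k - t + s) *
          (MvPolynomial.X b + MvPolynomial.X c) ^ 0 * MvPolynomial.X c ^ t) := by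
      rw [neg_pow]
      simp only [map_mul, map_pow, map_neg, map_one]
      ring
    rw [h1, MvPolynomial.coeff_C_mul, coeff_trinomial hab hac hbc (by omega), if_pos le_rfl,
      Nat.sub_self, Nat.choose_zero_right, show k - t + s - 0 + 0 = k + s - t by omega]
    push_cast
    ring
  · simp [hab, hac]

/-- The coefficient of `b^q c^r` in a linear symbol at `(β, λ) = (-(b+c), c)`, times `(b+c)^s`. The
third variable `a` does not occur. -/
theorem coeff_two_linear (hab : a ≠ b) (hac : a ≠ c) (hbc : b ≠ c) (k : ℕ) {s q r : ℕ}
    (h : k + s = q + r) (v : ℕ → R) :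
    MvPolynomial.coeff (Finsupp.single a 0 + Finsupp.single b q + Finsupp.single c r)
      ((MvPolynomial.X b + MvPolynomial.X c) ^ s * ∑ t ∈ Finset.range (k + 1),
        MvPolynomial.C (v t) * (-(MvPolynomial.X b + MvPolynomial.X c)) ^ (k - t) *
              MvPolynomial.X c ^ t : MvPolynomial σ R) =
      ∑ t ∈ Finset.range (k + 1), (-1) ^ (k - t) * ((k + s - t).choose q : R) * v t := by
  rw [Finset.mul_sum, MvPolynomial.coeff_sum]
  refine Finset.sum_congr rfl fun t ht => ?_
  have ht' : t ≤ k := Nat.lt_succ_iff.1 (Finset.mem_range.1 ht)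
  have h1 : ((MvPolynomial.X b + MvPolynomial.X c) ^ s *
        (MvPolynomial.C (v t) * (-(MvPolynomial.X b + MvPolynomial.X c)) ^ (k - t) *
              MvPolynomial.X c ^ t) : MvPolynomial σ R) =
      MvPolynomial.C ((-1) ^ (k - t) * v t) * (MvPolynomial.X a ^ 0 *
        (MvPolynomial.X a + (MvPolynomial.X b + MvPolynomial.X c)) ^ 0 *
        (MvPolynomial.X b + MvPolynomial.X c) ^ (k - t + s) * MvPolynomial.X c ^ t) := by
    rw [neg_pow]
    simp only [map_mul, map_pow, map_neg, map_one]
    ring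
  rw [h1, MvPolynomial.coeff_C_mul, coeff_trinomial hab hac hbc (by omega), if_pos le_rfl,
    Nat.sub_self, Nat.choose_zero_right, show 0 - 0 + (k - t + s) = k + s - t by omega]
  push_cast
  ring

end Trinomial

/-! ### Consequences of the Jacobi identity -/

section Jacobi

variable {n : ℕ} {R : Type*} [CommRing R] [Algebra ℝ R]
variable {D : Fin n → Derivation ℝ R R} {k : ℕ} {P : ℕ → Fin n → Fin n → DiffPoly n R}

/-- The combination of the coefficients `c_t^{ij}` of the linear part of the bracket which
corresponds to the connection `∇^{[s]}`. -/
def flatCoeffSum (D : Fin n → Derivation ℝ R R) (k : ℕ) (P : ℕ → Fin n → Fin n → DiffPoly n R)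
    (s : ℕ) (i j q : Fin n) : R :=
  flatSum k s fun t => linCoeff D k P t i j q

theorem flatSum_map (d : Derivation ℝ R R) (k s : ℕ) (v : ℕ → R) :
    d (flatSum k s v) = flatSum k s fun t => d (v t) := by
  rw [flatSum, flatSum, map_sum]
  refine Finset.sum_congr rfl fun t _ => ?_
  have : ((-1) ^ (k - t) * ((k + s - t).choose k : R)) =
      algebraMap ℝ R ((-1) ^ (k - t) * ((k + s - t).choose k : ℝ)) := by simp
  rw [this, ← Algebra.smul_def, ← Algebra.smul_def, d.map_smul]

/-- Skew-symmetry in terms of the combinations `flatCoeffSum`. -/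
theorem IsSkew.flatCoeffSum_swap (hP : IsHomogeneousFamily k P) (hS : IsSkew D k P) (s : ℕ)
    (i j q : Fin n) :
    ∑ t ∈ Finset.range (k + 1), (-1) ^ (k - t) * ((k + s - t).choose s : R) *
      linCoeff D k P t j i q = -flatCoeffSum D k P s i j q := by
  have h := hS.linSymbol_swap (S := MvPolynomial (Fin 3) R) q
    (-(MvPolynomial.X 1 + MvPolynomial.X 2)) (MvPolynomial.X 2) hP j i (z := MvPolynomial.X 1) (by ring)
  have h1 := congrArg (fun F => MvPolynomial.coeff
    (Finsupp.single 0 0 + Finsupp.single 1 s + Finsupp.single 2 k)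
    ((MvPolynomial.X 1 + MvPolynomial.X 2) ^ s * F)) h
  simp only [mul_neg, MvPolynomial.coeff_neg] at h1
  have h2 := coeff_two_linear (R := R) (a := (0 : Fin 3)) (b := 1) (c := 2) (by decide) (by decide)
    (by decide) k (s := s) (q := s) (r := k) (by omega) fun t => linCoeff D k P t j i q
  have h3 := coeff_two_linear (R := R) (a := (0 : Fin 3)) (b := 2) (c := 1) (by decide) (by decide)
    (by decide) k (s := s) (q := k) (r := s) (by omega) fun t => linCoeff D k P t i j q
  rw [flatCoeffSum, flatSum, ← h2, ← h3]
  simp only [linSymbol, MvPolynomial.algebraMap_eq] at h1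
  rw [h1, add_comm (MvPolynomial.X 2 : MvPolynomial (Fin 3) R) (MvPolynomial.X 1),
    show (Finsupp.single (0 : Fin 3) 0 + Finsupp.single 2 k + Finsupp.single 1 s : Fin 3 →₀ ℕ) =
      Finsupp.single 0 0 + Finsupp.single 1 s + Finsupp.single 2 k by abel]

/-- The part of the Jacobi identity without jet variables, where `λ + μ + ν = 0`: the coefficient
of `λ^k ν^k`. It relates the derivatives of `g` to the symbols of the bracket. -/
theorem IsJacobi.leadCoeff_identity (hP : IsHomogeneousFamily k P) (hJ : IsJacobi D k P)
    (i j l : Fin n) :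
    (-1) ^ k * (∑ m, flatCoeffSum D k P k i j m * leadCoeff k P m l) +
      (-1) ^ k * (∑ m, D m (leadCoeff k P j l) * leadCoeff k P m i) +
      ∑ m, D m (leadCoeff k P l i) * leadCoeff k P m j = 0 := by
  -- `λ`, `ν` are the variables with indices `0`, `2`, and `μ = -(λ + ν)`
  have h := congrArg (fun T => MvPolynomial.coeff
    (Finsupp.single 1 0 + Finsupp.single 2 k + Finsupp.single 0 k)
    (symbolExpand D i (0 : MvPolynomial (Fin 3) R) (MvPolynomial.X 0)
      (-(MvPolynomial.X 2 + MvPolynomial.X 0)) T).fst) (hJ i j l)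
  simp only [map_add, TrivSqZeroExt.fst_add, fst_symbolExpand_rotate, fst_symbolExpand_rotateInv,
    fst_symbolExpand_doubleBracket _ _ _ _ hP, map_zero, TrivSqZeroExt.fst_zero,
    MvPolynomial.coeff_zero, MvPolynomial.coeff_add, MvPolynomial.coeff_sum] at h
  rw [← h, Finset.mul_sum, Finset.mul_sum]
  have e2 : (-(MvPolynomial.X 0 + -(MvPolynomial.X 2 + MvPolynomial.X 0)) :
    MvPolynomial (Fin 3) R) = MvPolynomial.X 2 := by ring
  rw [e2]
  congr 1
  · congr 1
    · refine Finset.sum_congr rfl fun m _ => ?_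
      have h2 := coeff_two_linear (R := R) (a := (1 : Fin 3)) (b := 2) (c := 0) (by decide)
        (by decide) (by decide) k (s := k) (q := k) (r := k) rfl fun t => linCoeff D k P t i j m
      rw [flatCoeffSum, flatSum, ← h2]
      simp only [linSymbol, MvPolynomial.algebraMap_eq]
      rw [neg_pow (MvPolynomial.X 2 + MvPolynomial.X 0) k]
      have (F : MvPolynomial (Fin 3) R) (y : MvPolynomial (Fin 3) R) :
          F * (MvPolynomial.C (leadCoeff k P m l) * ((-1) ^ k * y ^ k)) =
          MvPolynomial.C ((-1) ^ k * leadCoeff k P m l) * (y ^ k * F) := by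
        simp only [map_mul, map_pow, map_neg, map_one]
        ring
      rw [this, MvPolynomial.coeff_C_mul]
      ring
    · refine Finset.sum_congr rfl fun m _ => ?_
      simp only [linSymbol, MvPolynomial.algebraMap_eq]
      rw [Finset.sum_mul, MvPolynomial.coeff_sum, Finset.sum_eq_single k]
      · have : (MvPolynomial.C (linCoeff D k P k j l m) * MvPolynomial.X 2 ^ (k - k) *
            (-(MvPolynomial.X 2 + MvPolynomial.X 0)) ^ k *
            (MvPolynomial.C (leadCoeff k P m i) * MvPolynomial.X 2 ^ k) :
              MvPolynomial (Fin 3) R) =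
            MvPolynomial.C ((-1) ^ k * (linCoeff D k P k j l m * leadCoeff k P m i)) *
            (MvPolynomial.X 1 ^ 0 * (MvPolynomial.X 1 + (MvPolynomial.X 0 + MvPolynomial.X 2)) ^ 0 *
              (MvPolynomial.X 0 + MvPolynomial.X 2) ^ k * MvPolynomial.X 2 ^ k) := by
          rw [neg_pow, Nat.sub_self]
          simp only [map_mul, map_pow, map_neg, map_one]
          ring
        rw [this, MvPolynomial.coeff_C_mul, show (Finsupp.single (1 : Fin 3) 0 +
          Finsupp.single 2 k + Finsupp.single 0 k : Fin 3 →₀ ℕ) =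
          Finsupp.single 1 0 + Finsupp.single 0 k + Finsupp.single 2 k by abel,
          coeff_trinomial (by decide) (by decide) (by decide) (by omega), linCoeff, if_pos rfl]
        simp
      · intro t ht htk
        have ht' : t ≤ k := Nat.lt_succ_iff.1 (Finset.mem_range.1 ht)
        have : (MvPolynomial.C (linCoeff D k P t j l m) * MvPolynomial.X 2 ^ (k - t) *
            (-(MvPolynomial.X 2 + MvPolynomial.X 0)) ^ t *
            (MvPolynomial.C (leadCoeff k P m i) * MvPolynomial.X 2 ^ k) :
              MvPolynomial (Fin 3) R) =
            MvPolynomial.X 2 ^ (k + (k - t)) * (MvPolynomial.C (linCoeff D k P t j l m) *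
            (-(MvPolynomial.X 2 + MvPolynomial.X 0)) ^ t *
            MvPolynomial.C (leadCoeff k P m i)) := by ring
        rw [this, coeff_X_pow_mul_eq_zero]
        simp
        omega
      · simp
  · refine Finset.sum_congr rfl fun m _ => ?_
    simp only [linSymbol, MvPolynomial.algebraMap_eq]
    rw [Finset.sum_mul, MvPolynomial.coeff_sum, Finset.sum_eq_single k]
    · have : (MvPolynomial.C (linCoeff D k P k l i m) * MvPolynomial.X 0 ^ (k - k) *
          MvPolynomial.X 2 ^ k *
          (MvPolynomial.C (leadCoeff k P m j) * MvPolynomial.X 0 ^ k) :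
            MvPolynomial (Fin 3) R) =
          MvPolynomial.C (linCoeff D k P k l i m * leadCoeff k P m j) *
          (MvPolynomial.X 1 ^ 0 * MvPolynomial.X 2 ^ k * MvPolynomial.X 0 ^ k) := by
        rw [Nat.sub_self]
        simp only [map_mul]
        ring
      rw [this, MvPolynomial.coeff_C_mul, coeff_X_pow_three (by decide) (by decide) (by decide),
        linCoeff, if_pos rfl]
      simp
    · intro t ht htk
      have ht' : t ≤ k := Nat.lt_succ_iff.1 (Finset.mem_range.1 ht)
      have : (MvPolynomial.C (linCoeff D k P t l i m) * MvPolynomial.X 0 ^ (k - t) *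
          MvPolynomial.X 2 ^ t *
          (MvPolynomial.C (leadCoeff k P m j) * MvPolynomial.X 0 ^ k) :
            MvPolynomial (Fin 3) R) =
          MvPolynomial.X 0 ^ (k + (k - t)) * (MvPolynomial.C (linCoeff D k P t l i m) *
          MvPolynomial.X 2 ^ t * MvPolynomial.C (leadCoeff k P m j)) := by ring
      rw [this, coeff_X_pow_mul_eq_zero]
      simp
      omega
    · simp

/-- The part of the Jacobi identity which is linear in the jets of `u^q`, where
`λ + μ + ν + α = 0` for the variable `α` dual to these jets: the coefficient of `λ^k μ^s ν^k` after
multiplication by `(λ + μ + ν)^s`. Raising the two indices of the curvature form of `∇^{[s]}` by `g`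
gives this expression, up to terms with derivatives of `g`. -/
theorem IsJacobi.flatCoeffSum_identity (hD : ∀ i j f, D i (D j f) = D j (D i f))
    (hP : IsHomogeneousFamily k P) (hS : IsSkew D k P) (hJ : IsJacobi D k P) {s : ℕ} (hs : s < k)
    (i j l q : Fin n) :
    (∑ m, leadCoeff k P m i * D m (flatCoeffSum D k P s j l q)) -
      (∑ m, leadCoeff k P m j * D m (flatCoeffSum D k P s i l q)) +
      (∑ m, flatCoeffSum D k P k i j m * flatCoeffSum D k P s m l q) -
      (∑ m, flatCoeffSum D k P s j l m * flatCoeffSum D k P s i m q) +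
      ∑ m, flatCoeffSum D k P s i l m * flatCoeffSum D k P s j m q = 0 := by
  let x : MvPolynomial (Fin 3) R := MvPolynomial.X 0
  let y : MvPolynomial (Fin 3) R := MvPolynomial.X 1
  let z : MvPolynomial (Fin 3) R := MvPolynomial.X 2
  let α : MvPolynomial (Fin 3) R := -(x + (y + z))
  let E : Fin 3 →₀ ℕ := Finsupp.single 0 k + Finsupp.single 1 s + Finsupp.single 2 k
  have h := congrArg (fun T => MvPolynomial.coeff E
    ((x + (y + z)) ^ s * (symbolExpand D q α x y T).snd)) (hJ i j l)
  have hz : -(x + y + α) = z := by simp only [α]; ring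
  obtain ⟨B1, hB1⟩ := exists_snd_symbolExpand_doubleBracket q α x y hD hP i j l
  obtain ⟨B2, hB2⟩ := exists_snd_symbolExpand_doubleBracket q α y z hD hP j l i
  obtain ⟨B3, hB3⟩ := exists_snd_symbolExpand_doubleBracket q α z x hD hP l i j
  simp only [map_add, TrivSqZeroExt.snd_add, snd_symbolExpand_rotate, snd_symbolExpand_rotateInv,
    hz, hB1, hB2, hB3, map_zero, TrivSqZeroExt.snd_zero, mul_zero,
    MvPolynomial.coeff_zero, MvPolynomial.coeff_add, Finset.mul_sum, mul_add (_ ^ s),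
    MvPolynomial.coeff_sum] at h
  -- the terms in which the coefficients of the bracket are differentiated twice; the first one is
  -- divisible by `y ^ k`, and `s < k`
  have b1 (m : Fin n) : MvPolynomial.coeff E ((x + (y + z)) ^ s *
      (algebraMap R (MvPolynomial (Fin 3) R) (leadCoeff k P m l) * y ^ k *
        ((∑ t ∈ Finset.range (k + 1), algebraMap R (MvPolynomial (Fin 3) R)
          (D m (linCoeff D k P t i j q)) * α ^ (k - t) * x ^ t) + y * B1 m))) = 0 := by
    have : (x + (y + z)) ^ s *
      (algebraMap R (MvPolynomial (Fin 3) R) (leadCoeff k P m l) * y ^ k *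
        ((∑ t ∈ Finset.range (k + 1), algebraMap R (MvPolynomial (Fin 3) R)
          (D m (linCoeff D k P t i j q)) * α ^ (k - t) * x ^ t) + y * B1 m)) =
        MvPolynomial.X 1 ^ k * ((x + (y + z)) ^ s *
      (algebraMap R (MvPolynomial (Fin 3) R) (leadCoeff k P m l) *
        ((∑ t ∈ Finset.range (k + 1), algebraMap R (MvPolynomial (Fin 3) R)
          (D m (linCoeff D k P t i j q)) * α ^ (k - t) * x ^ t) + y * B1 m))) := by
      simp only [y]; ring
    rw [this, coeff_X_pow_mul_eq_zero]
    simpa [E] using hs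
  have b2 (m : Fin n) : MvPolynomial.coeff E ((x + (y + z)) ^ s *
      (algebraMap R (MvPolynomial (Fin 3) R) (leadCoeff k P m i) * z ^ k *
        ((∑ t ∈ Finset.range (k + 1), algebraMap R (MvPolynomial (Fin 3) R)
          (D m (linCoeff D k P t j l q)) * α ^ (k - t) * y ^ t) + z * B2 m))) =
      leadCoeff k P m i * D m (flatCoeffSum D k P s j l q) := by
    have h2 := coeff_X_pow_mul_linear (R := R) (a := (2 : Fin 3)) (b := 0) (c := 1) (by decide)
      (by decide) (by decide) k (s := s) (q := k) (r := s) rfl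
      (fun t => D m (linCoeff D k P t j l q)) (B2 m)
    rw [flatCoeffSum, flatSum_map, flatSum, ← h2, ← MvPolynomial.coeff_C_mul]
    rw [show (Finsupp.single (2 : Fin 3) k + Finsupp.single 0 k + Finsupp.single 1 s) = E by
      simp only [E]; abel]
    congr 1
    have e : (MvPolynomial.X 2 + (MvPolynomial.X 0 + MvPolynomial.X 1) :
      MvPolynomial (Fin 3) R) = x + (y + z) := by simp only [x, y, z]; ring
    rw [e]
    simp only [MvPolynomial.algebraMap_eq]
    change _ = _ * (_ * (z ^ k * ((∑ t ∈ Finset.range (k + 1), _ * α ^ (k - t) * y ^ t) + z * _)))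
    ring
  have b3 (m : Fin n) : MvPolynomial.coeff E ((x + (y + z)) ^ s *
      (algebraMap R (MvPolynomial (Fin 3) R) (leadCoeff k P m j) * x ^ k *
        ((∑ t ∈ Finset.range (k + 1), algebraMap R (MvPolynomial (Fin 3) R)
          (D m (linCoeff D k P t l i q)) * α ^ (k - t) * z ^ t) + x * B3 m))) =
      -(leadCoeff k P m j * D m (flatCoeffSum D k P s i l q)) := by
    have h2 := coeff_X_pow_mul_linear (R := R) (a := (0 : Fin 3)) (b := 1) (c := 2) (by decide)
      (by decide) (by decide) k (s := s) (q := s) (r := k) (by omega)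
      (fun t => D m (linCoeff D k P t l i q)) (B3 m)
    have h3 := congrArg (D m) (hS.flatCoeffSum_swap hP s i l q)
    rw [map_neg, map_sum] at h3
    have h4 : ∑ t ∈ Finset.range (k + 1), D m ((-1) ^ (k - t) * ((k + s - t).choose s : R) *
        linCoeff D k P t l i q) = ∑ t ∈ Finset.range (k + 1),
        (-1) ^ (k - t) * ((k + s - t).choose s : R) * D m (linCoeff D k P t l i q) := by
      refine Finset.sum_congr rfl fun t _ => ?_
      have : ((-1) ^ (k - t) * ((k + s - t).choose s : R)) =
          algebraMap ℝ R ((-1) ^ (k - t) * ((k + s - t).choose s : ℝ)) := by simp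
      rw [this, ← Algebra.smul_def, ← Algebra.smul_def, (D m).map_smul]
    rw [← mul_neg, ← h3, h4, ← h2, ← MvPolynomial.coeff_C_mul]
    congr 1
    simp only [MvPolynomial.algebraMap_eq]
    change _ = _ * (_ * (x ^ k * ((∑ t ∈ Finset.range (k + 1), _ * α ^ (k - t) * z ^ t) + x * _)))
    ring
  -- the terms quadratic in the linear part of the bracket
  have q1 (m : Fin n) : MvPolynomial.coeff E ((x + (y + z)) ^ s *
      (linSymbol D k P i j m (y + α) x * linSymbol D k P m l q α y)) =
      flatCoeffSum D k P k i j m * flatCoeffSum D k P s m l q := by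
    have h2 := coeff_flatSum_top_mul_flatSum (R := R) (a := (1 : Fin 3)) (b := 2) (c := 0)
      (by decide) (by decide) (by decide) k s (fun t => linCoeff D k P t i j m)
      (fun t => linCoeff D k P t m l q)
    rw [flatCoeffSum, flatCoeffSum, ← h2, show (Finsupp.single (1 : Fin 3) s +
      Finsupp.single 2 k + Finsupp.single 0 k) = E by simp only [E]; abel]
    have e1 : y + α = -(MvPolynomial.X 2 + MvPolynomial.X 0) := by simp only [α, x, y, z]; ring
    have e : (MvPolynomial.X 1 + (MvPolynomial.X 2 + MvPolynomial.X 0) :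
      MvPolynomial (Fin 3) R) = x + (y + z) := by simp only [x, y, z]; ring
    rw [e, e1]
    rfl
  have q2 (m : Fin n) : MvPolynomial.coeff E ((x + (y + z)) ^ s *
      (linSymbol D k P j l m (z + α) y * linSymbol D k P m i q α z)) =
      -(flatCoeffSum D k P s j l m * flatCoeffSum D k P s i m q) := by
    have h2 := coeff_flatSum_mul_flatSum (R := R) (a := (2 : Fin 3)) (b := 0) (c := 1)
      (by decide) (by decide) (by decide) k s (fun t => linCoeff D k P t j l m)
      (fun t => linCoeff D k P t i m q)
    rw [flatCoeffSum, flatCoeffSum, ← h2, show (Finsupp.single (2 : Fin 3) k +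
      Finsupp.single 0 k + Finsupp.single 1 s) = E by simp only [E]; abel,
      hS.linSymbol_swap q α z hP m i (z := MvPolynomial.X 0 + MvPolynomial.X 1)
        (by simp only [α, x, y, z]; ring)]
    have e1 : z + α = -(MvPolynomial.X 0 + MvPolynomial.X 1) := by simp only [α, x, y, z]; ring
    have e : (MvPolynomial.X 2 + (MvPolynomial.X 0 + MvPolynomial.X 1) :
      MvPolynomial (Fin 3) R) = x + (y + z) := by simp only [x, y, z]; ring
    rw [e, e1, mul_neg, mul_neg, MvPolynomial.coeff_neg]
    rfl
  have q3 (m : Fin n) : MvPolynomial.coeff E ((x + (y + z)) ^ s *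
      (linSymbol D k P l i m (x + α) z * linSymbol D k P m j q α x)) =
      flatCoeffSum D k P s i l m * flatCoeffSum D k P s j m q := by
    have h2 := coeff_flatSum_mul_flatSum (R := R) (a := (0 : Fin 3)) (b := 2) (c := 1)
      (by decide) (by decide) (by decide) k s (fun t => linCoeff D k P t i l m)
      (fun t => linCoeff D k P t j m q)
    rw [flatCoeffSum, flatCoeffSum, ← h2, show (Finsupp.single (0 : Fin 3) k +
      Finsupp.single 2 k + Finsupp.single 1 s) = E by simp only [E]; abel,
      hS.linSymbol_swap q α x hP m j (z := MvPolynomial.X 2 + MvPolynomial.X 1)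
        (by simp only [α, x, y, z]; ring),
      hS.linSymbol_swap m (x + α) z hP l i (z := MvPolynomial.X 1)
        (by simp only [α, x, y, z]; ring)]
    have e1 : x + α = -(MvPolynomial.X 2 + MvPolynomial.X 1) := by simp only [α, x, y, z]; ring
    have e : (MvPolynomial.X 0 + (MvPolynomial.X 2 + MvPolynomial.X 1) :
      MvPolynomial (Fin 3) R) = x + (y + z) := by simp only [x, y, z]; ring
    rw [e, e1, neg_mul_neg]
    have e3 : α = -(x + (y + z)) := rfl
    rw [e3]
    rfl
  simp only [b1, b2, b3, q1, q2, q3, Finset.sum_neg_distrib, Finset.sum_const_zero] at h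
  linear_combination h

end Jacobi

/-! ### Vanishing of the curvature in the ring of functions -/

section Curvature

variable {n : ℕ} {R : Type*} [CommRing R] [Algebra ℝ R]

/-- The component `R_{ab q}^l` of the curvature of the connection with symbols `Γ_{ij}^l`. -/
def curvatureSymbol (D : Fin n → Derivation ℝ R R) (Γ : Fin n → Fin n → Fin n → R)
    (a b q l : Fin n) : R :=
  D a (Γ b q l) - D b (Γ a q l) + ∑ m, (Γ a m l * Γ b q m - Γ b m l * Γ a q m)

variable {D : Fin n → Derivation ℝ R R} {k : ℕ} {P : ℕ → Fin n → Fin n → DiffPoly n R}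

/-- If the combinations `flatCoeffSum` are the symbols `Γ` with the first index raised by `g`, then
the curvature of `Γ` vanishes: the two identities following from the Jacobi identity combine to
`gᵀ K g = 0` for each matrix `K` of components `R_{ab q}^l` with fixed `q` and `l`. -/
theorem curvatureSymbol_eq_zero (hD : ∀ i j f, D i (D j f) = D j (D i f))
    (hP : IsHomogeneousFamily k P) (hS : IsSkew D k P) (hJ : IsJacobi D k P)
    (hg : IsUnit (Matrix.of (leadCoeff k P)).det) {s : ℕ} (hs : s < k)
    {Γ : Fin n → Fin n → Fin n → R}
    (hΓ : ∀ j l q, flatCoeffSum D k P s j l q = ∑ p, leadCoeff k P p j * Γ p q l)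
    (a b q l : Fin n) : curvatureSymbol D Γ a b q l = 0 := by
  set g : Matrix (Fin n) (Fin n) R := Matrix.of (leadCoeff k P) with hgdef
  have hg' (i j : Fin n) : leadCoeff k P i j = g i j := rfl
  have hskew (i j : Fin n) : g i j = -((-1) ^ k * g j i) := hS.leadCoeff_swap hP i j
  have hsq : ((-1 : R) ^ k) * (-1) ^ k = 1 := by rw [← mul_pow]; simp
  have hΓ' (j l q : Fin n) : flatCoeffSum D k P s j l q = ∑ p, g p j * Γ p q l := hΓ j l q
  -- the derivatives of `g` and the quadratic term with upper indices `i`, `j` cancel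
  have key1 (i j p : Fin n) : (∑ m, flatCoeffSum D k P k i j m * g p m) +
      (∑ m, g m i * D m (g p j)) - ∑ m, g m j * D m (g p i) = 0 := by
    have h := hJ.leadCoeff_identity hP i j p
    simp only [hg'] at h
    have e1 : ∑ m, flatCoeffSum D k P k i j m * g m p =
        -((-1) ^ k * ∑ m, flatCoeffSum D k P k i j m * g p m) := by
      rw [Finset.mul_sum, ← Finset.sum_neg_distrib]
      exact Finset.sum_congr rfl fun m _ => by rw [hskew m p]; ring
    have e2 : ∑ m, D m (g j p) * g m i = -((-1) ^ k * ∑ m, g m i * D m (g p j)) := by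
      rw [Finset.mul_sum, ← Finset.sum_neg_distrib]
      refine Finset.sum_congr rfl fun m _ => ?_
      have : g j p = (-(-1) ^ k : ℝ) • g p j := by
        rw [hskew j p, Algebra.smul_def]; simp
      rw [this, (D m).map_smul, Algebra.smul_def]
      simp only [map_neg, map_pow, map_one]
      ring
    have e3 : ∑ m, D m (g p i) * g m j = ∑ m, g m j * D m (g p i) :=
      Finset.sum_congr rfl fun m _ => mul_comm _ _
    rw [e1, e2, e3] at h
    linear_combination (-1 : R) * h - ((∑ m, flatCoeffSum D k P k i j m * g p m) +
      ∑ m, g m i * D m (g p j)) * hsq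
  have key2 (i j : Fin n) :
      ∑ a, ∑ b, g a i * g b j * curvatureSymbol D Γ a b q l = 0 := by
    have h := hJ.flatCoeffSum_identity hD hP hS hs i j l q
    simp only [hg'] at h
    have t1 (i j : Fin n) : ∑ m, g m i * D m (flatCoeffSum D k P s j l q) =
        (∑ a, ∑ b, g a i * g b j * D a (Γ b q l)) + ∑ p, (∑ m, g m i * D m (g p j)) * Γ p q l := by
      simp only [hΓ', map_sum, Derivation.leibniz, smul_eq_mul, Finset.mul_sum, Finset.sum_mul,
        mul_add, Finset.sum_add_distrib]
      congr 1
      · exact Finset.sum_congr rfl fun m _ => Finset.sum_congr rfl fun p _ => by ring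
      · rw [Finset.sum_comm]
        exact Finset.sum_congr rfl fun m _ => Finset.sum_congr rfl fun p _ => by ring
    have t3 : ∑ m, flatCoeffSum D k P k i j m * flatCoeffSum D k P s m l q =
        ∑ p, (∑ m, flatCoeffSum D k P k i j m * g p m) * Γ p q l := by
      simp only [hΓ', Finset.mul_sum, Finset.sum_mul]
      rw [Finset.sum_comm]
      exact Finset.sum_congr rfl fun m _ => Finset.sum_congr rfl fun p _ => by ring
    have t4 (i j : Fin n) : ∑ m, flatCoeffSum D k P s i l m * flatCoeffSum D k P s j m q =
        ∑ a, ∑ b, g a i * g b j * ∑ m, Γ a m l * Γ b q m := by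
      simp only [hΓ', Finset.sum_mul_sum]
      simp only [Finset.mul_sum]
      rw [Finset.sum_comm]
      refine Finset.sum_congr rfl fun a _ => ?_
      rw [Finset.sum_comm]
      exact Finset.sum_congr rfl fun b _ => Finset.sum_congr rfl fun m _ => by ring
    have t5 : ∑ p, ((∑ m, flatCoeffSum D k P k i j m * g p m) +
      (∑ m, g m i * D m (g p j)) - ∑ m, g m j * D m (g p i)) * Γ p q l = 0 :=
      Finset.sum_eq_zero fun p _ => by rw [key1, zero_mul]
    simp only [sub_mul, add_mul, Finset.sum_add_distrib, Finset.sum_sub_distrib] at t5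
    have swap (F : Fin n → Fin n → R) : ∑ a, ∑ b, g a j * g b i * F a b =
        ∑ a, ∑ b, g a i * g b j * F b a := by
      rw [Finset.sum_comm]
      exact Finset.sum_congr rfl fun a _ => Finset.sum_congr rfl fun b _ => by ring
    have t6 := t4 j i
    rw [swap (fun a b => ∑ m, Γ a m l * Γ b q m)] at t6
    have t7 := t1 j i
    rw [swap (fun a b => D a (Γ b q l))] at t7
    rw [t1 i j, t7, t3, t4 i j, t6] at h
    simp only [curvatureSymbol, mul_add, mul_sub, Finset.sum_add_distrib, Finset.sum_sub_distrib]
    linear_combination h - t5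
  have hdet : IsUnit g.transpose.det := by rwa [Matrix.det_transpose]
  let K : Matrix (Fin n) (Fin n) R := Matrix.of fun a b => curvatureSymbol D Γ a b q l
  have hK : g.transpose * K * g = 0 := by
    ext i j
    rw [Matrix.mul_apply, Matrix.zero_apply, ← key2 i j, Finset.sum_comm]
    refine Finset.sum_congr rfl fun b _ => ?_
    rw [Matrix.mul_apply, Finset.sum_mul]
    refine Finset.sum_congr rfl fun a _ => ?_
    simp only [Matrix.transpose_apply, K, Matrix.of_apply]
    ring
  have hK0 : K = 0 := by
    calc K = (g.transpose⁻¹ * g.transpose) * K * (g * g⁻¹) := by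
          rw [Matrix.nonsing_inv_mul _ hdet, Matrix.mul_nonsing_inv _ hg, Matrix.one_mul,
            Matrix.mul_one]
      _ = g.transpose⁻¹ * (g.transpose * K * g) * g⁻¹ := by
          simp only [Matrix.mul_assoc]
      _ = 0 := by rw [hK, Matrix.mul_zero, Matrix.zero_mul]
  exact congrFun (congrFun hK0 a) b

end Curvature

/-! ### The transformation law of the linear part -/

section Transformation

variable {n : ℕ} {R : Type*} [CommRing R] [Algebra ℝ R]
variable {D : Fin n → Derivation ℝ R R} {k : ℕ} {P Q : ℕ → Fin n → Fin n → DiffPoly n R}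

theorem constantCoeff_totalDeriv_iterate (t : ℕ) (f : R) :
    MvPolynomial.constantCoeff ((totalDeriv D)^[t] (MvPolynomial.C f)) = if t = 0 then f else 0 := by
  cases t with
  | zero => simp
  | succ t => rw [Function.iterate_succ_apply', constantCoeff_totalDeriv, if_neg (by omega)]

theorem snd_jetAlong_totalDeriv_iterate (q : Fin n) (t : ℕ) (f : R) :
    (jetAlong D q (1 : R) ((totalDeriv D)^[t] (MvPolynomial.C f))).snd = D q f := by
  induction t with
  | zero => simp [snd_jetAlong_C]
  | succ t ih => rw [Function.iterate_succ_apply', snd_jetAlong_totalDeriv, ih, one_mul]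

/-- To first order, with all jets of `u^q` equal to `ε`, the substitution `ũ^{l,a} = ∂ₓ^a ũ^l`
replaces every `ũ^{l,a}` by `ε ∂ũ^l/∂u^q`. -/
theorem jetAlong_jetSubst (q : Fin n) (v : Fin n → R) (f : DiffPoly n R) :
    (jetAlong D q (1 : R) (jetSubst D v f)).snd =
      (jetExpand (D q) (fun w => D q (v w.1)) f).snd := by
  have : (jetAlong D q (1 : R)).comp (jetSubst D v) =
      jetExpand (D q) (fun w => D q (v w.1)) := by
    refine MvPolynomial.ringHom_ext (fun a => ?_) fun w => ?_
    · simp [jetSubst, jetAlong]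
    · rw [RingHom.comp_apply, jetSubst, MvPolynomial.coe_eval₂Hom, MvPolynomial.eval₂_X]
      ext
      · rw [fst_jetAlong, constantCoeff_totalDeriv_iterate, if_neg (by omega), fst_jetExpand]
        simp
      · rw [snd_jetAlong_totalDeriv_iterate, snd_jetExpand_X]
  rw [← this, RingHom.comp_apply]

variable {v : Fin n → R}

/-- The transformation rule of the coefficients under the coordinate change `ũ = v`. -/
def IsTransformed (D : Fin n → Derivation ℝ R R) (k : ℕ) (v : Fin n → R)
    (P Q : ℕ → Fin n → Fin n → DiffPoly n R) : Prop :=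
  ∀ s i j, s ≤ k → jetSubst D v (Q s i j) =
    ∑ t ∈ Finset.range (k - s + 1), ∑ i', ∑ j',
      ((s + t).choose s : DiffPoly n R) * MvPolynomial.C (D i' (v i)) * P (s + t) i' j' *
        (totalDeriv D)^[t] (MvPolynomial.C (D j' (v j)))

theorem IsTransformed.leadCoeff (hQ : IsHomogeneousFamily k Q)
    (h : IsTransformed D k v P Q) (i j : Fin n) :
    leadCoeff k Q i j = ∑ a, ∑ b, D a (v i) * leadCoeff k P a b * D b (v j) := by
  have h1 := h k i j le_rfl
  have h2 := hQ k i j le_rfl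
  rw [Nat.sub_self] at h1 h2
  rw [eq_C_of_isWeightedHomogeneous_zero h2] at h1
  have h3 := congrArg MvPolynomial.constantCoeff h1
  simpa [jetSubst, LocalPoisson.leadCoeff] using h3

/-- The part of the transformation rule which is linear in the jets of `u^q`: in the sum over `t`
only `t = 0` and `t = k - s` contribute. -/
theorem IsTransformed.linCoeff (hP : IsHomogeneousFamily k P) (hQ : IsHomogeneousFamily k Q)
    (h : IsTransformed D k v P Q) {s : ℕ} (hs : s < k) (i j q : Fin n) :
    ∑ l, linCoeff D k Q s i j l * D q (v l) =
      (∑ a, ∑ b, D a (v i) * linCoeff D k P s a b q * D b (v j)) +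
        (k.choose s : R) * ∑ a, ∑ b, D a (v i) * LocalPoisson.leadCoeff k P a b *
          D q (D b (v j)) := by
  have h1 := congrArg (fun f => (jetAlong D q (1 : R) f).snd) (h s i j hs.le)
  obtain ⟨N, hN⟩ : ∃ N, k - s = N + 1 := ⟨k - s - 1, by omega⟩
  have h2 := hQ s i j hs.le
  rw [hN] at h2
  rw [jetAlong_jetSubst q v, snd_jetExpand_of_isWeightedHomogeneous _ _ h2] at h1
  have hc (l : Fin n) : LocalPoisson.linCoeff D k Q s i j l =
      (Q s i j).coeff (Finsupp.single (l, N) 1) := by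
    rw [LocalPoisson.linCoeff, if_neg hs.ne, hN, Nat.add_sub_cancel]
  simp only [Algebra.algebraMap_self, RingHom.id_apply, ← hc] at h1
  rw [h1]
  simp only [map_sum, TrivSqZeroExt.snd_sum]
  have hterm (t : ℕ) (ht : t ∈ Finset.range (k - s + 1)) (a b : Fin n) :
      (jetAlong D q (1 : R) (((s + t).choose s : DiffPoly n R) * MvPolynomial.C (D a (v i)) *
        P (s + t) a b * (totalDeriv D)^[t] (MvPolynomial.C (D b (v j))))).snd =
      (if t = 0 then D a (v i) * LocalPoisson.linCoeff D k P s a b q * D b (v j) else 0) +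
      if t = k - s then (k.choose s : R) * (D a (v i) * LocalPoisson.leadCoeff k P a b *
          D q (D b (v j))) else 0 := by
    have ht' : s + t ≤ k := by
      have := Finset.mem_range.1 ht
      omega
    rw [snd_jetAlong_mul, snd_jetAlong_mul, snd_jetAlong_totalDeriv_iterate,
      constantCoeff_totalDeriv_iterate, map_mul, constantCoeff_eq_ite hP ht',
      snd_jetAlong_coeff hP ht']
    simp only [Algebra.algebraMap_self, RingHom.id_apply, one_pow, mul_one, map_mul, map_natCast,
      MvPolynomial.constantCoeff_C]
    by_cases h0 : t = 0
    · subst h0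
      rw [if_neg (by omega), if_pos rfl, if_pos rfl, if_neg (by omega)]
      simp
    · rw [if_neg h0, if_neg h0]
      by_cases h3 : t = k - s
      · rw [if_pos h3, if_pos (by omega), show s + t = k by omega]
        ring
      · rw [if_neg h3, if_neg (by omega)]
        ring
  rw [Finset.sum_congr rfl fun t ht => Finset.sum_congr rfl fun a _ =>
    Finset.sum_congr rfl fun b _ => hterm t ht a b]
  simp only [Finset.sum_add_distrib]
  congr 1
  · rw [Finset.sum_eq_single 0]
    · simp
    · intro t _ ht
      simp [ht]
    · simp
  · rw [Finset.sum_eq_single (k - s)]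
    · simp only [if_true, Finset.mul_sum]
    · intro t _ ht
      simp [ht]
    · simp

end Transformation

/-! ### Calculus in coordinate charts -/

section ChartCalculus

open Filter Topology

variable {n : ℕ} {M : Type*} [TopologicalSpace M] [ChartedSpace (EuclideanSpace ℝ (Fin n)) M]

/-- The points `v` of the chart with `e⁻¹ v ∈ W` form a neighbourhood of `e x`, for `x ∈ W`. -/
theorem eventually_mem_chart (e : Coord n M) {W : Opens M} (hW : W ≤ e.dom) {x : M} (hx : x ∈ W) :
    ∀ᶠ v in 𝓝 (e.1 x), v ∈ e.1.target ∧ e.1.symm v ∈ W := by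
  have hxe : x ∈ e.1.source := hW hx
  have h1 : e.1.target ∈ 𝓝 (e.1 x) := e.1.open_target.mem_nhds (e.1.map_source hxe)
  have h2 : ∀ᶠ v in 𝓝 (e.1 x), e.1.symm v ∈ W := by
    have hc := e.1.continuousAt_symm (e.1.map_source hxe)
    refine hc.eventually ?_
    rw [e.1.left_inv hxe]
    exact W.isOpen.mem_nhds hx
  filter_upwards [h1, h2] with v hv hv' using ⟨hv, hv'⟩

theorem eventually_extendZero_partialFun (e : Coord n M) {W : Opens M} (hW : W ≤ e.dom)
    (i : Fin n) (f : W → ℝ) {x : M} (hx : x ∈ W) :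
    extendZero (partialFun e i f) ∘ e.1.symm =ᶠ[𝓝 (e.1 x)]
      fun v => fderiv ℝ (extendZero f ∘ e.1.symm) v (EuclideanSpace.single i 1) := by
  filter_upwards [eventually_mem_chart e hW hx] with v hv
  have := extendZero_apply (partialFun e i f) ⟨e.1.symm v, hv.2⟩
  rw [Function.comp_apply, this, partialFun, e.1.right_inv hv.1]

theorem partialDeriv_apply (e : Coord n M) {W : Opens M} (hW : W ≤ e.dom) (i : Fin n)
    (f : Smooth (n := n) W) (x : W) : partialDeriv e hW i f x = partialFun e i f x := rfl

theorem partialDeriv_comm (e : Coord n M) {W : Opens M} (hW : W ≤ e.dom) (i j : Fin n)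
    (f : Smooth (n := n) W) :
    partialDeriv e hW i (partialDeriv e hW j f) = partialDeriv e hW j (partialDeriv e hW i f) := by
  have key (i j : Fin n) (x : W) : partialDeriv e hW i (partialDeriv e hW j f) x =
      fderiv ℝ (fderiv ℝ (extendZero f ∘ e.1.symm)) (e.1 x) (EuclideanSpace.single i 1)
        (EuclideanSpace.single j 1) := by
    change fderiv ℝ (extendZero (partialFun e j f) ∘ e.1.symm) (e.1 x) _ = _
    have hd := ((contDiffAt_extendZero e hW f x.2).fderiv_right (m := ∞)
      (by simp)).differentiableAt (by simp)
    rw [(eventually_extendZero_partialFun e hW j f x.2).fderiv_eq,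
      fderiv_clm_apply hd (differentiableAt_const _)]
    simp
  ext x
  rw [key, key]
  exact ((contDiffAt_extendZero e hW f x.2).isSymmSndFDerivAt (by simpa using (ENat.LEInfty.out : (2 : WithTop ℕ∞) ≤ ∞))) _ _

theorem isUnit_smooth {W : Opens M} {f : Smooth (n := n) W} (hf : ∀ x, f x ≠ 0) : IsUnit f := by
  refine IsUnit.of_mul_eq_one
    (⟨fun x => (f x)⁻¹, f.contMDiff.inv₀ hf⟩ : Smooth (n := n) W) ?_
  ext x
  exact mul_inv_cancel₀ (hf x)

/-- Evaluation of smooth functions on `W` at a point of `W`. -/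
abbrev evalAt {W : Opens M} (x : W) : Smooth (n := n) W →+* ℝ := ContMDiffMap.evalRingHom x

theorem evalAt_apply {W : Opens M} (x : W) (f : Smooth (n := n) W) : evalAt x f = f x := rfl

/-- The change of coordinates from `e` to `e'`. -/
def transition (e e' : Coord n M) : EuclideanSpace ℝ (Fin n) → EuclideanSpace ℝ (Fin n) :=
  e'.1 ∘ e.1.symm

theorem contDiffAt_transition (e e' : Coord n M) {x : M} (hx : x ∈ e.dom) (hx' : x ∈ e'.dom) :
    ContDiffAt ℝ ∞ (transition e e') (e.1 x) := by
  have h1 := contMDiffAt_symm_of_mem_maximalAtlas e.2 (e.1.map_source hx)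
  have h2 : ContMDiffAt (𝓡 n) (𝓡 n) ∞ e'.1 (e.1.symm (e.1 x)) := by
    rw [e.1.left_inv hx]
    exact contMDiffAt_of_mem_maximalAtlas e'.2 hx'
  exact (h2.comp _ h1).contDiffAt

theorem fderiv_transition_apply (e e' : Coord n M) {v : EuclideanSpace ℝ (Fin n)}
    (hv : DifferentiableAt ℝ (transition e e') v) (w : EuclideanSpace ℝ (Fin n)) (i : Fin n) :
    fderiv ℝ (fun v => transition e e' v i) v w = fderiv ℝ (transition e e') v w i := by
  have := ((EuclideanSpace.proj i : EuclideanSpace ℝ (Fin n) →L[ℝ] ℝ).hasFDerivAt.comp v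
    hv.hasFDerivAt).fderiv
  change fderiv ℝ ((EuclideanSpace.proj i : EuclideanSpace ℝ (Fin n) →L[ℝ] ℝ) ∘
    transition e e') v w = _
  rw [this]
  rfl

section Overlap

variable (e e' : Coord n M) {x : M}

theorem eventually_coordFun (hx : x ∈ e.dom ⊓ e'.dom) (j : Fin n) :
    extendZero (coordFun e' (inf_le_right : e.dom ⊓ e'.dom ≤ e'.dom) j) ∘ e.1.symm
      =ᶠ[𝓝 (e.1 x)] fun v => transition e e' v j := by
  filter_upwards [eventually_mem_chart e (inf_le_left : e.dom ⊓ e'.dom ≤ e.dom) hx] with v hv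
  have := extendZero_apply (coordFun e' (inf_le_right : e.dom ⊓ e'.dom ≤ e'.dom) j)
    ⟨e.1.symm v, hv.2⟩
  rw [Function.comp_apply, this]
  rfl

theorem partialDeriv_coordFun (hx : x ∈ e.dom ⊓ e'.dom) (a j : Fin n) :
    partialDeriv e (inf_le_left : e.dom ⊓ e'.dom ≤ e.dom) a
      (coordFun e' (inf_le_right : e.dom ⊓ e'.dom ≤ e'.dom) j) ⟨x, hx⟩ =
      fderiv ℝ (transition e e') (e.1 x) (EuclideanSpace.single a 1) j := by
  rw [partialDeriv_apply, partialFun, (eventually_coordFun e e' hx j).fderiv_eq,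
    fderiv_transition_apply]
  exact (contDiffAt_transition e e' hx.1 hx.2).differentiableAt (by simp)

theorem partialDeriv_partialDeriv_coordFun (hx : x ∈ e.dom ⊓ e'.dom) (q a j : Fin n) :
    partialDeriv e (inf_le_left : e.dom ⊓ e'.dom ≤ e.dom) q
      (partialDeriv e (inf_le_left : e.dom ⊓ e'.dom ≤ e.dom) a
        (coordFun e' (inf_le_right : e.dom ⊓ e'.dom ≤ e'.dom) j)) ⟨x, hx⟩ =
      fderiv ℝ (fderiv ℝ (transition e e')) (e.1 x) (EuclideanSpace.single q 1)
        (EuclideanSpace.single a 1) j := by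
  have hc := contDiffAt_transition e e' hx.1 hx.2
  have h1 : extendZero (partialFun e a
      (coordFun e' (inf_le_right : e.dom ⊓ e'.dom ≤ e'.dom) j)) ∘ e.1.symm =ᶠ[𝓝 (e.1 x)]
      fun v => fderiv ℝ (transition e e') v (EuclideanSpace.single a 1) j := by
    filter_upwards [eventually_extendZero_partialFun e (inf_le_left : e.dom ⊓ e'.dom ≤ e.dom) a
      (coordFun e' (inf_le_right : e.dom ⊓ e'.dom ≤ e'.dom) j) hx,
      (eventually_coordFun e e' hx j).eventually_nhds, (hc.of_le (m := 1) (by simp)).eventually (by simp)] with v h2 h3 h4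
    rw [h2, Filter.EventuallyEq.fderiv_eq h3, fderiv_transition_apply]
    exact h4.differentiableAt (by simp)
  change fderiv ℝ (extendZero (partialFun e a
      (coordFun e' (inf_le_right : e.dom ⊓ e'.dom ≤ e'.dom) j)) ∘ e.1.symm) (e.1 x) _ = _
  rw [h1.fderiv_eq]
  have hd := (hc.fderiv_right (m := ∞) (by simp)).differentiableAt (by simp)
  have h5 : HasFDerivAt (fun v => fderiv ℝ (transition e e') v (EuclideanSpace.single a 1))
      ((fderiv ℝ (fderiv ℝ (transition e e')) (e.1 x)).flip (EuclideanSpace.single a 1))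
      (e.1 x) := by
    simpa using hd.hasFDerivAt.clm_apply (hasFDerivAt_const (EuclideanSpace.single a 1) (e.1 x))
  have h6 := ((EuclideanSpace.proj j : EuclideanSpace ℝ (Fin n) →L[ℝ] ℝ).hasFDerivAt.comp
    (e.1 x) h5).fderiv
  change fderiv ℝ ((EuclideanSpace.proj j : EuclideanSpace ℝ (Fin n) →L[ℝ] ℝ) ∘
    fun v => fderiv ℝ (transition e e') v (EuclideanSpace.single a 1)) (e.1 x) _ = _
  rw [h6]
  rfl

end Overlap

end ChartCalculus

/-! ### The symbols of the standard connections in a chart -/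

section Christoffel

variable {n k : ℕ} {M : Type*} [TopologicalSpace M] [ChartedSpace (EuclideanSpace ℝ (Fin n)) M]
variable (B : HomogeneousPoissonBracket n k M) (e : Coord n M)

theorem HomogeneousPoissonBracket.isHomogeneousFamily : IsHomogeneousFamily k (B.P e) :=
  fun s i j hs => B.homogeneous e s i j hs

theorem HomogeneousPoissonBracket.leadCoeff_eq (i j : Fin n) :
    leadCoeff k (B.P e) i j = B.g e i j := rfl

theorem HomogeneousPoissonBracket.linCoeff_eq
    (D : Fin n → Derivation ℝ (Smooth (n := n) e.dom) (Smooth (n := n) e.dom))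
    {s : ℕ} (hs : s < k) (i j l : Fin n) :
    linCoeff D k (B.P e) s i j l = B.h e s i j l := by
  rw [linCoeff, if_neg hs.ne, HomogeneousPoissonBracket.h]

variable {B}

theorem HomogeneousPoissonBracket.Nondegenerate.isUnit_det (hB : B.Nondegenerate) :
    IsUnit (Matrix.of (leadCoeff k (B.P e))).det := by
  refine isUnit_smooth fun x => ?_
  have h := RingHom.map_det (evalAt (n := n) x) (Matrix.of (leadCoeff k (B.P e)))
  rw [evalAt_apply] at h
  rw [h]
  exact hB e x

end Christoffel

section ChartSymbols

variable {n k : ℕ} {M : Type*} [TopologicalSpace M] [ChartedSpace (EuclideanSpace ℝ (Fin n)) M]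
variable (B : HomogeneousPoissonBracket n k M) (e : Coord n M)

/-- The symbols `Γ_{(t)ij}^l` as smooth functions on the domain of the chart. -/
def HomogeneousPoissonBracket.christoffelFun (t : ℕ) (i j l : Fin n) : Smooth (n := n) e.dom :=
  (-(k.choose t : ℝ)⁻¹) • ∑ p, (Matrix.of (leadCoeff k (B.P e)))⁻¹ i p * B.h e t p l j

/-- The symbols of the connection `∇^{[s]}`. -/
def HomogeneousPoissonBracket.flatFun (s : ℕ) (i j l : Fin n) : Smooth (n := n) e.dom :=
  ∑ t ∈ Finset.range (s + 1), flatCoeff k s t • B.christoffelFun e t i j l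

variable {B}

theorem HomogeneousPoissonBracket.Nondegenerate.christoffelFun_apply (hB : B.Nondegenerate)
    (t : ℕ) (i j l : Fin n) (x : e.dom) :
    B.christoffelFun e t i j l x = B.christoffel e t i j l x := by
  have h := congrArg (evalAt x).mapMatrix (Matrix.nonsing_inv_mul _ (hB.isUnit_det e))
  rw [map_mul, map_one] at h
  have h1 : (B.gMatrix e x)⁻¹ = (evalAt x).mapMatrix (Matrix.of (leadCoeff k (B.P e)))⁻¹ :=
    Matrix.inv_eq_left_inv h
  rw [christoffel, h1, ← evalAt_apply, christoffelFun]
  change (-(k.choose t : ℝ)⁻¹) * evalAt x _ = _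
  simp only [map_sum, map_mul]
  rw [neg_mul]
  rfl

/-- `h_{(t)l}^{ij}` in terms of the symbols of the `t`-th standard connection. -/
theorem HomogeneousPoissonBracket.Nondegenerate.h_eq (hB : B.Nondegenerate) {t : ℕ} (ht : t ≤ k)
    (i j l : Fin n) :
    B.h e t i j l = (-(k.choose t : ℝ)) • ∑ p, B.g e i p * B.christoffelFun e t p l j := by
  have h : ∀ a, ∑ p, B.g e i p * (Matrix.of (leadCoeff k (B.P e)))⁻¹ p a =
      if i = a then 1 else 0 := by
    intro a
    have := congrFun (congrFun (Matrix.mul_nonsing_inv _ (hB.isUnit_det e)) i) a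
    rw [Matrix.mul_apply, Matrix.one_apply] at this
    exact this
  have hc : (k.choose t : ℝ) ≠ 0 := by exact_mod_cast (Nat.choose_pos ht).ne'
  have h1 : ∑ p, B.g e i p * B.christoffelFun e t p l j =
      (-(k.choose t : ℝ)⁻¹) • B.h e t i j l := by
    simp only [christoffelFun, mul_smul_comm, ← Finset.smul_sum, Finset.mul_sum]
    rw [Finset.sum_comm]
    simp only [← mul_assoc, ← Finset.sum_mul, h]
    simp
  rw [h1, smul_smul, neg_mul_neg, mul_inv_cancel₀ hc, one_smul]

/-- The combinations `flatCoeffSum` are the symbols of `∇^{[s]}` with the first index raised by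
`g`. The sum over `t ≤ k` stops at `t = s`, since `(k+s-t choose k) = 0` for `t > s`. -/
theorem HomogeneousPoissonBracket.Nondegenerate.flatCoeffSum_eq (hB : B.Nondegenerate) {s : ℕ}
    (hs : s < k) (j l q : Fin n) :
    flatCoeffSum (partialDeriv e le_rfl) k (B.P e) s j l q =
      ∑ p, leadCoeff k (B.P e) p j * B.flatFun e s p q l := by
  have hterm : ∀ t ∈ Finset.range (s + 1),
      (-1) ^ (k - t) * ((k + s - t).choose k : Smooth (n := n) e.dom) *
        linCoeff (partialDeriv e le_rfl) k (B.P e) t j l q =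
      flatCoeff k s t • ∑ p, leadCoeff k (B.P e) p j * B.christoffelFun e t p q l := by
    intro t ht
    have htk : t < k := by
      have := Finset.mem_range.1 ht
      omega
    have h1 : ((-1) ^ (k - t) * ((k + s - t).choose k : Smooth (n := n) e.dom)) =
        algebraMap ℝ _ ((-1) ^ (k - t) * ((k + s - t).choose k : ℝ)) := by simp
    have h2 : ∑ p, B.g e j p * B.christoffelFun e t p q l =
        (-(-1) ^ k : ℝ) • ∑ p, leadCoeff k (B.P e) p j * B.christoffelFun e t p q l := by
      rw [Finset.smul_sum]
      refine Finset.sum_congr rfl fun p _ => ?_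
      rw [← B.leadCoeff_eq, (B.skew e).leadCoeff_swap (B.isHomogeneousFamily e), Algebra.smul_def]
      simp
      ring
    rw [B.linCoeff_eq e _ htk, hB.h_eq e htk.le, h2, h1, ← Algebra.smul_def, smul_smul, smul_smul]
    congr 1
    have h3 : ((-1 : ℝ) ^ (k - t)) * (-1) ^ k = (-1) ^ t := by
      have : ((-1 : ℝ) ^ (k - t)) * (-1) ^ (k - t) = 1 := by rw [← mul_pow]; simp
      calc ((-1 : ℝ) ^ (k - t)) * (-1) ^ k
          = ((-1 : ℝ) ^ (k - t)) * (-1) ^ ((k - t) + t) := by rw [Nat.sub_add_cancel htk.le]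
        _ = ((-1 : ℝ) ^ (k - t)) * (-1) ^ (k - t) * (-1) ^ t := by rw [pow_add, mul_assoc]
        _ = _ := by rw [this, one_mul]
    rw [flatCoeff, ← h3]
    ring
  rw [flatCoeffSum, flatSum, ← Finset.sum_subset (Finset.range_mono (by omega : s + 1 ≤ k + 1)),
    Finset.sum_congr rfl hterm]
  · simp only [flatFun, Finset.mul_sum, Finset.smul_sum, mul_smul_comm]
    exact Finset.sum_comm
  · intro t _ ht
    have := mt Finset.mem_range.2 ht
    rw [Nat.choose_eq_zero_of_lt (by omega)]
    simp

/-- In every chart the symbols of `∇^{[s]}` have vanishing curvature. -/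
theorem HomogeneousPoissonBracket.Nondegenerate.curvatureSymbol_flatFun (hB : B.Nondegenerate)
    {s : ℕ} (hs : s < k) (a b q l : Fin n) :
    curvatureSymbol (partialDeriv e le_rfl) (B.flatFun e s) a b q l = 0 :=
  curvatureSymbol_eq_zero (partialDeriv_comm e le_rfl) (B.isHomogeneousFamily e) (B.skew e)
    (B.jacobi e) (hB.isUnit_det e) hs (hB.flatCoeffSum_eq e hs) a b q l

/-- The linear algebra behind the transformation rule of the symbols: the invertible factor
`J g` is cancelled. -/
theorem symbol_transform_of_coeff_transform {g g' J : Matrix (Fin n) (Fin n) ℝ}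
    (hg : g' = J * g * J.transpose) (hg' : g'.det ≠ 0) {c : ℝ} (hc : c ≠ 0)
    {h h' Γ Γ' H : Fin n → Fin n → Fin n → ℝ}
    (hh : ∀ i j q, h i j q = -c * ∑ p, g i p * Γ p q j)
    (hh' : ∀ i j q, h' i j q = -c * ∑ p, g' i p * Γ' p q j)
    (ht : ∀ i j q, ∑ l, h' i j l * J l q =
      (∑ a, ∑ b, J i a * h a b q * J j b) + c * ∑ a, ∑ b, J i a * g a b * H j q b)
    (m q j : Fin n) :
    ∑ p, ∑ l, J p m * J l q * Γ' p l j = ∑ b, J j b * Γ m q b - H j q m := by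
  have hdet : (J * g).det ≠ 0 := by
    intro h0
    apply hg'
    rw [hg, Matrix.det_mul, h0, zero_mul]
  have key := Matrix.eq_zero_of_mulVec_eq_zero hdet
    (v := fun m => ∑ p, ∑ l, J p m * J l q * Γ' p l j - (∑ b, J j b * Γ m q b - H j q m)) ?_
  · exact sub_eq_zero.1 (congrFun key m)
  · funext i
    have h1 := ht i j q
    simp only [hh, hh', hg] at h1
    have e1 : ∑ l, -c * (∑ p, (J * g * J.transpose) i p * Γ' p l j) * J l q =
        -c * ∑ m, (J * g) i m * ∑ p, ∑ l, J p m * J l q * Γ' p l j := by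
      simp only [Matrix.mul_apply (M := J * g), Matrix.transpose_apply, Finset.mul_sum,
        Finset.sum_mul]
      rw [Finset.sum_comm]
      refine (Finset.sum_congr rfl fun p _ => Finset.sum_comm).trans ?_
      rw [Finset.sum_comm]
      refine Finset.sum_congr rfl fun m _ => Finset.sum_congr rfl fun p _ =>
        Finset.sum_congr rfl fun l _ => by ring
    have e2 : ∑ a, ∑ b, J i a * (-c * ∑ p, g a p * Γ p q b) * J j b =
        -c * ∑ m, (J * g) i m * ∑ b, J j b * Γ m q b := by
      simp only [Matrix.mul_apply, Finset.mul_sum, Finset.sum_mul]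
      refine (Finset.sum_congr rfl fun p _ => Finset.sum_comm).trans ?_
      rw [Finset.sum_comm]
      refine Finset.sum_congr rfl fun m _ => ?_
      rw [Finset.sum_comm]
      refine Finset.sum_congr rfl fun p _ =>
        Finset.sum_congr rfl fun l _ => by ring
    have e3 : ∑ a, ∑ b, J i a * g a b * H j q b = ∑ m, (J * g) i m * H j q m := by
      simp only [Matrix.mul_apply, Finset.sum_mul]
      exact Finset.sum_comm
    rw [e1, e2, e3] at h1
    simp only [Matrix.mulVec, dotProduct, Pi.zero_apply, mul_sub, Finset.sum_sub_distrib]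
    apply mul_left_cancel₀ (neg_ne_zero.2 hc)
    linear_combination h1

theorem isWeightedHomogeneous_restrict {V W : Opens M} (h : W ≤ V)
    {f : DiffPoly n (Smooth (n := n) V)} {w : Fin n × ℕ → ℕ} {N : ℕ}
    (hf : MvPolynomial.IsWeightedHomogeneous w f N) :
    MvPolynomial.IsWeightedHomogeneous w (restrict h f) N := by
  intro d hd
  refine hf fun h0 => hd ?_
  rw [restrict, MvPolynomial.coeff_map, h0, map_zero]

/-- The transformation rule of the symbols of the standard connections between two charts. -/
theorem HomogeneousPoissonBracket.Nondegenerate.christoffel_transform (hB : B.Nondegenerate)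
    (e e' : Coord n M) {x : M} (hx : x ∈ e.dom) (hx' : x ∈ e'.dom) {t : ℕ} (ht : t < k)
    (m q j : Fin n) :
    ∑ p, ∑ l, fderiv ℝ (transition e e') (e.1 x) (EuclideanSpace.single m 1) p *
        fderiv ℝ (transition e e') (e.1 x) (EuclideanSpace.single q 1) l *
        B.christoffel e' t p l j ⟨x, hx'⟩ =
      ∑ b, fderiv ℝ (transition e e') (e.1 x) (EuclideanSpace.single b 1) j *
        B.christoffel e t m q b ⟨x, hx⟩ -
      fderiv ℝ (fderiv ℝ (transition e e')) (e.1 x) (EuclideanSpace.single q 1)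
        (EuclideanSpace.single m 1) j := by
  have hW : x ∈ e.dom ⊓ e'.dom := ⟨hx, hx'⟩
  set P : ℕ → Fin n → Fin n → DiffPoly n (Smooth (n := n) (e.dom ⊓ e'.dom)) :=
    fun s i j => restrict inf_le_left (B.P e s i j) with hPdef
  set Q : ℕ → Fin n → Fin n → DiffPoly n (Smooth (n := n) (e.dom ⊓ e'.dom)) :=
    fun s i j => restrict inf_le_right (B.P e' s i j) with hQdef
  have hP : IsHomogeneousFamily k P := fun s i j hs => isWeightedHomogeneous_restrict _ (B.homogeneous e s i j hs)
  have hQ : IsHomogeneousFamily k Q := fun s i j hs => isWeightedHomogeneous_restrict _ (B.homogeneous e' s i j hs)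
  have hT : IsTransformed (partialDeriv e inf_le_left) k (coordFun e' inf_le_right) P Q :=
    fun s i j hs => B.transform e e' s i j hs
  -- the coefficients of the bracket on the overlap are the restrictions of those on the charts
  have gP (i j : Fin n) : (leadCoeff k P i j) ⟨x, hW⟩ = B.g e i j ⟨x, hx⟩ := by
    rw [leadCoeff, hPdef]
    simp only [restrict, MvPolynomial.constantCoeff_map]
    rfl
  have gQ (i j : Fin n) : (leadCoeff k Q i j) ⟨x, hW⟩ = B.g e' i j ⟨x, hx'⟩ := by
    rw [leadCoeff, hQdef]
    simp only [restrict, MvPolynomial.constantCoeff_map]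
    rfl
  have lP (i j q : Fin n) : (linCoeff (partialDeriv e inf_le_left) k P t i j q) ⟨x, hW⟩ =
      B.h e t i j q ⟨x, hx⟩ := by
    rw [linCoeff, if_neg ht.ne]
    simp only [hPdef, restrict, MvPolynomial.coeff_map]
    rfl
  have lQ (i j q : Fin n) : (linCoeff (partialDeriv e inf_le_left) k Q t i j q) ⟨x, hW⟩ =
      B.h e' t i j q ⟨x, hx'⟩ := by
    rw [linCoeff, if_neg ht.ne]
    simp only [hQdef, restrict, MvPolynomial.coeff_map]
    rfl
  have hh (e : Coord n M) (hx : x ∈ e.dom) (i j q : Fin n) : B.h e t i j q ⟨x, hx⟩ =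
      -(k.choose t : ℝ) * ∑ p, B.g e i p ⟨x, hx⟩ * B.christoffel e t p q j ⟨x, hx⟩ := by
    simp only [← hB.christoffelFun_apply]
    rw [hB.h_eq e ht.le, ← evalAt_apply]
    change -(k.choose t : ℝ) * evalAt _ _ = _
    simp only [map_sum, map_mul]
    rfl
  refine symbol_transform_of_coeff_transform (c := k.choose t)
    (g := B.gMatrix e ⟨x, hx⟩) (g' := B.gMatrix e' ⟨x, hx'⟩)
    (J := Matrix.of fun i a => fderiv ℝ (transition e e') (e.1 x) (EuclideanSpace.single a 1) i)
    (h := fun i j q => B.h e t i j q ⟨x, hx⟩) (h' := fun i j q => B.h e' t i j q ⟨x, hx'⟩)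
    (Γ := fun i j q => B.christoffel e t i j q ⟨x, hx⟩)
    (Γ' := fun i j q => B.christoffel e' t i j q ⟨x, hx'⟩)
    (H := fun j q m => fderiv ℝ (fderiv ℝ (transition e e')) (e.1 x) (EuclideanSpace.single q 1)
        (EuclideanSpace.single m 1) j) ?_ (hB e' _)
    (by exact_mod_cast (Nat.choose_pos ht.le).ne') (hh e hx) (hh e' hx') ?_ m q j
  · ext i j
    have h := congrArg (evalAt (n := n) (⟨x, hW⟩ : (e.dom ⊓ e'.dom : Opens M))) (hT.leadCoeff hQ i j)
    simp only [map_sum, map_mul, evalAt_apply, gP, gQ, partialDeriv_coordFun e e' hW] at h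
    simp only [Matrix.mul_apply, Matrix.transpose_apply, HomogeneousPoissonBracket.gMatrix,
      Matrix.of_apply, Finset.sum_mul]
    rw [h, Finset.sum_comm]
  · intro i j q
    have h := congrArg (evalAt (n := n) (⟨x, hW⟩ : (e.dom ⊓ e'.dom : Opens M)))
      (hT.linCoeff hP hQ ht i j q)
    simp only [map_sum, map_mul, map_add, map_natCast, evalAt_apply, gP, lP, lQ,
      partialDeriv_coordFun e e' hW, partialDeriv_partialDeriv_coordFun e e' hW] at h
    exact h

end ChartSymbols

/-! ### Vector fields in a chart -/

/-- The coordinate space of an `n`-dimensional manifold. -/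
abbrev Vec (n : ℕ) : Type := EuclideanSpace ℝ (Fin n)

section VectorFields

open Filter Topology

variable {n : ℕ} {M : Type*} [TopologicalSpace M] [ChartedSpace (EuclideanSpace ℝ (Fin n)) M]

theorem Coord.mdifferentiable (e : Coord n M) : e.1.MDifferentiable (𝓡 n) (𝓡 n) := by
  have h : e.1 ∈ IsManifold.maximalAtlas (𝓡 n) 1 M :=
    IsManifold.maximalAtlas_subset_of_le (by simp) e.2
  exact ⟨fun x hx => (mdifferentiableAt_of_mem_maximalAtlas h hx).mdifferentiableWithinAt,
    fun x hx => (mdifferentiableAt_symm_of_mem_maximalAtlas h hx).mdifferentiableWithinAt⟩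

theorem Coord.isInvertible_mfderiv (e : Coord n M) {x : M} (hx : x ∈ e.dom) :
    (mfderiv (𝓡 n) (𝓡 n) e.1 x).IsInvertible :=
  ⟨e.mdifferentiable.mfderiv hx, rfl⟩

/-- The vector field `Z` in the chart `e`: its components as functions of the coordinates. -/
def chartRep (e : Coord n M) (Z : (x : M) → TangentSpace (𝓡 n) x) (v : Vec n) : Vec n :=
  mfderiv (𝓡 n) (𝓡 n) e.1 (e.1.symm v) (Z (e.1.symm v))

theorem chartRep_apply (e : Coord n M) (Z : (x : M) → TangentSpace (𝓡 n) x) {x : M}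
    (hx : x ∈ e.dom) : chartRep e Z (e.1 x) = mfderiv (𝓡 n) (𝓡 n) e.1 x (Z x) :=
  congrArg (fun p => (mfderiv (𝓡 n) (𝓡 n) e.1 p (Z p) : Vec n)) (e.1.left_inv hx)

theorem chartRep_eventuallyEq_mpullback (e : Coord n M) (Z : (x : M) → TangentSpace (𝓡 n) x)
    {x : M} (hx : x ∈ e.dom) :
    chartRep e Z =ᶠ[𝓝 (e.1 x)] VectorField.mpullback 𝓘(ℝ, Vec n) (𝓡 n) e.1.symm Z := by
  filter_upwards [e.1.open_target.mem_nhds (e.1.map_source hx)] with v hv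
  have h1 := (e.mdifferentiable.comp_symm_deriv hv)
  have h2 := e.mdifferentiable.symm.symm_comp_deriv hv
  have h3 := e.mdifferentiable.symm.comp_symm_deriv (x := e.1.symm v) (e.1.map_target hv)
  have h4 : (mfderiv 𝓘(ℝ, Vec n) (𝓡 n) e.1.symm v).inverse =
      mfderiv (𝓡 n) (𝓡 n) e.1 (e.1.symm v) := by
    refine ContinuousLinearMap.inverse_eq ?_ h1
    rw [e.1.symm_symm, e.1.right_inv hv] at h3
    exact h3
  rw [VectorField.mpullback_apply, h4]
  rfl

theorem isInvertible_mfderiv_symm (e : Coord n M) {v : Vec n} (hv : v ∈ e.1.target) :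
    (mfderiv 𝓘(ℝ, Vec n) (𝓡 n) e.1.symm v).IsInvertible :=
  ⟨e.mdifferentiable.symm.mfderiv hv, rfl⟩

theorem eventuallyEq_mpullback_chartRep (e : Coord n M) (Z : (x : M) → TangentSpace (𝓡 n) x)
    {x : M} (hx : x ∈ e.dom) :
    ∀ᶠ y in 𝓝 x, Z y = VectorField.mpullback (𝓡 n) 𝓘(ℝ, Vec n) e.1 (chartRep e Z) y := by
  filter_upwards [e.1.open_source.mem_nhds hx] with y hy
  change _ = (mfderiv (𝓡 n) (𝓡 n) e.1 y).inverse (chartRep e Z (e.1 y))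
  rw [chartRep_apply e Z hy]
  exact ((e.isInvertible_mfderiv hy).inverse_apply_eq.2 rfl).symm

theorem mdifferentiableAt_vectorSpace_iff {V : Vec n → Vec n} {v : Vec n} :
    MDifferentiableAt 𝓘(ℝ, Vec n) (𝓡 n).tangent
      (fun y => (⟨y, V y⟩ : TangentBundle 𝓘(ℝ, Vec n) (Vec n))) v ↔ DifferentiableAt ℝ V v := by
  refine ⟨fun h => ?_, fun h => ?_⟩
  · exact (((contMDiff_snd_tangentBundle_modelSpace (Vec n) 𝓘(ℝ, Vec n)).contMDiffAt.mdifferentiableAt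
      one_ne_zero).comp v h).differentiableAt
  · rw [mdifferentiableAt_totalSpace]
    refine ⟨mdifferentiableAt_id, ?_⟩
    convert! h.mdifferentiableAt with y
    simp

theorem mdifferentiableAt_iff_chartRep [IsManifold (𝓡 n) ∞ M]
    (e : Coord n M) {Z : (x : M) → TangentSpace (𝓡 n) x}
    {x : M} (hx : x ∈ e.dom) :
    MDifferentiableAt (𝓡 n) (𝓡 n).tangent (fun y => (⟨y, Z y⟩ : TangentBundle (𝓡 n) M)) x ↔
      DifferentiableAt ℝ (chartRep e Z) (e.1 x) := by
  refine ⟨fun h => ?_, fun h => ?_⟩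
  · rw [← e.1.left_inv hx] at h
    have h1 := h.mpullback_vectorField (I := 𝓘(ℝ, Vec n)) (f := e.1.symm) (n := ∞)
      (contMDiffAt_symm_of_mem_maximalAtlas e.2 (e.1.map_source hx))
      (isInvertible_mfderiv_symm e (e.1.map_source hx)) ENat.LEInfty.out
    exact (mdifferentiableAt_vectorSpace_iff.1 h1).congr_of_eventuallyEq
      (chartRep_eventuallyEq_mpullback e Z hx)
  · have h1 := (mdifferentiableAt_vectorSpace_iff.2 h).mpullback_vectorField (I := 𝓡 n)
      (f := e.1) (n := ∞) (contMDiffAt_of_mem_maximalAtlas e.2 hx)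
      (e.isInvertible_mfderiv hx) ENat.LEInfty.out
    refine h1.congr_of_eventuallyEq ?_
    filter_upwards [eventuallyEq_mpullback_chartRep e Z hx] with y hy
    rw [hy]

theorem contDiffAt_chartRep [IsManifold (𝓡 n) ∞ M]
    (e : Coord n M) {Z : (x : M) → TangentSpace (𝓡 n) x}
    {x : M} (hx : x ∈ e.dom)
    (h : ContMDiffAt (𝓡 n) (𝓡 n).tangent ∞ (fun y => (⟨y, Z y⟩ : TangentBundle (𝓡 n) M)) x) :
    ContDiffAt ℝ ∞ (chartRep e Z) (e.1 x) := by
  rw [← e.1.left_inv hx] at h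
  have h1 := h.mpullback_vectorField_preimage (I := 𝓘(ℝ, Vec n)) (f := e.1.symm) (n := ∞)
      (contMDiffAt_symm_of_mem_maximalAtlas e.2 (e.1.map_source hx))
      (isInvertible_mfderiv_symm e (e.1.map_source hx)) (by simp)
  exact (contMDiffAt_vectorSpace_iff_contDiffAt.1 h1).congr_of_eventuallyEq
    (chartRep_eventuallyEq_mpullback e Z hx)

theorem chartRep_mlieBracket [IsManifold (𝓡 n) ∞ M]
    (e : Coord n M) {X Y : (x : M) → TangentSpace (𝓡 n) x}
    {x : M} (hx : x ∈ e.dom)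
    (hX : MDifferentiableAt (𝓡 n) (𝓡 n).tangent (fun y => (⟨y, X y⟩ : TangentBundle (𝓡 n) M)) x)
    (hY : MDifferentiableAt (𝓡 n) (𝓡 n).tangent (fun y => (⟨y, Y y⟩ : TangentBundle (𝓡 n) M)) x) :
    mfderiv (𝓡 n) (𝓡 n) e.1 x (VectorField.mlieBracket (𝓡 n) X Y x) =
      VectorField.lieBracket ℝ (chartRep e X) (chartRep e Y) (e.1 x) := by
  have : IsManifold (𝓡 n) (minSmoothness ℝ 3) M := IsManifold.of_le (n := ∞) (by
    simpa using (ENat.LEInfty.out : (3 : WithTop ℕ∞) ≤ ∞))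
  rw [← chartRep_apply e _ hx, (chartRep_eventuallyEq_mpullback e _ hx).eq_of_nhds]
  rw [← e.1.left_inv hx] at hX hY
  rw [VectorField.mpullback_mlieBracket hX hY
    (contMDiffAt_symm_of_mem_maximalAtlas e.2 (e.1.map_source hx)) (by
      simpa using (ENat.LEInfty.out : (2 : WithTop ℕ∞) ≤ ∞)),
    ← VectorField.mlieBracketWithin_univ, VectorField.mlieBracketWithin_eq_lieBracketWithin]
  refine (congrFun (VectorField.lieBracketWithin_univ (𝕜 := ℝ) (E := Vec n)
    (V := VectorField.mpullback 𝓘(ℝ, Vec n) (𝓡 n) e.1.symm X)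
    (W := VectorField.mpullback 𝓘(ℝ, Vec n) (𝓡 n) e.1.symm Y)) (e.1 x)).trans ?_
  exact ((chartRep_eventuallyEq_mpullback e X hx).lieBracket_vectorField_eq
    (chartRep_eventuallyEq_mpullback e Y hx)).symm

theorem chartRep_coordField (e : Coord n M) (i : Fin n) {v : Vec n} (hv : v ∈ e.1.target) :
    chartRep e (coordField e i) v = EuclideanSpace.single i 1 :=
  (e.isInvertible_mfderiv (e.1.map_target hv)).self_apply_inverse _

theorem mfderiv_coordField (e : Coord n M) (i : Fin n) {x : M} (hx : x ∈ e.dom) :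
    mfderiv (𝓡 n) (𝓡 n) e.1 x (coordField e i x) =
      (EuclideanSpace.single i 1 : Vec n) :=
  (e.isInvertible_mfderiv hx).self_apply_inverse _

theorem chartRep_coordField_eventuallyEq (e : Coord n M) (i : Fin n) {x : M} (hx : x ∈ e.dom) :
    chartRep e (coordField e i) =ᶠ[𝓝 (e.1 x)] fun _ => EuclideanSpace.single i 1 := by
  filter_upwards [e.1.open_target.mem_nhds (e.1.map_source hx)] with v hv
  exact chartRep_coordField e i hv

theorem mdifferentiableAt_coordField [IsManifold (𝓡 n) ∞ M]
    (e : Coord n M) (i : Fin n) {x : M} (hx : x ∈ e.dom) :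
    MDifferentiableAt (𝓡 n) (𝓡 n).tangent
      (fun y => (⟨y, coordField e i y⟩ : TangentBundle (𝓡 n) M)) x :=
  (mdifferentiableAt_iff_chartRep e hx).2 ((differentiableAt_const _).congr_of_eventuallyEq
    (chartRep_coordField_eventuallyEq e i hx))

/-- The components of a tangent vector in two charts are related by the derivative of the
transition map. -/
theorem fderiv_transition_mfderiv (e e' : Coord n M) {x : M} (hx : x ∈ e.dom)
    (hx' : x ∈ e'.dom) (v : TangentSpace (𝓡 n) x) :
    fderiv ℝ (transition e e') (e.1 x) (mfderiv (𝓡 n) (𝓡 n) e.1 x v) =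
      mfderiv (𝓡 n) (𝓡 n) e'.1 x v := by
  have h1 : e'.1 =ᶠ[𝓝 x] transition e e' ∘ e.1 := by
    filter_upwards [e.1.open_source.mem_nhds hx] with y hy
    rw [Function.comp_apply, transition, Function.comp_apply, e.1.left_inv hy]
  have hd := (contDiffAt_transition e e' hx hx').differentiableAt (by simp)
  rw [h1.mfderiv_eq, mfderiv_comp x hd.mdifferentiableAt (e.mdifferentiable.mdifferentiableAt hx),
    mfderiv_eq_fderiv]
  rfl

end VectorFields

/-! ### Covariant derivatives in a chart -/

section ChartCovariantDerivative

open Filter Topology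

variable {n : ℕ}

/-- The bilinear map `(w, z) ↦ ∑ Γ_{ij}^l w^i z^j ∂_l`. -/
def symbolMap (Γ : Fin n → Fin n → Fin n → ℝ) : Vec n →L[ℝ] Vec n →L[ℝ] Vec n :=
  ∑ i, ∑ j, ∑ l, Γ i j l • (EuclideanSpace.proj i : Vec n →L[ℝ] ℝ).smulRight
    ((EuclideanSpace.proj j : Vec n →L[ℝ] ℝ).smulRight (EuclideanSpace.single l 1 : Vec n))

theorem symbolMap_apply (Γ : Fin n → Fin n → Fin n → ℝ) (w z : Vec n) :
    symbolMap Γ w z = ∑ i, ∑ j, ∑ l, (Γ i j l * w i * z j) • (EuclideanSpace.single l 1 : Vec n) := by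
  simp [symbolMap, smul_smul]

theorem symbolMap_single (Γ : Fin n → Fin n → Fin n → ℝ) (i j : Fin n) :
    symbolMap Γ (EuclideanSpace.single i 1) (EuclideanSpace.single j 1) =
      ∑ l, Γ i j l • (EuclideanSpace.single l 1 : Vec n) := by
  rw [symbolMap_apply, Finset.sum_eq_single i, Finset.sum_eq_single j]
  · simp
  · intro b _ hb
    simp [hb]
  · simp
  · intro b _ hb
    simp [hb]
  · simp

theorem ext_single {F : Type*} [AddCommGroup F] [Module ℝ F] [TopologicalSpace F]
    {A B : Vec n →L[ℝ] F}
    (h : ∀ i, A (EuclideanSpace.single i 1) = B (EuclideanSpace.single i 1)) : A = B := by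
  refine ContinuousLinearMap.coe_inj.1 ((EuclideanSpace.basisFun (Fin n) ℝ).toBasis.ext fun i => ?_)
  simpa using h i

variable {M : Type*} [TopologicalSpace M] [ChartedSpace (EuclideanSpace ℝ (Fin n)) M]

/-- The covariant derivative with symbols `Γ` in the chart `e`. -/
def chartCov (e : Coord n M) (Γ : M → Vec n →L[ℝ] Vec n →L[ℝ] Vec n)
    (Z : (x : M) → TangentSpace (𝓡 n) x) (x : M) :
    TangentSpace (𝓡 n) x →L[ℝ] TangentSpace (𝓡 n) x :=
  (mfderiv (𝓡 n) (𝓡 n) e.1 x).inverse ∘L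
    ((fderiv ℝ (chartRep e Z) (e.1 x) + (Γ x).flip (chartRep e Z (e.1 x)) :
      Vec n →L[ℝ] Vec n) ∘L mfderiv (𝓡 n) (𝓡 n) e.1 x)

variable (e : Coord n M) (Γ : M → Vec n →L[ℝ] Vec n →L[ℝ] Vec n)

theorem mfderiv_chartCov {Z : (x : M) → TangentSpace (𝓡 n) x} {x : M} (hx : x ∈ e.dom)
    (v : TangentSpace (𝓡 n) x) :
    mfderiv (𝓡 n) (𝓡 n) e.1 x (chartCov e Γ Z x v) =
      fderiv ℝ (chartRep e Z) (e.1 x) (mfderiv (𝓡 n) (𝓡 n) e.1 x v) +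
        Γ x (mfderiv (𝓡 n) (𝓡 n) e.1 x v) (mfderiv (𝓡 n) (𝓡 n) e.1 x (Z x)) := by
  rw [← chartRep_apply e Z hx]
  exact (e.isInvertible_mfderiv hx).self_apply_inverse _

theorem tangent_ext (e : Coord n M) {x : M} (hx : x ∈ e.dom) {v w : TangentSpace (𝓡 n) x}
    (h : mfderiv (𝓡 n) (𝓡 n) e.1 x v = mfderiv (𝓡 n) (𝓡 n) e.1 x w) : v = w :=
  e.mdifferentiable.mfderiv_injective hx h

theorem isCovariantDerivativeOn_chartCov [IsManifold (𝓡 n) ∞ M] :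
    IsCovariantDerivativeOn (I := 𝓡 n) (Vec n) (V := fun x : M => TangentSpace (𝓡 n) x)
      (chartCov e Γ) (e.dom : Set M) where
  add {Z W x} hZ hW hx := by
    have hZ' := (mdifferentiableAt_iff_chartRep e hx).1 hZ
    have hW' := (mdifferentiableAt_iff_chartRep e hx).1 hW
    have hadd : chartRep e (Z + W) = chartRep e Z + chartRep e W := by
      funext v
      exact map_add (mfderiv (𝓡 n) (𝓡 n) e.1 (e.1.symm v)) _ _
    ext v
    refine tangent_ext e hx ?_
    have h1 := mfderiv_chartCov e Γ (Z := Z) hx v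
    have h2 := mfderiv_chartCov e Γ (Z := W) hx v
    have h3 := mfderiv_chartCov e Γ (Z := Z + W) hx v
    have h4 : mfderiv (𝓡 n) (𝓡 n) e.1 x ((Z + W) x) = mfderiv (𝓡 n) (𝓡 n) e.1 x (Z x) +
      mfderiv (𝓡 n) (𝓡 n) e.1 x (W x) := map_add _ _ _
    have h5 : mfderiv (𝓡 n) (𝓡 n) e.1 x ((chartCov e Γ Z x + chartCov e Γ W x) v) =
      mfderiv (𝓡 n) (𝓡 n) e.1 x (chartCov e Γ Z x v) +
        mfderiv (𝓡 n) (𝓡 n) e.1 x (chartCov e Γ W x v) := map_add _ _ _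
    have h6 := fderiv_add hZ' hW'
    rw [h5, h1, h2, h3, h4, hadd, h6]
    refine (congrArg₂ (· + ·) rfl (map_add (Γ x (mfderiv (𝓡 n) (𝓡 n) e.1 x v)) _ _)).trans ?_
    exact add_add_add_comm _ _ _ _
  leibniz {Z g x} hZ hg hx := by
    have hZ' := (mdifferentiableAt_iff_chartRep e hx).1 hZ
    have hsymm := e.mdifferentiable.mdifferentiableAt_symm (e.1.map_source hx)
    have hg0 : MDifferentiableAt (𝓡 n) 𝓘(ℝ, ℝ) g (e.1.symm (e.1 x)) := by
      rw [e.1.left_inv hx]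
      exact hg
    have hg' : DifferentiableAt ℝ (g ∘ e.1.symm) (e.1 x) :=
      (hg0.comp (e.1 x) hsymm).differentiableAt
    have hsmul : chartRep e (g • Z) = fun v => (g ∘ e.1.symm) v • chartRep e Z v := by
      funext v
      exact map_smul (mfderiv (𝓡 n) (𝓡 n) e.1 (e.1.symm v)) _ _
    have hge : g =ᶠ[𝓝 x] (g ∘ e.1.symm) ∘ e.1 := by
      filter_upwards [e.1.open_source.mem_nhds hx] with y hy
      rw [Function.comp_apply, Function.comp_apply, e.1.left_inv hy]
    have hdg (v : TangentSpace (𝓡 n) x) : mvfderiv (𝓡 n) g x v =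
        fderiv ℝ (g ∘ e.1.symm) (e.1 x) (mfderiv (𝓡 n) (𝓡 n) e.1 x v) := by
      rw [mvfderiv, hge.mfderiv_eq, mfderiv_comp x hg'.mdifferentiableAt
        (e.mdifferentiable.mdifferentiableAt hx), mfderiv_eq_fderiv]
      rfl
    ext v
    refine tangent_ext e hx ?_
    have h1 := mfderiv_chartCov e Γ (Z := Z) hx v
    have h3 := mfderiv_chartCov e Γ (Z := g • Z) hx v
    have h4 : mfderiv (𝓡 n) (𝓡 n) e.1 x ((g • Z) x) = g x • mfderiv (𝓡 n) (𝓡 n) e.1 x (Z x) :=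
      map_smul (mfderiv (𝓡 n) (𝓡 n) e.1 x) _ _
    have h5 : mfderiv (𝓡 n) (𝓡 n) e.1 x
        ((g x • chartCov e Γ Z x + (mvfderiv (𝓡 n) g x).smulRight (Z x)) v) =
        g x • mfderiv (𝓡 n) (𝓡 n) e.1 x (chartCov e Γ Z x v) +
        mvfderiv (𝓡 n) g x v • mfderiv (𝓡 n) (𝓡 n) e.1 x (Z x) :=
      (map_add _ _ _).trans (congrArg₂ (· + ·) (map_smul (mfderiv (𝓡 n) (𝓡 n) e.1 x) _ _)
        (map_smul (mfderiv (𝓡 n) (𝓡 n) e.1 x) _ _))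
    have h6 (w z : Vec n) (hz : chartRep e Z (e.1 x) = z) :
        fderiv ℝ (fun v => (g ∘ e.1.symm) v • chartRep e Z v) (e.1 x) w =
        g x • fderiv ℝ (chartRep e Z) (e.1 x) w + fderiv ℝ (g ∘ e.1.symm) (e.1 x) w • z := by
      rw [fderiv_fun_smul hg' hZ', hz, Function.comp_apply, e.1.left_inv hx]
      rfl
    have h7 (w z z' d : Vec n) (c : ℝ) : g x • w + c • z + Γ x d (g x • z') =
        g x • (w + Γ x d z') + c • z := by
      rw [map_smul, smul_add, add_right_comm]
    rw [h5, h1, h3, h4, hsmul, hdg]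
    refine (congrArg₂ (· + ·) (h6 _ _ (chartRep_apply e Z hx)) rfl).trans ?_
    exact h7 _ _ _ _ _

/-- In the chart `e`, the symbols of `chartCov e Γ` are the components of `Γ`. -/
theorem mfderiv_chartCov_coordField {x : M} (hx : x ∈ e.dom) (j : Fin n)
    (v : TangentSpace (𝓡 n) x) :
    mfderiv (𝓡 n) (𝓡 n) e.1 x (chartCov e Γ (coordField e j) x v) =
      Γ x (mfderiv (𝓡 n) (𝓡 n) e.1 x v) (EuclideanSpace.single j 1) := by
  have h := mfderiv_chartCov e Γ (Z := coordField e j) hx v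
  rw [mfderiv_coordField e j hx, (chartRep_coordField_eventuallyEq e j hx).fderiv_eq] at h
  rw [h, fderiv_fun_const]
  exact zero_add _

/-- A tangent vector is a combination of the coordinate vectors. -/
theorem exists_sum_coordField {x : M} (hx : x ∈ e.dom) (v : TangentSpace (𝓡 n) x) :
    ∃ c : Fin n → ℝ, v = ∑ i, c i • coordField e i x := by
  refine ⟨(mfderiv (𝓡 n) (𝓡 n) e.1 x v : Vec n).ofLp, tangent_ext e hx ?_⟩
  rw [map_sum]
  have (i : Fin n) (c : ℝ) : mfderiv (𝓡 n) (𝓡 n) e.1 x (c • coordField e i x) =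
      c • (EuclideanSpace.single i 1 : Vec n) :=
    (map_smul _ _ _).trans (congrArg (c • ·) (mfderiv_coordField e i hx))
  refine Eq.trans ?_ (Finset.sum_congr rfl fun i _ => (this i _).symm)
  have h (w : Vec n) : w = ∑ i, w i • (EuclideanSpace.single i 1 : Vec n) := by
    simpa using ((EuclideanSpace.basisFun (Fin n) ℝ).sum_repr w).symm
  exact h _

/-- A connection is determined at `x` by its values on the coordinate vector fields of a chart
around `x`. -/
theorem covariantDerivative_eq_of_coordField [IsManifold (𝓡 n) ∞ M]
    {cov cov' : ((x : M) → TangentSpace (𝓡 n) x) →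
      ((x : M) → TangentSpace (𝓡 n) x →L[ℝ] TangentSpace (𝓡 n) x)} {x : M} (hx : x ∈ e.dom)
    (hcov : IsCovariantDerivativeOn (I := 𝓡 n) (Vec n) (V := fun x : M => TangentSpace (𝓡 n) x)
      cov {x})
    (hcov' : IsCovariantDerivativeOn (I := 𝓡 n) (Vec n) (V := fun x : M => TangentSpace (𝓡 n) x)
      cov' {x})
    (h : ∀ j, cov (coordField e j) x = cov' (coordField e j) x)
    {Z : (x : M) → TangentSpace (𝓡 n) x}
    (hZ : MDifferentiableAt (𝓡 n) (𝓡 n).tangent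
      (fun y => (⟨y, Z y⟩ : TangentBundle (𝓡 n) M)) x) :
    cov Z x = cov' Z x := by
  have h1 (j : Fin n) : hcov.difference hcov' x (coordField e j x) = 0 := by
    rw [hcov.difference_apply hcov' rfl (mdifferentiableAt_coordField e j hx), h j, sub_self]
  obtain ⟨c, hc⟩ := exists_sum_coordField e hx (Z x)
  have h2 := hcov.difference_apply hcov' rfl hZ
  rw [hc, map_sum] at h2
  simp only [map_smul, h1, smul_zero, Finset.sum_const_zero] at h2
  exact (sub_eq_zero.1 h2.symm)

end ChartCovariantDerivative

/-! ### Curvature in a chart -/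

section FlatIdentity

variable {E : Type*} [NormedAddCommGroup E] [NormedSpace ℝ E]

/-- The formula for the curvature of the connection `D + G` on a vector space: if the curvature
form of `G` vanishes at `p`, then so does `R(X, Y) Z`. -/
theorem curvature_identity {X Y Z : E → E} {G : E → E →L[ℝ] E →L[ℝ] E} {p : E}
    (hX : DifferentiableAt ℝ X p) (hY : DifferentiableAt ℝ Y p) (hZ : ContDiffAt ℝ 2 Z p)
    (hG : DifferentiableAt ℝ G p)
    (hflat : ∀ a b c, fderiv ℝ G p a b c - fderiv ℝ G p b a c + G p a (G p b c) -
      G p b (G p a c) = 0) :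
    (fderiv ℝ (fun v => fderiv ℝ Z v (Y v) + G v (Y v) (Z v)) p (X p) +
        G p (X p) (fderiv ℝ Z p (Y p) + G p (Y p) (Z p))) -
      (fderiv ℝ (fun v => fderiv ℝ Z v (X v) + G v (X v) (Z v)) p (Y p) +
        G p (Y p) (fderiv ℝ Z p (X p) + G p (X p) (Z p))) -
      (fderiv ℝ Z p (VectorField.lieBracket ℝ X Y p) +
        G p (VectorField.lieBracket ℝ X Y p) (Z p)) = 0 := by
  have hZ1 : DifferentiableAt ℝ Z p := hZ.differentiableAt (by simp)
  have hZ2 : DifferentiableAt ℝ (fderiv ℝ Z) p :=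
    (hZ.fderiv_right (m := 1) (by norm_num)).differentiableAt (by simp)
  have hsymm := (hZ.isSymmSndFDerivAt (by simp)) (X p) (Y p)
  have key {Y : E → E} (hY : DifferentiableAt ℝ Y p) (h : E) :
      fderiv ℝ (fun v => fderiv ℝ Z v (Y v) + G v (Y v) (Z v)) p h =
      fderiv ℝ (fderiv ℝ Z) p h (Y p) + fderiv ℝ Z p (fderiv ℝ Y p h) +
        (fderiv ℝ G p h (Y p) (Z p) + G p (fderiv ℝ Y p h) (Z p) +
          G p (Y p) (fderiv ℝ Z p h)) := by
    have h1 := hZ2.hasFDerivAt.clm_apply hY.hasFDerivAt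
    have h2 := (hG.hasFDerivAt.clm_apply hY.hasFDerivAt).clm_apply hZ1.hasFDerivAt
    rw [(h1.fun_add h2).fderiv]
    simp
    abel
  have h := hflat (X p) (Y p) (Z p)
  rw [key hX, key hY, VectorField.lieBracket, hsymm]
  simp only [map_add, map_sub, sub_apply]
  rw [← h]
  abel

end FlatIdentity

section CurvatureInChart

open Filter Topology

variable {n : ℕ} {M : Type*} [TopologicalSpace M] [ChartedSpace (EuclideanSpace ℝ (Fin n)) M]
  [IsManifold (𝓡 n) ∞ M]

theorem mfderiv_connection_apply (e : Coord n M) {nabla : Connection n M}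
    {G : Vec n → Vec n →L[ℝ] Vec n →L[ℝ] Vec n} {x : M} (hx : x ∈ e.dom)
    {Z : (x : M) → TangentSpace (𝓡 n) x}
    (hnabla : nabla Z x = chartCov e (fun y => G (e.1 y)) Z x) (v : TangentSpace (𝓡 n) x) {w : Vec n}
    (hw : mfderiv (𝓡 n) (𝓡 n) e.1 x v = w) :
    (mfderiv (𝓡 n) (𝓡 n) e.1 x (nabla Z x v) : Vec n) =
      fderiv ℝ (chartRep e Z) (e.1 x) w + G (e.1 x) w (chartRep e Z (e.1 x)) := by
  rw [hnabla, mfderiv_chartCov e _ hx, chartRep_apply e Z hx, ← hw]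

/-- The curvature of a connection which in the chart `e` is `D + G` vanishes at `x` if the curvature
form of `G` does. -/
theorem curvature_eq_zero_of_chart (e : Coord n M) {nabla : Connection n M}
    {G : Vec n → Vec n →L[ℝ] Vec n →L[ℝ] Vec n}
    (hnabla : ∀ y ∈ e.dom, ∀ Z : (x : M) → TangentSpace (𝓡 n) x,
      MDifferentiableAt (𝓡 n) (𝓡 n).tangent (fun y => (⟨y, Z y⟩ : TangentBundle (𝓡 n) M)) y →
      nabla Z y = chartCov e (fun y => G (e.1 y)) Z y) {x : M} (hx : x ∈ e.dom)
    (hG : DifferentiableAt ℝ G (e.1 x))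
    (hflat : ∀ a b c, fderiv ℝ G (e.1 x) a b c - fderiv ℝ G (e.1 x) b a c +
      G (e.1 x) a (G (e.1 x) b c) - G (e.1 x) b (G (e.1 x) a c) = 0)
    {U : Opens M} (hU : x ∈ U) {X Y Z : (x : M) → TangentSpace (𝓡 n) x}
    (hX : IsSmoothFieldOn X U) (hY : IsSmoothFieldOn Y U) (hZ : IsSmoothFieldOn Z U) :
    curvature nabla X Y Z x = 0 := by
  have hsm {W : (x : M) → TangentSpace (𝓡 n) x} (hW : IsSmoothFieldOn W U) {y : M} (hy : y ∈ U) :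
      ContMDiffAt (𝓡 n) (𝓡 n).tangent ∞ (fun y => (⟨y, W y⟩ : TangentBundle (𝓡 n) M)) y :=
    hW.contMDiffAt (U.isOpen.mem_nhds hy)
  have hZ2 := contDiffAt_chartRep e hx (hsm hZ hU)
  -- the components of `∇_Y Z`
  have hrep {Y : (x : M) → TangentSpace (𝓡 n) x} :
      chartRep e (fun y => nabla Z y (Y y)) =ᶠ[𝓝 (e.1 x)] fun v =>
        fderiv ℝ (chartRep e Z) v (chartRep e Y v) + G v (chartRep e Y v) (chartRep e Z v) := by
    filter_upwards [eventually_mem_chart e (inf_le_left : e.dom ⊓ U ≤ e.dom) ⟨hx, hU⟩] with v hv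
    obtain ⟨hv1, hv2, hv3⟩ := hv
    have h1 := mfderiv_connection_apply e hv2
      (hnabla _ hv2 Z ((hsm hZ hv3).mdifferentiableAt (by simp))) (Y (e.1.symm v))
      (chartRep_apply e Y hv2).symm
    rw [e.1.right_inv hv1] at h1
    exact h1
  have hfd {Y : (x : M) → TangentSpace (𝓡 n) x} (hY : IsSmoothFieldOn Y U) :
      MDifferentiableAt (𝓡 n) (𝓡 n).tangent
        (fun y => (⟨y, nabla Z y (Y y)⟩ : TangentBundle (𝓡 n) M)) x := by
    rw [mdifferentiableAt_iff_chartRep e hx]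
    refine DifferentiableAt.congr_of_eventuallyEq ?_ hrep
    have h1 : DifferentiableAt ℝ (chartRep e Y) (e.1 x) :=
      (contDiffAt_chartRep e hx (hsm hY hU)).differentiableAt (by simp)
    have h2 : DifferentiableAt ℝ (fderiv ℝ (chartRep e Z)) (e.1 x) :=
      (hZ2.fderiv_right (m := ∞) (by simp)).differentiableAt (by simp)
    exact (h2.clm_apply h1).add ((hG.clm_apply h1).clm_apply (hZ2.differentiableAt (by simp)))
  have hterm {X Y : (x : M) → TangentSpace (𝓡 n) x} (hY : IsSmoothFieldOn Y U) :
      (mfderiv (𝓡 n) (𝓡 n) e.1 x (nabla (fun y => nabla Z y (Y y)) x (X x)) : Vec n) =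
      fderiv ℝ (fun v => fderiv ℝ (chartRep e Z) v (chartRep e Y v) +
        G v (chartRep e Y v) (chartRep e Z v)) (e.1 x) (chartRep e X (e.1 x)) +
        G (e.1 x) (chartRep e X (e.1 x)) (fderiv ℝ (chartRep e Z) (e.1 x) (chartRep e Y (e.1 x)) +
          G (e.1 x) (chartRep e Y (e.1 x)) (chartRep e Z (e.1 x))) := by
    rw [mfderiv_connection_apply e hx (hnabla x hx _ (hfd hY)) (X x) (chartRep_apply e X hx).symm,
      hrep.fderiv_eq, hrep.eq_of_nhds]
  have hXd := (hsm hX hU).mdifferentiableAt (by norm_num : (∞ : WithTop ℕ∞) ≠ 0)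
  have hYd := (hsm hY hU).mdifferentiableAt (by norm_num : (∞ : WithTop ℕ∞) ≠ 0)
  have hbr := mfderiv_connection_apply e hx
    (hnabla x hx Z ((hsm hZ hU).mdifferentiableAt (by simp)))
    (VectorField.mlieBracket (𝓡 n) X Y x) (chartRep_mlieBracket e hx hXd hYd)
  -- the vanishing is checked on components
  refine tangent_ext e hx ?_
  have h0 := curvature_identity
    ((contDiffAt_chartRep e hx (hsm hX hU)).differentiableAt (by simp))
    ((contDiffAt_chartRep e hx (hsm hY hU)).differentiableAt (by simp))
    (hZ2.of_le ENat.LEInfty.out) hG hflat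
  rw [← hterm hX, ← hterm hY, ← hbr] at h0
  rw [curvature, map_zero]
  refine (map_sub _ _ _).trans (Eq.trans ?_ h0)
  exact congrArg₂ (· - ·) (map_sub _ _ _) rfl

/-- A connection is determined on a chart by its symbols. -/
theorem connection_eq_chartCov (e : Coord n M) {nabla : Connection n M}
    {γ : Fin n → Fin n → Fin n → M → ℝ}
    (h : ∀ y ∈ e.dom, ∀ i j, nabla (coordField e j) y (coordField e i y) =
      ∑ l, γ i j l y • coordField e l y) {y : M} (hy : y ∈ e.dom)
    {Z : (x : M) → TangentSpace (𝓡 n) x}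
    (hZ : MDifferentiableAt (𝓡 n) (𝓡 n).tangent
      (fun y => (⟨y, Z y⟩ : TangentBundle (𝓡 n) M)) y) :
    nabla Z y = chartCov e (fun y => symbolMap fun i j l => γ i j l y) Z y := by
  refine covariantDerivative_eq_of_coordField e hy nabla.isCovariantDerivativeOn
    ((isCovariantDerivativeOn_chartCov e _).mono (Set.singleton_subset_iff.2 hy)) (fun j => ?_) hZ
  have hbasis (i : Fin n) : nabla (coordField e j) y (coordField e i y) =
      chartCov e (fun y => symbolMap fun i j l => γ i j l y) (coordField e j) y
        (coordField e i y) := by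
    refine tangent_ext e hy ?_
    rw [mfderiv_chartCov_coordField e _ hy, h y hy, map_sum]
    have h1 := symbolMap_single (fun i j l => γ i j l y) i j
    refine (Finset.sum_congr rfl fun l _ => ?_).trans
      (h1.symm.trans (congrArg (fun w => symbolMap (fun i j l => γ i j l y) w
        (EuclideanSpace.single j 1)) (mfderiv_coordField e i hy).symm))
    exact (map_smul (mfderiv (𝓡 n) (𝓡 n) e.1 y) _ _).trans
      (congrArg (γ i j l y • ·) (mfderiv_coordField e l hy))
  ext v
  obtain ⟨c, rfl⟩ := exists_sum_coordField e hy v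
  rw [map_sum, map_sum]
  refine Finset.sum_congr rfl fun i _ => ?_
  rw [map_smul, map_smul, hbasis]

end CurvatureInChart

section Symbols

variable {n : ℕ}

set_option maxSynthPendingDepth 3 in
/-- The derivative of `symbolMap γ` has the derivatives of `γ` as components. -/
theorem hasFDerivAt_symbolMap {γ : Fin n → Fin n → Fin n → Vec n → ℝ} {p : Vec n}
    (hγ : ∀ i j l, DifferentiableAt ℝ (γ i j l) p) :
    ∃ L : Vec n →L[ℝ] Vec n →L[ℝ] Vec n →L[ℝ] Vec n,
      HasFDerivAt (fun v => symbolMap fun i j l => γ i j l v) L p ∧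
      ∀ a, L a = symbolMap fun i j l => fderiv ℝ (γ i j l) p a := by
  have h (i j l : Fin n) (A : Vec n →L[ℝ] Vec n →L[ℝ] Vec n) :
      HasFDerivAt (fun v => γ i j l v • A) ((fderiv ℝ (γ i j l) p).smulRight A) p :=
    (hγ i j l).hasFDerivAt.smul_const A
  refine ⟨∑ i, ∑ j, ∑ l, (fderiv ℝ (γ i j l) p).smulRight
    ((EuclideanSpace.proj i : Vec n →L[ℝ] ℝ).smulRight
      ((EuclideanSpace.proj j : Vec n →L[ℝ] ℝ).smulRight (EuclideanSpace.single l 1 : Vec n))),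
    ?_, fun a => ?_⟩
  · exact HasFDerivAt.fun_sum fun i _ => HasFDerivAt.fun_sum fun j _ =>
      HasFDerivAt.fun_sum fun l _ => h i j l _
  · simp only [symbolMap, _root_.sum_apply, ContinuousLinearMap.smulRight_apply]

/-- The curvature form of `symbolMap γ` vanishes if its components do. -/
theorem curvatureForm_eq_zero {D : Vec n →L[ℝ] Vec n →L[ℝ] Vec n →L[ℝ] Vec n}
    {γ : Fin n → Fin n → Fin n → ℝ} {dγ : Fin n → Fin n → Fin n → Fin n → ℝ}
    (hD : ∀ a, D (EuclideanSpace.single a 1) = symbolMap (dγ a))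
    (h : ∀ a b q l, dγ a b q l - dγ b a q l + ∑ m, (γ a m l * γ b q m - γ b m l * γ a q m) = 0)
    (a b c : Vec n) :
    D a b c - D b a c + symbolMap γ a (symbolMap γ b c) - symbolMap γ b (symbolMap γ a c) = 0 := by
  have h1 (i j : Fin n) (c : Vec n) : D (EuclideanSpace.single i 1) (EuclideanSpace.single j 1) c -
      D (EuclideanSpace.single j 1) (EuclideanSpace.single i 1) c +
      symbolMap γ (EuclideanSpace.single i 1) (symbolMap γ (EuclideanSpace.single j 1) c) -
      symbolMap γ (EuclideanSpace.single j 1) (symbolMap γ (EuclideanSpace.single i 1) c) = 0 := by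
    have := ext_single (A := D (EuclideanSpace.single i 1) (EuclideanSpace.single j 1) -
      D (EuclideanSpace.single j 1) (EuclideanSpace.single i 1) +
      symbolMap γ (EuclideanSpace.single i 1) ∘L symbolMap γ (EuclideanSpace.single j 1) -
      symbolMap γ (EuclideanSpace.single j 1) ∘L symbolMap γ (EuclideanSpace.single i 1))
      (B := 0) fun q => ?_
    · exact congrArg (fun A : Vec n →L[ℝ] Vec n => A c) this
    · change D (EuclideanSpace.single i 1) (EuclideanSpace.single j 1) _ -
        D (EuclideanSpace.single j 1) (EuclideanSpace.single i 1) _ +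
        symbolMap γ (EuclideanSpace.single i 1) (symbolMap γ (EuclideanSpace.single j 1) _) -
        symbolMap γ (EuclideanSpace.single j 1) (symbolMap γ (EuclideanSpace.single i 1) _) = 0
      simp only [hD, symbolMap_single, map_sum, map_smul]
      ext l
      have h2 := h i j q l
      rw [Finset.sum_sub_distrib] at h2
      simp only [PiLp.sub_apply, PiLp.add_apply, PiLp.smul_apply, WithLp.ofLp_sum, Finset.sum_apply,
        PiLp.zero_apply, PiLp.single_apply, smul_eq_mul, mul_ite, mul_one, mul_zero,
        Finset.sum_ite_eq, Finset.mem_univ, if_true]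
      simp only [mul_comm (γ j q _), mul_comm (γ i q _)]
      linarith
  have h2 (i : Fin n) (b c : Vec n) : D (EuclideanSpace.single i 1) b c -
      D b (EuclideanSpace.single i 1) c +
      symbolMap γ (EuclideanSpace.single i 1) (symbolMap γ b c) -
      symbolMap γ b (symbolMap γ (EuclideanSpace.single i 1) c) = 0 := by
    have := ext_single (A := (D (EuclideanSpace.single i 1)).flip c -
      (D.flip (EuclideanSpace.single i 1)).flip c +
      symbolMap γ (EuclideanSpace.single i 1) ∘L (symbolMap γ).flip c -
      (symbolMap γ).flip (symbolMap γ (EuclideanSpace.single i 1) c))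
      (B := 0) fun j => h1 i j c
    exact congrArg (fun A : Vec n →L[ℝ] Vec n => A b) this
  have := ext_single (A := (D.flip b).flip c - (D b).flip c +
      (symbolMap γ).flip (symbolMap γ b c) - symbolMap γ b ∘L (symbolMap γ).flip c)
      (B := 0) fun i => h2 i b c
  exact congrArg (fun A : Vec n →L[ℝ] Vec n => A a) this

end Symbols

/-! ### The standard connections -/

section StandardConnections

open Filter Topology

variable {n k : ℕ} {M : Type*} [TopologicalSpace M] [ChartedSpace (EuclideanSpace ℝ (Fin n)) M]
variable (B : HomogeneousPoissonBracket n k M)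

/-- The symbols `Γ_{(t)ij}^l` in the chart `e` at the point `x`, as a bilinear map. -/
def HomogeneousPoissonBracket.symbolAt (e : Coord n M) (t : ℕ) (x : M) :
    Vec n →L[ℝ] Vec n →L[ℝ] Vec n :=
  symbolMap fun i j l => extendZero (B.christoffelFun e t i j l) x

variable {B}

theorem HomogeneousPoissonBracket.Nondegenerate.symbolAt_single (hB : B.Nondegenerate)
    (e : Coord n M) (t : ℕ) (x : e.dom) (i j : Fin n) :
    B.symbolAt e t x (EuclideanSpace.single i 1) (EuclideanSpace.single j 1) =
      ∑ l, B.christoffel e t i j l x • (EuclideanSpace.single l 1 : Vec n) := by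
  rw [HomogeneousPoissonBracket.symbolAt, symbolMap_single]
  exact Finset.sum_congr rfl fun l _ => by
    rw [extendZero_apply _ x, hB.christoffelFun_apply]

theorem sum_smul_single_apply (c : Fin n → ℝ) (j : Fin n) :
    (∑ l, c l • (EuclideanSpace.single l 1 : Vec n)) j = c j := by
  simp [Pi.single_apply]

theorem sum_apply_smul_single (w : Vec n) :
    ∑ l, w l • (EuclideanSpace.single l 1 : Vec n) = w := by
  ext j
  exact sum_smul_single_apply _ j

/-- The transformation rule of the symbols, in terms of bilinear maps:
`Γ̃(Dφ a, Dφ b) = Dφ (Γ(a, b)) - D²φ(a, b)` for the transition map `φ`. -/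
theorem HomogeneousPoissonBracket.Nondegenerate.symbolAt_transform (hB : B.Nondegenerate)
    (e e' : Coord n M) {x : M} (hx : x ∈ e.dom) (hx' : x ∈ e'.dom) {t : ℕ} (ht : t < k)
    (a b : Vec n) :
    B.symbolAt e' t x (fderiv ℝ (transition e e') (e.1 x) a)
        (fderiv ℝ (transition e e') (e.1 x) b) =
      fderiv ℝ (transition e e') (e.1 x) (B.symbolAt e t x a b) -
        fderiv ℝ (fderiv ℝ (transition e e')) (e.1 x) a b := by
  have hc := contDiffAt_transition e e' hx hx'
  set J := fderiv ℝ (transition e e') (e.1 x) with hJ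
  set H := fderiv ℝ (fderiv ℝ (transition e e')) (e.1 x) with hH
  have hsymm (a b : Vec n) : H a b = H b a :=
    (hc.isSymmSndFDerivAt (by simpa using (ENat.LEInfty.out : (2 : WithTop ℕ∞) ≤ ∞))) a b
  have h1 (m q : Fin n) :
      B.symbolAt e' t x (J (EuclideanSpace.single m 1)) (J (EuclideanSpace.single q 1)) =
      J (B.symbolAt e t x (EuclideanSpace.single m 1) (EuclideanSpace.single q 1)) -
        H (EuclideanSpace.single m 1) (EuclideanSpace.single q 1) := by
    ext j
    have h := hB.christoffel_transform e e' hx hx' ht m q j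
    rw [hB.symbolAt_single e t ⟨x, hx⟩, map_sum]
    rw [← sum_apply_smul_single (J (EuclideanSpace.single m 1)),
      ← sum_apply_smul_single (J (EuclideanSpace.single q 1))]
    simp only [map_sum, map_smul, _root_.sum_apply, _root_.smul_apply,
      hB.symbolAt_single e' t ⟨x, hx'⟩, hsymm (EuclideanSpace.single m 1),
      PiLp.sub_apply, WithLp.ofLp_sum, Finset.sum_apply, PiLp.smul_apply, smul_eq_mul,
      PiLp.single_apply, mul_ite, mul_one, mul_zero, Finset.sum_ite_eq, Finset.mem_univ, if_true]
    rw [Finset.sum_congr rfl fun b _ => mul_comm (B.christoffel e t m q b ⟨x, hx⟩) _, ← h]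
    rw [Finset.sum_comm]
    refine Finset.sum_congr rfl fun c _ => ?_
    rw [Finset.mul_sum]
    exact Finset.sum_congr rfl fun d _ => by ring
  have h2 (m : Fin n) (b : Vec n) :
      B.symbolAt e' t x (J (EuclideanSpace.single m 1)) (J b) =
      J (B.symbolAt e t x (EuclideanSpace.single m 1) b) - H (EuclideanSpace.single m 1) b := by
    have := ext_single (A := B.symbolAt e' t x (J (EuclideanSpace.single m 1)) ∘L J)
      (B := J ∘L B.symbolAt e t x (EuclideanSpace.single m 1) - H (EuclideanSpace.single m 1))
      fun q => h1 m q
    exact congrArg (fun A : Vec n →L[ℝ] Vec n => A b) this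
  have := ext_single (A := (B.symbolAt e' t x).flip (J b) ∘L J)
    (B := J ∘L (B.symbolAt e t x).flip b - H.flip b) fun m => h2 m b
  exact congrArg (fun A : Vec n →L[ℝ] Vec n => A a) this

variable [IsManifold (𝓡 n) ∞ M]

variable (n) in
/-- The preferred chart around `x`. -/
def coordAt (x : M) : Coord n M :=
  ⟨chartAt (EuclideanSpace ℝ (Fin n)) x, IsManifold.chart_mem_maximalAtlas x⟩

variable (n) in
theorem mem_coordAt (x : M) : x ∈ (coordAt n x).dom := mem_chart_source _ x

variable (B) in
/-- The connection which at every point is given by the symbols `Γ_{(t)ij}^l` in the preferred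
chart around that point. The transformation rule of the symbols shows that, for `t < k`, the choice
of charts does not matter. -/
def HomogeneousPoissonBracket.standardConnection (t : ℕ) : Connection n M where
  toFun Z x := chartCov (coordAt n x) (B.symbolAt (coordAt n x) t) Z x
  isCovariantDerivativeOnUniv :=
    { add := fun {_ _ x} hZ hW _ =>
        (isCovariantDerivativeOn_chartCov (coordAt n x) (B.symbolAt (coordAt n x) t)).add hZ hW
          (mem_coordAt n x)
      leibniz := fun {_ _ x} hZ hg _ =>
        (isCovariantDerivativeOn_chartCov (coordAt n x) (B.symbolAt (coordAt n x) t)).leibniz hZ hg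
          (mem_coordAt n x) }

/-- The connection with symbols `Γ` in the chart `e` has the symbols `Γ̃` in the chart `e'`. -/
theorem HomogeneousPoissonBracket.Nondegenerate.chartCov_coordField (hB : B.Nondegenerate)
    (e e' : Coord n M) {x : M} (hx : x ∈ e.dom) (hx' : x ∈ e'.dom) {t : ℕ} (ht : t < k)
    (i j : Fin n) :
    chartCov e (B.symbolAt e t) (coordField e' j) x (coordField e' i x) =
      ∑ l, B.christoffel e' t i j l ⟨x, hx'⟩ • coordField e' l x := by
  have hc := contDiffAt_transition e e' hx hx'
  have hcd : DifferentiableAt ℝ (fderiv ℝ (transition e e')) (e.1 x) :=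
    (hc.fderiv_right (m := ∞) (by simp)).differentiableAt (by simp)
  have hzd : DifferentiableAt ℝ (chartRep e (coordField e' j)) (e.1 x) :=
    (mdifferentiableAt_iff_chartRep e hx).1 (mdifferentiableAt_coordField e' j hx')
  -- the field `∂̃_j` is mapped to a constant field by `Dφ`; the derivative of this relation
  have h1 : (fun v => fderiv ℝ (transition e e') v (chartRep e (coordField e' j) v))
      =ᶠ[𝓝 (e.1 x)] fun _ => (EuclideanSpace.single j 1 : Vec n) := by
    filter_upwards [eventually_mem_chart e (inf_le_left : e.dom ⊓ e'.dom ≤ e.dom) ⟨hx, hx'⟩]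
      with v hv
    have h2 := fderiv_transition_mfderiv e e' hv.2.1 hv.2.2 (coordField e' j (e.1.symm v))
    rw [e.1.right_inv hv.1] at h2
    exact h2.trans (mfderiv_coordField e' j hv.2.2)
  have h3 (w : Vec n) : fderiv ℝ (transition e e') (e.1 x)
      (fderiv ℝ (chartRep e (coordField e' j)) (e.1 x) w) +
      fderiv ℝ (fderiv ℝ (transition e e')) (e.1 x) w (chartRep e (coordField e' j) (e.1 x)) = 0 := by
    have h4 := (hcd.hasFDerivAt.clm_apply hzd.hasFDerivAt).fderiv
    rw [h1.fderiv_eq, fderiv_fun_const] at h4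
    exact (congrArg (fun A : Vec n →L[ℝ] Vec n => A w) h4).symm
  obtain ⟨w, hw⟩ : ∃ w : Vec n, w = mfderiv (𝓡 n) (𝓡 n) e.1 x (coordField e' i x) := ⟨_, rfl⟩
  obtain ⟨z, hz⟩ : ∃ z : Vec n, z = mfderiv (𝓡 n) (𝓡 n) e.1 x (coordField e' j x) := ⟨_, rfl⟩
  have hw' : fderiv ℝ (transition e e') (e.1 x) w = EuclideanSpace.single i 1 := by
    rw [hw]
    exact (fderiv_transition_mfderiv e e' hx hx' _).trans (mfderiv_coordField e' i hx')
  have hz' : fderiv ℝ (transition e e') (e.1 x) z = EuclideanSpace.single j 1 := by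
    rw [hz]
    exact (fderiv_transition_mfderiv e e' hx hx' _).trans (mfderiv_coordField e' j hx')
  have h5 := mfderiv_chartCov e (B.symbolAt e t) (Z := coordField e' j) hx (coordField e' i x)
  rw [← hw, ← hz] at h5
  have h6 := h3 w
  rw [chartRep_apply e _ hx, ← hz] at h6
  have h7 := hB.symbolAt_transform e e' hx hx' ht w z
  rw [hw', hz', hB.symbolAt_single e' t ⟨x, hx'⟩] at h7
  refine tangent_ext e' hx' ?_
  rw [← fderiv_transition_mfderiv e e' hx hx', h5, map_sum]
  refine (map_add _ _ _).trans ?_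
  have h8 (p q r s : Vec n) (hp : p + r = 0) (hs : s = q - r) : p + q = s := by
    rw [hs, eq_neg_of_add_eq_zero_left hp, neg_add_eq_sub]
  refine (h8 _ _ _ _ h6 h7).trans ?_
  refine Finset.sum_congr rfl fun l _ => ?_
  exact ((map_smul (mfderiv (𝓡 n) (𝓡 n) e'.1 x) _ _).trans
    (congrArg (B.christoffel e' t i j l ⟨x, hx'⟩ • ·) (mfderiv_coordField e' l hx'))).symm

theorem HomogeneousPoissonBracket.Nondegenerate.isStandardConnection (hB : B.Nondegenerate)
    {t : ℕ} (ht : t < k) : IsStandardConnection B t (B.standardConnection t) :=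
  fun e i j x => hB.chartCov_coordField (coordAt n x.1) e (mem_coordAt n x.1) x.2 ht i j

/-- Flatness of `∇^{[s]}`: in each chart its symbols are `B.flatFun e s`. -/
theorem HomogeneousPoissonBracket.Nondegenerate.isFlat_quadConnection (hB : B.Nondegenerate)
    {nabla : ℕ → Connection n M} (hn : ∀ t < k, IsStandardConnection B t (nabla t)) {s : ℕ}
    (hs : s < k) : IsFlat (quadConnection k s nabla) := by
  intro U X Y Z hX hY hZ x hxU
  set e := coordAt n x
  have hx : x ∈ e.dom := mem_coordAt n x
  have hsymb : ∀ y ∈ e.dom, ∀ i j, quadConnection k s nabla (coordField e j) y (coordField e i y) =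
      ∑ l, extendZero (B.flatFun e s i j l) y • coordField e l y := by
    intro y hy i j
    have h1 : quadConnection k s nabla (coordField e j) y (coordField e i y) =
        ∑ t ∈ Finset.range (s + 1),
          flatCoeff k s t • nabla t (coordField e j) y (coordField e i y) := by
      change (∑ t ∈ Finset.range (s + 1), flatCoeff k s t • nabla t (coordField e j) y) _ = _
      rw [_root_.sum_apply]
      rfl
    have h2 (l : Fin n) : extendZero (B.flatFun e s i j l) y =
        ∑ t ∈ Finset.range (s + 1), flatCoeff k s t * B.christoffel e t i j l ⟨y, hy⟩ := by
      rw [extendZero_apply _ (⟨y, hy⟩ : e.dom), ← evalAt_apply, HomogeneousPoissonBracket.flatFun,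
        map_sum]
      exact Finset.sum_congr rfl fun t _ => by
        rw [← hB.christoffelFun_apply]
        rfl
    simp only [h1, h2, Finset.sum_smul]
    rw [Finset.sum_comm]
    refine Finset.sum_congr rfl fun t ht => ?_
    have htk : t < k := by
      have := Finset.mem_range.1 ht
      omega
    rw [hn t htk e i j ⟨y, hy⟩, Finset.smul_sum]
    exact Finset.sum_congr rfl fun l _ => smul_smul _ _ _
  set γ : Fin n → Fin n → Fin n → Vec n → ℝ :=
    fun i j l => extendZero (B.flatFun e s i j l) ∘ e.1.symm with hγ
  have hγd (i j l : Fin n) : DifferentiableAt ℝ (γ i j l) (e.1 x) :=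
    (contDiffAt_extendZero e le_rfl (B.flatFun e s i j l) hx).differentiableAt (by simp)
  have hγx (i j l : Fin n) : γ i j l (e.1 x) = B.flatFun e s i j l ⟨x, hx⟩ := by
    rw [hγ]
    dsimp only
    rw [Function.comp_apply, e.1.left_inv hx, extendZero_apply _ (⟨x, hx⟩ : e.dom)]
  obtain ⟨L, hL, hL'⟩ := hasFDerivAt_symbolMap hγd
  refine curvature_eq_zero_of_chart e (G := fun v => symbolMap fun i j l => γ i j l v) ?_ hx
    hL.differentiableAt ?_ hxU hX hY hZ
  · intro y hy W hW
    rw [connection_eq_chartCov e hsymb hy hW]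
    have : ∀ i j l, γ i j l (e.1 y) = extendZero (B.flatFun e s i j l) y := fun i j l => by
      rw [hγ]
      dsimp only
      rw [Function.comp_apply, e.1.left_inv hy]
    ext v
    refine tangent_ext e hy ?_
    rw [mfderiv_chartCov e _ hy, mfderiv_chartCov e _ hy]
    simp only [this]
    rfl
  · rw [hL.fderiv]
    refine curvatureForm_eq_zero (dγ := fun a i j l => fderiv ℝ (γ i j l) (e.1 x)
      (EuclideanSpace.single a 1)) (fun a => hL' _) fun a b q l => ?_
    have h := congrArg (evalAt (n := n) (⟨x, hx⟩ : e.dom)) (hB.curvatureSymbol_flatFun e hs a b q l)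
    simp only [curvatureSymbol, map_add, map_sub, map_sum, map_mul, map_zero, evalAt_apply] at h
    simp only [hγx]
    exact h

end StandardConnections

end LocalPoisson

end

open LocalPoisson in
theorem mainTheorem1 (n k : ℕ) (hk : 1 ≤ k) (M : Type*) [TopologicalSpace M]
    [ChartedSpace (EuclideanSpace ℝ (Fin n)) M] [IsManifold (𝓡 n) ∞ M]
    (B : HomogeneousPoissonBracket n k M) (hB : B.Nondegenerate) :
    (∃ nabla : ℕ → Connection n M, ∀ t < k, IsStandardConnection B t (nabla t)) ∧
    ∀ nabla : ℕ → Connection n M, (∀ t < k, IsStandardConnection B t (nabla t)) →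
      ∀ s < k, IsFlat (quadConnection k s nabla) :=
  ⟨⟨B.standardConnection, fun _ ht => hB.isStandardConnection ht⟩,
    fun _ hn _ hs => hB.isFlat_quadConnection hn hs⟩
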